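/- Let $k$ be a field and let $K$ be a simplicial complex on the vertex set $[m]=\{1,\dots,m\}$ with $\{i\}\in K$ for all $i\in[m]$. Let $S=k[v_1,\dots,v_m]$ with the standard grading, and let $I_K\subseteq S$ be the Stanley–Reisner ideal, generated by the monomials $\prod_{i\in\sigma}v_i$ with $\sigma\subseteq[m]$, $\sigma\notin K$. Assume that $K$ is Gorenstein$^*$ over $k$, that is, the Stanley–Reisner ring $k[K]=S/I_K$ is a Gorenstein ring and $K$ is not a cone, and assume that $K$ is not the boundary $\partial\Delta^{m-1}$ of the simplex on $[m]$ (the complex of all proper subsets of $[m]$). Let $n-1=\dim K$. Then $I_K$ has an almost linear resolution if and only if $K$ is odd-dimensional (that is, $n-1$ is odd) and neighbourly. Here $I_K$ has an almost linear resolution if there is an integer $d$ such that $I_K$ is generated in degree $d$ and its graded Betti numbers (the numbers $\beta_{i,j}(I_K)=\dim_k\operatorname{Tor}^S_i(I_K,k)_j$ of summands $S(-j)$ in the $i$-th module of the minimal graded free resolution of $I_K$ over $S$) satisfy $\beta_{i,j}(I_K)=0$ for all $i<\operatorname{projdim}_S(I_K)$ and all $j\neq i+d$; and $K$ is neighbourly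 if every set of $\lfloor n/2\rfloor$ vertices is a face of $K$. -/

import Mathlib

open CategoryTheory

/-! ## Commutative algebra -/

/-- A commutative ring is Gorenstein if it is Noetherian and each of its localizations at a prime
ideal has finite injective dimension as a module over itself. -/
def IsGorensteinRing (R : Type*) [CommRing R] : Prop :=
  IsNoetherianRing R ∧ ∀ (P : Ideal R) [P.IsPrime], ∃ n : ℕ,
    HasInjectiveDimensionLE (ModuleCat.of (Localization.AtPrime P) (Localization.AtPrime P)) n

/-- A minimal graded free resolution
`⋯ → F₂ → F₁ → F₀ → I → 0` of an ideal `I` of the standard graded polynomial ring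
`S = k[v₁, …, vₘ]`, given by homogeneous bases and matrices.  The module `F i` is
`⨁ a : Fin (rank i), S(-deg i a)`. -/
structure MinimalGradedFreeResolution {k : Type*} [Field k] {m : ℕ}
    (I : Ideal (MvPolynomial (Fin m) k)) where
  /-- the rank of `F i` -/
  rank : ℕ → ℕ
  /-- the degrees of the elements of the homogeneous basis of `F i` -/
  deg : (i : ℕ) → Fin (rank i) → ℕ
  /-- the images in `I` of the basis elements of `F 0` -/
  gen : Fin (rank 0) → MvPolynomial (Fin m) k
  /-- the matrix of the differential `F (i + 1) → F i` -/
  d : (i : ℕ) → Matrix (Fin (rank i)) (Fin (rank (i + 1))) (MvPolynomial (Fin m) k)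
  /-- the augmentation preserves degrees -/
  gen_homogeneous : ∀ a, (gen a).IsHomogeneous (deg 0 a)
  /-- the differentials preserve degrees -/
  d_homogeneous : ∀ i a b, d i a b ≠ 0 →
    ∃ e : ℕ, deg i a + e = deg (i + 1) b ∧ (d i a b).IsHomogeneous e
  /-- the augmentation maps onto `I` -/
  range_aug : LinearMap.range (Fintype.linearCombination (MvPolynomial (Fin m) k) gen) = I
  /-- exactness at `F 0` -/
  exact_zero : LinearMap.range (d 0).mulVecLin =
    LinearMap.ker (Fintype.linearCombination (MvPolynomial (Fin m) k) gen)
  /-- exactness at `F (i + 1)` -/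
  exact_succ : ∀ i, LinearMap.range (d (i + 1)).mulVecLin = LinearMap.ker (d i).mulVecLin
  /-- minimality: the entries of the differentials lie in the ideal `(v₁, …, vₘ)` -/
  minimal : ∀ i a b, MvPolynomial.constantCoeff (d i a b) = 0

/-- The graded Betti number `β_{i,j}`, the number of summands `S(-j)` of `F i`. -/
def MinimalGradedFreeResolution.betti {k : Type*} [Field k] {m : ℕ}
    {I : Ideal (MvPolynomial (Fin m) k)} (F : MinimalGradedFreeResolution I) (i j : ℕ) : ℕ :=
  (Finset.univ.filter fun a : Fin (F.rank i) => F.deg i a = j).card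

/-- The ideal `I` is generated by homogeneous polynomials of degree `d`. -/
def IsGeneratedInDegree {k : Type*} [Field k] {m : ℕ}
    (I : Ideal (MvPolynomial (Fin m) k)) (d : ℕ) : Prop :=
  Ideal.span {f | f ∈ I ∧ f.IsHomogeneous d} = I

/-- Condition `N_{d,p}`: the ideal is generated in degree `d` and its minimal graded free
resolution (which is unique up to isomorphism) is linear in the first `p` steps, that is,
`β_{i,j} = 0` for `j ≠ i + d` when `i < p`. -/
def SatisfiesN {k : Type*} [Field k] {m : ℕ}
    (I : Ideal (MvPolynomial (Fin m) k)) (d : ℕ) (p : WithBot ℕ∞) : Prop :=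
  IsGeneratedInDegree I d ∧ ∃ F : MinimalGradedFreeResolution I,
    ∀ i : ℕ, (i : WithBot ℕ∞) < p → ∀ j : ℕ, j ≠ i + d → F.betti i j = 0

/-- The ideal has an almost linear resolution: it satisfies `N_{d,p}` for some `d`, where `p` is
its projective dimension as an `S`-module. -/
def HasAlmostLinearResolution {k : Type*} [Field k] {m : ℕ}
    (I : Ideal (MvPolynomial (Fin m) k)) : Prop :=
  ∃ d : ℕ, SatisfiesN I d (projectiveDimension (ModuleCat.of (MvPolynomial (Fin m) k) I))

/-! ## Simplicial complexes on the vertex set `Fin m`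

Mathlib's `AbstractSimplicialComplex` contains all singletons (there are no ghost vertices) and
records the nonempty faces only; the empty set is a face by convention. -/

/-- The faces of `K`, including the empty face. -/
def IsFace {m : ℕ} (K : AbstractSimplicialComplex (Fin m)) (σ : Finset (Fin m)) : Prop :=
  σ = ∅ ∨ σ ∈ K.faces

open Classical in
/-- The largest number of vertices of a face of `K`. -/
noncomputable def maxFaceCard {m : ℕ} (K : AbstractSimplicialComplex (Fin m)) : ℕ :=
  (Finset.univ.filter fun σ : Finset (Fin m) => IsFace K σ).sup Finset.card

/-- The dimension of `K`. -/
noncomputable def complexDim {m : ℕ} (K : AbstractSimplicialComplex (Fin m)) : ℤ :=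
  (maxFaceCard K : ℤ) - 1

/-- `K` is a cone: some vertex can be added to every face. -/
def IsCone {m : ℕ} (K : AbstractSimplicialComplex (Fin m)) : Prop :=
  ∃ v : Fin m, ∀ σ : Finset (Fin m), IsFace K σ → IsFace K (insert v σ)

/-- `K = ∂Δ^{m-1}`: the faces of `K` are the proper subsets of the vertex set. -/
def IsSimplexBoundary {m : ℕ} (K : AbstractSimplicialComplex (Fin m)) : Prop :=
  ∀ σ : Finset (Fin m), IsFace K σ ↔ σ ≠ Finset.univ

/-- An `(n-1)`-dimensional complex is neighbourly if every set of `⌊n/2⌋` vertices is a face. -/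
def IsNeighbourly {m : ℕ} (K : AbstractSimplicialComplex (Fin m)) : Prop :=
  ∀ σ : Finset (Fin m), σ.card = maxFaceCard K / 2 → IsFace K σ

/-- The Stanley–Reisner ideal, generated by the squarefree monomials of the non-faces. -/
noncomputable def stanleyReisnerIdeal (k : Type*) [Field k] {m : ℕ}
    (K : AbstractSimplicialComplex (Fin m)) : Ideal (MvPolynomial (Fin m) k) :=
  Ideal.span {f | ∃ σ : Finset (Fin m), ¬ IsFace K σ ∧ f = ∏ i ∈ σ, MvPolynomial.X i}

/-- `K` is Gorenstein* over `k`: its Stanley–Reisner ring over `k` is a Gorenstein ring, and `K`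
is not a cone. -/
def IsGorensteinStar (k : Type*) [Field k] {m : ℕ}
    (K : AbstractSimplicialComplex (Fin m)) : Prop :=
  IsGorensteinRing (MvPolynomial (Fin m) k ⧸ stanleyReisnerIdeal k K) ∧ ¬ IsCone K

-- Write n for the largest size of a face and I for the Stanley–Reisner ideal. For a Gorenstein ring
-- `S ⧸ I` with I nonzero, the minimal free resolution has length m - n, its last module has rank
-- one, and its dual is exact except at the last spot (`IsResolution.gorenstein`). Consequently the
-- entries of the last matrix generate I, exactly as those of the first one do
-- (`IsResolution.entryIdeal_last`). Since K is not a cone, the last basis element has multidegree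
-- (1, …, 1), hence degree m (`SqResolution.deg_last_eq_univ`). Since K is not the boundary of a
-- simplex, the first and the last matrix are different (`SqResolution.isSimplexBoundary`).
--
-- Suppose the resolution is almost linear with generators of degree d. The last module but one is
-- generated in degree d + (m - n - 2), and the last step adds d by duality, so m = 2d + m - n - 2.
-- Thus n = 2(d - 1) is even, and nonfaces have at least d = n/2 + 1 elements. Conversely, let n =
-- 2e and let all nonfaces have at least e + 1 elements. Degrees grow by at least one at each step,
-- so the first matrix bounds all degrees from below and the last matrix bounds them from above. In
-- the linear range the two bounds coincide (`SqResolution.le_card_deg_of_le`,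
-- `SqResolution.card_deg_add_le`).
--
-- The Gorenstein property is used at the irrelevant ideal only, where it gives a local ring A of
-- finite injective dimension with residue field κ. The dual into A of a resolution of κ over S has
-- cohomology killed by the maximal ideal. Comparing `Ext (-, A)` of its cokernels shows that the
-- last t with Ext^t_A(κ, A) nonzero is also the first nonvanishing degree of that cohomology, which
-- is simple there (`exact_and_cohom_equiv_residueField`). A largest face gives t ≥ n. Following
-- `Ext (κ, -)` along the resolution of `S ⧸ I` (`IsResolution.ext_localized`) shows that its length
-- is m - t and its last rank is one. The vanishing of Ext^j(`S ⧸ I`, S) for j < m - n, obtained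
-- from a filtration by the primes of the faces, forces t = n and the exactness of the dual.
--
-- The resolution in the definition of almost linearity is arbitrary, whereas multidegrees are
-- available for a specially constructed squarefree one. The two are compared through Hilbert
-- functions only (`MinimalGradedFreeResolution.eulerSum_single_eq`).

universe u

/-! ## Long exact sequences of `Ext` for modules, in unbundled form -/

section ExtModule

open Abelian

variable {R : Type u} [CommRing R]

/-- `0 → X₁ → X₂ → X₃ → 0` is exact. -/
structure IsShortExact {X₁ X₂ X₃ : Type*} [AddCommGroup X₁] [AddCommGroup X₂] [AddCommGroup X₃]
    [Module R X₁] [Module R X₂] [Module R X₃] (f : X₁ →ₗ[R] X₂) (g : X₂ →ₗ[R] X₃) : Prop where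
  inj : Function.Injective f
  exact : Function.Exact f g
  surj : Function.Surjective g

variable (R) in
/-- `Ext` of modules over a commutative ring. -/
abbrev ExtM (M N : Type u) [AddCommGroup M] [Module R M] [AddCommGroup N] [Module R N] (n : ℕ) :=
  Ext (ModuleCat.of R M) (ModuleCat.of R N) n

variable {M M' M'' N X₁ X₂ X₃ : Type u} [AddCommGroup M] [Module R M] [AddCommGroup N] [Module R N]
  [AddCommGroup M'] [Module R M'] [AddCommGroup M''] [Module R M'']
  [AddCommGroup X₁] [AddCommGroup X₂] [AddCommGroup X₃]
  [Module R X₁] [Module R X₂] [Module R X₃]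

/-- Contravariant functoriality of `Ext`. -/
noncomputable def extPre (f : M →ₗ[R] M') (N : Type u) [AddCommGroup N] [Module R N] (n : ℕ) :
    ExtM R M' N n →ₗ[R] ExtM R M N n :=
  Ext.precompOfLinear (Ext.mk₀ (ModuleCat.ofHom f)) R (ModuleCat.of R N) (zero_add n)

/-- Covariant functoriality of `Ext`. -/
noncomputable def extPost (M : Type u) [AddCommGroup M] [Module R M] (f : N →ₗ[R] M') (n : ℕ) :
    ExtM R M N n →ₗ[R] ExtM R M M' n :=
  Ext.postcompOfLinear (Ext.mk₀ (ModuleCat.ofHom f)) R (ModuleCat.of R M) (add_zero n)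

lemma extPre_apply (f : M →ₗ[R] M') (n : ℕ) (x : ExtM R M' N n) :
    extPre f N n x = (Ext.mk₀ (ModuleCat.ofHom f)).comp x (zero_add n) := rfl

lemma extPost_apply (f : N →ₗ[R] M') (n : ℕ) (x : ExtM R M N n) :
    extPost M f n x = x.comp (Ext.mk₀ (ModuleCat.ofHom f)) (add_zero n) := rfl

lemma extPre_comp (f : M →ₗ[R] M') (g : M' →ₗ[R] M'') (n : ℕ) (x : ExtM R M'' N n) :
    extPre (g ∘ₗ f) N n x = extPre f N n (extPre g N n x) := by
  rw [extPre_apply, ModuleCat.ofHom_comp, ← Ext.mk₀_comp_mk₀_assoc]; rfl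

lemma extPost_comp (f : N →ₗ[R] M') (g : M' →ₗ[R] M'') (n : ℕ) (x : ExtM R M N n) :
    extPost M (g ∘ₗ f) n x = extPost M g n (extPost M f n x) := by
  simp only [extPost_apply, ModuleCat.ofHom_comp, ← Ext.mk₀_comp_mk₀]
  rw [Ext.comp_assoc_of_second_deg_zero]

lemma extPre_smul_id (r : R) (n : ℕ) (x : ExtM R M N n) :
    extPre (r • LinearMap.id) N n x = r • x := by
  have : ModuleCat.ofHom (r • LinearMap.id : M →ₗ[R] M) = r • 𝟙 (ModuleCat.of R M) := rfl
  rw [extPre_apply, this, Ext.mk₀_smul, Ext.smul_comp, Ext.mk₀_id_comp]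

lemma extPost_smul_id (r : R) (n : ℕ) (x : ExtM R M N n) :
    extPost M (r • LinearMap.id) n x = r • x := by
  have : ModuleCat.ofHom (r • LinearMap.id : N →ₗ[R] N) = r • 𝟙 (ModuleCat.of R N) := rfl
  rw [extPost_apply, this, Ext.mk₀_smul, Ext.comp_smul, Ext.comp_mk₀_id]

lemma extPre_id (n : ℕ) (x : ExtM R M N n) : extPre LinearMap.id N n x = x := by
  simpa using extPre_smul_id (1 : R) n x

lemma extPost_id (n : ℕ) (x : ExtM R M N n) : extPost M LinearMap.id n x = x := by
  simpa using extPost_smul_id (1 : R) n x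

lemma extPre_zero (n : ℕ) (x : ExtM R M' N n) : extPre (0 : M →ₗ[R] M') N n x = 0 := by
  have : ModuleCat.ofHom (0 : M →ₗ[R] M') = 0 := rfl
  rw [extPre_apply, this, Ext.mk₀_zero, Ext.zero_comp]

lemma extPost_zero (n : ℕ) (x : ExtM R M N n) : extPost M (0 : N →ₗ[R] M') n x = 0 := by
  have : ModuleCat.ofHom (0 : N →ₗ[R] M') = 0 := rfl
  rw [extPost_apply, this, Ext.mk₀_zero, Ext.comp_zero]

lemma extPost_add (f g : N →ₗ[R] M') (n : ℕ) (x : ExtM R M N n) :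
    extPost M (f + g) n x = extPost M f n x + extPost M g n x := by
  have : ModuleCat.ofHom (f + g) = ModuleCat.ofHom f + ModuleCat.ofHom g := rfl
  rw [extPost_apply, this, Ext.mk₀_add, Ext.comp_add]; rfl

/-- A linear equivalence in the first variable induces one on `Ext`. -/
noncomputable def extPreEquiv (e : M ≃ₗ[R] M') (N : Type u) [AddCommGroup N] [Module R N] (n : ℕ) :
    ExtM R M' N n ≃ₗ[R] ExtM R M N n :=
  LinearEquiv.ofLinearMap (extPre e.toLinearMap N n) (extPre e.symm.toLinearMap N n)
    (by ext x; simp [← extPre_comp, extPre_id]) (by ext x; simp [← extPre_comp, extPre_id])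

/-- A linear equivalence in the second variable induces one on `Ext`. -/
noncomputable def extPostEquiv (M : Type u) [AddCommGroup M] [Module R M] (e : N ≃ₗ[R] M') (n : ℕ) :
    ExtM R M N n ≃ₗ[R] ExtM R M M' n :=
  LinearEquiv.ofLinearMap (extPost M e.toLinearMap n) (extPost M e.symm.toLinearMap n)
    (by ext x; simp [← extPost_comp, extPost_id]) (by ext x; simp [← extPost_comp, extPost_id])

/-- The scalar action on `Ext` can be computed in the first variable, where it is already zero. -/
lemma smul_ext_eq_zero_of_left {r : R} (hr : ∀ x : M, r • x = 0) (n : ℕ) (x : ExtM R M N n) :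
    r • x = 0 := by
  rw [← extPre_smul_id, show (r • LinearMap.id : M →ₗ[R] M) = 0 from LinearMap.ext hr, extPre_zero]

variable {f : X₁ →ₗ[R] X₂} {g : X₂ →ₗ[R] X₃}

lemma IsShortExact.comp_eq_zero (h : IsShortExact f g) : g ∘ₗ f = 0 :=
  h.exact.linearMap_comp_eq_zero

lemma IsShortExact.shortExact (h : IsShortExact f g) :
    (ModuleCat.shortComplexOfCompEqZero f g h.comp_eq_zero).ShortExact :=
  ModuleCat.shortComplex_shortExact _ h.exact h.inj h.surj

/-- The connecting map of the contravariant long exact sequence. -/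
noncomputable def IsShortExact.extδ (h : IsShortExact f g) (N : Type u) [AddCommGroup N]
    [Module R N] (n : ℕ) : ExtM R X₁ N n →ₗ[R] ExtM R X₃ N (n + 1) :=
  Ext.precompOfLinear h.shortExact.extClass R (ModuleCat.of R N) (add_comm 1 n)

lemma IsShortExact.exact_pre (h : IsShortExact f g) (n : ℕ) :
    Function.Exact (extPre g N n) (extPre f N n) := by
  intro x
  constructor
  · intro hx
    obtain ⟨y, hy⟩ := Ext.contravariant_sequence_exact₂ h.shortExact (ModuleCat.of R N) x hx
    exact ⟨y, hy⟩
  · rintro ⟨y, rfl⟩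
    rw [← extPre_comp, h.comp_eq_zero, extPre_zero]

lemma IsShortExact.exact_pre_δ (h : IsShortExact f g) (n : ℕ) :
    Function.Exact (extPre f N n) (h.extδ N n) := by
  intro x
  constructor
  · intro hx
    obtain ⟨y, hy⟩ := Ext.contravariant_sequence_exact₁ h.shortExact (ModuleCat.of R N) x
      (add_comm 1 n) hx
    exact ⟨y, hy⟩
  · rintro ⟨y, rfl⟩
    exact h.shortExact.extClass_comp_assoc y (h := add_comm 1 n)

lemma IsShortExact.exact_δ_pre (h : IsShortExact f g) (n : ℕ) :
    Function.Exact (h.extδ N n) (extPre g N (n + 1)) := by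
  intro x
  constructor
  · intro hx
    obtain ⟨y, hy⟩ := Ext.contravariant_sequence_exact₃ h.shortExact (ModuleCat.of R N) x hx
      (add_comm 1 n)
    exact ⟨y, hy⟩
  · rintro ⟨y, rfl⟩
    exact h.shortExact.comp_extClass_assoc y (add_comm 1 n)

/-- The connecting map of the covariant long exact sequence. -/
noncomputable def IsShortExact.extδ' (h : IsShortExact f g) (M : Type u) [AddCommGroup M]
    [Module R M] (n : ℕ) : ExtM R M X₃ n →ₗ[R] ExtM R M X₁ (n + 1) :=
  Ext.postcompOfLinear h.shortExact.extClass R (ModuleCat.of R M) rfl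

lemma IsShortExact.exact_post (h : IsShortExact f g) (n : ℕ) :
    Function.Exact (extPost M f n) (extPost M g n) := by
  intro x
  constructor
  · intro hx
    obtain ⟨y, hy⟩ := Ext.covariant_sequence_exact₂ (ModuleCat.of R M) h.shortExact x hx
    exact ⟨y, hy⟩
  · rintro ⟨y, rfl⟩
    rw [← extPost_comp, h.comp_eq_zero, extPost_zero]

lemma IsShortExact.exact_post_δ (h : IsShortExact f g) (n : ℕ) :
    Function.Exact (extPost M g n) (h.extδ' M n) := by
  intro x
  constructor
  · intro hx
    obtain ⟨y, hy⟩ := Ext.covariant_sequence_exact₃ (ModuleCat.of R M) h.shortExact x rfl hx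
    exact ⟨y, hy⟩
  · rintro ⟨y, rfl⟩
    change (Ext.comp y (Ext.mk₀ (ModuleCat.ofHom g)) (add_zero n)).comp h.shortExact.extClass rfl = 0
    rw [Ext.comp_assoc_of_second_deg_zero]
    exact (congrArg (fun z ↦ Ext.comp y z rfl) h.shortExact.comp_extClass).trans (Ext.comp_zero ..)

lemma IsShortExact.exact_δ_post (h : IsShortExact f g) (n : ℕ) :
    Function.Exact (h.extδ' M n) (extPost M f (n + 1)) := by
  intro x
  constructor
  · intro hx
    obtain ⟨y, hy⟩ := Ext.covariant_sequence_exact₁ (ModuleCat.of R M) h.shortExact x hx rfl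
    exact ⟨y, hy⟩
  · rintro ⟨y, rfl⟩
    change (Ext.comp y h.shortExact.extClass rfl).comp (Ext.mk₀ (ModuleCat.ofHom f)) (add_zero _) = 0
    rw [Ext.comp_assoc_of_third_deg_zero]
    exact (congrArg (fun z ↦ Ext.comp y z rfl) h.shortExact.extClass_comp).trans (Ext.comp_zero ..)

lemma Function.Exact.injective_of_subsingleton_left {A B C : Type*} [AddCommGroup A]
    [AddCommGroup B] [AddCommGroup C] [Module R A] [Module R B] [Module R C]
    {a : A →ₗ[R] B} {b : B →ₗ[R] C} (h : Function.Exact a b) [Subsingleton A] :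
    Function.Injective b := by
  rw [injective_iff_map_eq_zero]
  intro x hx
  obtain ⟨y, rfl⟩ := (h x).mp hx
  rw [Subsingleton.elim y 0, map_zero]

lemma Function.Exact.surjective_of_subsingleton_right {A B C : Type*} [AddCommGroup A]
    [AddCommGroup B] [AddCommGroup C] [Module R A] [Module R B] [Module R C]
    {a : A →ₗ[R] B} {b : B →ₗ[R] C} (h : Function.Exact a b) [Subsingleton C] :
    Function.Surjective a :=
  fun x ↦ (h x).mp (Subsingleton.elim _ _)

lemma Function.Exact.subsingleton_mid {A B C : Type*} [AddCommGroup A]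
    [AddCommGroup B] [AddCommGroup C] [Module R A] [Module R B] [Module R C]
    {a : A →ₗ[R] B} {b : B →ₗ[R] C} (h : Function.Exact a b) [Subsingleton A] [Subsingleton C] :
    Subsingleton B :=
  h.injective_of_subsingleton_left.subsingleton

lemma IsShortExact.subsingleton_ext_mid (h : IsShortExact f g) (n : ℕ)
    [Subsingleton (ExtM R X₁ N n)] [Subsingleton (ExtM R X₃ N n)] :
    Subsingleton (ExtM R X₂ N n) :=
  (h.exact_pre n).subsingleton_mid

/-- If `Ext (X₂, N)` vanishes in degrees `n` and `n + 1`, then the connecting map is an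
isomorphism. -/
noncomputable def IsShortExact.extδEquiv (h : IsShortExact f g) (N : Type u) [AddCommGroup N]
    [Module R N] (n : ℕ) [Subsingleton (ExtM R X₂ N n)] [Subsingleton (ExtM R X₂ N (n + 1))] :
    ExtM R X₁ N n ≃ₗ[R] ExtM R X₃ N (n + 1) :=
  LinearEquiv.ofBijective (h.extδ N n) ⟨(h.exact_pre_δ n).injective_of_subsingleton_left,
    (h.exact_δ_pre n).surjective_of_subsingleton_right⟩

/-- If `Ext (X₃, N)` vanishes in degrees `n` and `n + 1`, then restriction along `f` is an
isomorphism. -/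
noncomputable def IsShortExact.extPreEquiv (h : IsShortExact f g) (N : Type u) [AddCommGroup N]
    [Module R N] (n : ℕ) [Subsingleton (ExtM R X₃ N n)] [Subsingleton (ExtM R X₃ N (n + 1))] :
    ExtM R X₂ N n ≃ₗ[R] ExtM R X₁ N n :=
  LinearEquiv.ofBijective (extPre f N n) ⟨(h.exact_pre n).injective_of_subsingleton_left,
    (h.exact_pre_δ n).surjective_of_subsingleton_right⟩

/-- If `Ext (M, X₂)` vanishes in degrees `n` and `n + 1`, then the connecting map is an
isomorphism. -/
noncomputable def IsShortExact.extδEquiv' (h : IsShortExact f g) (M : Type u) [AddCommGroup M]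
    [Module R M] (n : ℕ) [Subsingleton (ExtM R M X₂ n)]
    (h0 : ∀ x : ExtM R M X₁ (n + 1), extPost M f (n + 1) x = 0) :
    ExtM R M X₃ n ≃ₗ[R] ExtM R M X₁ (n + 1) :=
  LinearEquiv.ofBijective (h.extδ' M n) ⟨(h.exact_post_δ n).injective_of_subsingleton_left,
    fun x ↦ (h.exact_δ_post n x).mp (h0 x)⟩

instance subsingleton_extM_of_projective [Module.Projective R M] (n : ℕ) :
    Subsingleton (ExtM R M N (n + 1)) := by
  have : Projective (ModuleCat.of R M) := ModuleCat.projective_of_categoryTheory_projective _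
  exact Ext.subsingleton_of_projective _ _ _

/-- `Ext⁰` is `Hom`. -/
noncomputable def extZeroEquiv (M N : Type u) [AddCommGroup M] [Module R M] [AddCommGroup N]
    [Module R N] : ExtM R M N 0 ≃ₗ[R] (M →ₗ[R] N) :=
  Ext.linearEquiv₀.trans ModuleCat.homLinearEquiv

lemma extZeroEquiv_extPre (f : M →ₗ[R] M') (x : ExtM R M' N 0) :
    extZeroEquiv M N (extPre f N 0 x) = extZeroEquiv M' N x ∘ₗ f := by
  obtain ⟨y, rfl⟩ := (extZeroEquiv M' N).symm.surjective x
  rw [LinearEquiv.apply_symm_apply, ← LinearEquiv.eq_symm_apply]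
  simp [extZeroEquiv, extPre_apply]
  rfl

/-- The map `Hom (X₁, N) → Ext¹ (X₃, N)`. -/
noncomputable def IsShortExact.homToExt (h : IsShortExact f g) (N : Type u) [AddCommGroup N]
    [Module R N] : (X₁ →ₗ[R] N) →ₗ[R] ExtM R X₃ N 1 :=
  h.extδ N 0 ∘ₗ (extZeroEquiv X₁ N).symm.toLinearMap

lemma IsShortExact.homToExt_surjective (h : IsShortExact f g) [Module.Projective R X₂] :
    Function.Surjective (h.homToExt N) :=
  (h.exact_δ_pre 0).surjective_of_subsingleton_right.comp (extZeroEquiv X₁ N).symm.surjective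

lemma IsShortExact.homToExt_eq_zero_iff (h : IsShortExact f g) (φ : X₁ →ₗ[R] N) :
    h.homToExt N φ = 0 ↔ ∃ ψ : X₂ →ₗ[R] N, ψ ∘ₗ f = φ := by
  refine (h.exact_pre_δ 0 _).trans ⟨?_, ?_⟩
  · rintro ⟨y, hy⟩
    refine ⟨extZeroEquiv X₂ N y, ?_⟩
    rw [← extZeroEquiv_extPre, hy]
    exact (extZeroEquiv X₁ N).apply_symm_apply φ
  · rintro ⟨ψ, rfl⟩
    refine ⟨(extZeroEquiv X₂ N).symm ψ, ?_⟩
    rw [LinearEquiv.coe_coe, LinearEquiv.eq_symm_apply, extZeroEquiv_extPre,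
      LinearEquiv.apply_symm_apply]

end ExtModule

/-! ## Cochain complexes of free modules given by matrices -/

section Cochain

variable {A : Type u} [CommRing A] {r : ℕ → ℕ}

/-- The coboundaries of the complex `A^{r 0} → A^{r 1} → ⋯` of row vectors. -/
noncomputable def coboundary (d : ∀ i, Matrix (Fin (r i)) (Fin (r (i + 1))) A) :
    (j : ℕ) → Submodule A (Fin (r j) → A)
  | 0 => ⊥
  | j + 1 => LinearMap.range (d j).vecMulLinear

/-- The cokernel of the differential with target `A^{r j}`. -/
abbrev Coker (d : ∀ i, Matrix (Fin (r i)) (Fin (r (i + 1))) A) (j : ℕ) : Type u :=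
  (Fin (r j) → A) ⧸ coboundary d j

/-- The ideal generated by the entries of a matrix. -/
def entryIdeal {ι κ : Type*} (M : Matrix ι κ A) : Ideal A :=
  Ideal.span {x | ∃ a b, M a b = x}

variable {d : ∀ i, Matrix (Fin (r i)) (Fin (r (i + 1))) A}

lemma coboundary_le_ker (hd : ∀ i, d i * d (i + 1) = 0) (j : ℕ) :
    coboundary d j ≤ LinearMap.ker (d j).vecMulLinear := by
  cases j with
  | zero => exact bot_le
  | succ j =>
    rintro _ ⟨x, rfl⟩
    simp [Matrix.vecMul_vecMul, hd]

lemma vecMul_mem_coboundary (j : ℕ) (x : Fin (r j) → A) :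
    (d j).vecMulLinear x ∈ coboundary d (j + 1) := ⟨x, rfl⟩

/-- The map induced by the differential. -/
noncomputable def cokerMap (hd : ∀ i, d i * d (i + 1) = 0) (j : ℕ) :
    Coker d j →ₗ[A] coboundary d (j + 1) :=
  (coboundary d j).liftQ
    (LinearMap.codRestrict (coboundary d (j + 1)) (d j).vecMulLinear (vecMul_mem_coboundary j)) (by
      rw [LinearMap.ker_codRestrict]; exact coboundary_le_ker hd j)

lemma cokerMap_surjective (hd : ∀ i, d i * d (i + 1) = 0) (j : ℕ) :
    Function.Surjective (cokerMap hd j) := by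
  rintro ⟨_, x, rfl⟩
  exact ⟨Submodule.Quotient.mk x, rfl⟩

lemma cokerMap_mk_eq_zero (hd : ∀ i, d i * d (i + 1) = 0) (j : ℕ) (x : Fin (r j) → A) :
    cokerMap hd j (Submodule.Quotient.mk x) = 0 ↔ x ∈ LinearMap.ker (d j).vecMulLinear := by
  rw [LinearMap.mem_ker, Subtype.ext_iff]; rfl

/-- The cohomology, as a submodule of the cokernel. -/
noncomputable abbrev cohom (hd : ∀ i, d i * d (i + 1) = 0) (j : ℕ) : Submodule A (Coker d j) :=
  LinearMap.ker (cokerMap hd j)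

lemma isShortExact_cohom (hd : ∀ i, d i * d (i + 1) = 0) (j : ℕ) :
    IsShortExact (cohom hd j).subtype (cokerMap hd j) :=
  ⟨Subtype.val_injective, LinearMap.exact_subtype_ker_map _, cokerMap_surjective hd j⟩

lemma isShortExact_coboundary (d : ∀ i, Matrix (Fin (r i)) (Fin (r (i + 1))) A) (j : ℕ) :
    IsShortExact (coboundary d j).subtype (coboundary d j).mkQ :=
  ⟨Subtype.val_injective, LinearMap.exact_subtype_mkQ _, Submodule.mkQ_surjective _⟩

lemma cohom_eq_bot (hd : ∀ i, d i * d (i + 1) = 0) {j : ℕ}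
    (h : LinearMap.ker (d j).vecMulLinear ≤ coboundary d j) : cohom hd j = ⊥ := by
  rw [Submodule.eq_bot_iff]
  intro x hx
  obtain ⟨y, rfl⟩ := Submodule.Quotient.mk_surjective _ x
  rw [Submodule.Quotient.mk_eq_zero]
  exact h ((cokerMap_mk_eq_zero hd j y).mp hx)

/-- At an exact spot, the cokernel is isomorphic to the next coboundaries. -/
noncomputable def cokerEquiv (hd : ∀ i, d i * d (i + 1) = 0) {j : ℕ}
    (h : LinearMap.ker (d j).vecMulLinear ≤ coboundary d j) :
    Coker d j ≃ₗ[A] coboundary d (j + 1) :=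
  LinearEquiv.ofBijective (cokerMap hd j)
    ⟨LinearMap.ker_eq_bot.mp (cohom_eq_bot hd h), cokerMap_surjective hd j⟩

/-- Dimension shift: exactness at j identifies the cokernel with the next coboundaries, which are
the first syzygy of the next cokernel with respect to a free module. -/
lemma nonempty_ext_coker_succ_equiv (hd : ∀ i, d i * d (i + 1) = 0) {j : ℕ}
    (h : LinearMap.ker (d j).vecMulLinear ≤ coboundary d j) (q : ℕ)
    (N : Type u) [AddCommGroup N] [Module A N] :
    Nonempty (ExtM A (Coker d j) N (q + 1) ≃ₗ[A] ExtM A (Coker d (j + 1)) N (q + 1 + 1)) :=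
  ⟨(extPreEquiv (cokerEquiv hd h).symm N (q + 1)).trans
    ((isShortExact_coboundary d (j + 1)).extδEquiv N (q + 1))⟩

lemma nonempty_ext_coker_equiv (hd : ∀ i, d i * d (i + 1) = 0) {s : ℕ}
    (h : ∀ j < s, LinearMap.ker (d j).vecMulLinear ≤ coboundary d j)
    (N : Type u) [AddCommGroup N] [Module A N] (j q : ℕ) (hj : j + q ≤ s) (p : ℕ) :
    Nonempty (ExtM A (Coker d j) N (p + 1) ≃ₗ[A] ExtM A (Coker d (j + q)) N (q + p + 1)) := by
  induction q with
  | zero => rw [zero_add]; exact ⟨LinearEquiv.refl _ _⟩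
  | succ q ih =>
    obtain ⟨e⟩ := ih (by omega)
    obtain ⟨e'⟩ := nonempty_ext_coker_succ_equiv hd (h (j + q) (by omega)) (q + p) N
    rw [show q + 1 + p + 1 = q + p + 1 + 1 by omega]
    exact ⟨e.trans e'⟩

/-- If the complex is exact at the spots `< s`, `s ≥ 1`, then
`Ext^s (Coker d s, A) = A / (entries of d 0)`. -/
lemma exists_surjective_ext_coker (hd : ∀ i, d i * d (i + 1) = 0) {s : ℕ} (hr : r 0 = 1)
    (h : ∀ j < s, LinearMap.ker (d j).vecMulLinear ≤ coboundary d j) (hs : 1 ≤ s) :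
    ∃ f : A →ₗ[A] ExtM A (Coker d s) A s, Function.Surjective f ∧
      LinearMap.ker f = entryIdeal (d 0) := by
  obtain ⟨s, rfl⟩ := Nat.exists_eq_add_of_le hs
  obtain ⟨e⟩ := nonempty_ext_coker_equiv hd h A 1 s le_rfl 0
  have hu : ∀ a b : Fin (r 0), a = b := by rw [hr]; exact fun a b ↦ Subsingleton.elim a b
  let z : Fin (r 0) := ⟨0, by omega⟩
  -- Exactness at spot 0 makes `d 0` injective on row vectors, so the first coboundaries are free of
  -- rank one and every linear form on them is a scalar multiple of one coordinate.
  let e₀ : (Fin (r 0) → A) ≃ₗ[A] coboundary d 1 :=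
    (Submodule.quotEquivOfEqBot (coboundary d 0) rfl).symm.trans (cokerEquiv hd (h 0 (by omega)))
  have he₀ : ∀ x, (e₀ x : Fin (r 1) → A) = (d 0).vecMulLinear x := fun x ↦ rfl
  let φ : A →ₗ[A] (coboundary d 1 →ₗ[A] A) :=
    { toFun := fun a ↦ a • (LinearMap.proj z ∘ₗ e₀.symm.toLinearMap)
      map_add' := fun a b ↦ add_smul _ _ _
      map_smul' := fun a b ↦ mul_smul _ _ _ }
  have hφ : Function.Surjective φ := by
    intro ψ
    refine ⟨ψ (e₀ (Pi.single z 1)), LinearMap.ext fun x ↦ ?_⟩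
    obtain ⟨y, rfl⟩ := e₀.surjective x
    have hy : y = y z • Pi.single z 1 := by
      ext a; rw [hu a z]; simp
    conv_rhs => rw [hy, map_smul, map_smul]
    simp [φ, mul_comm]
  let δ := (isShortExact_coboundary d 1).homToExt A
  have hδ : Function.Surjective δ := (isShortExact_coboundary d 1).homToExt_surjective
  -- The form with scalar a extends from the coboundaries to the whole free module iff a is a linear
  -- combination of the entries of the single row `d 0`.
  have key : LinearMap.ker (δ ∘ₗ φ) = entryIdeal (d 0) := by
    ext a
    rw [LinearMap.mem_ker, LinearMap.comp_apply, IsShortExact.homToExt_eq_zero_iff]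
    constructor
    · rintro ⟨ψ, hψ⟩
      have h1 := LinearMap.congr_fun hψ (e₀ (Pi.single z 1))
      have h2 : φ a (e₀ (Pi.single z 1)) = a := by simp [φ]
      rw [h2] at h1
      rw [← h1, LinearMap.comp_apply, Submodule.subtype_apply, he₀,
        LinearMap.pi_apply_eq_sum_univ ψ]
      refine Submodule.sum_mem _ fun b _ ↦ ?_
      rw [smul_eq_mul]
      refine Ideal.mul_mem_right _ _ (Ideal.subset_span ⟨z, b, ?_⟩)
      simp
    · intro ha
      refine Submodule.span_induction ?_ ⟨0, by simp⟩ ?_ ?_ ha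
      · rintro _ ⟨a, b, rfl⟩
        obtain rfl := hu a z
        refine ⟨LinearMap.proj b, LinearMap.ext fun x ↦ ?_⟩
        obtain ⟨y, rfl⟩ := e₀.surjective x
        have hy : y = y z • Pi.single z 1 := by
          ext a; rw [hu a z]; simp
        rw [LinearMap.comp_apply, Submodule.subtype_apply, he₀]
        conv_lhs => rw [hy]
        simp [φ, mul_comm, z]
      · rintro x y - - ⟨ψ, hψ⟩ ⟨ψ', hψ'⟩
        exact ⟨ψ + ψ', by rw [map_add, ← hψ, ← hψ', LinearMap.add_comp]⟩
      · rintro c x - ⟨ψ, hψ⟩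
        exact ⟨c • ψ, by rw [map_smul, ← hψ, LinearMap.smul_comp]⟩
  have hs1 : 1 + s = s + 0 + 1 := by omega
  have e' : ExtM A (Coker d 1) A 1 ≃ₗ[A] ExtM A (Coker d (1 + s)) A (1 + s) :=
    cast (by rw [show s + 0 + 1 = 1 + s by omega]) e
  refine ⟨e'.toLinearMap ∘ₗ δ ∘ₗ φ, e'.surjective.comp (hδ.comp hφ), ?_⟩
  rw [LinearEquiv.ker_comp, key]

end Cochain

/-! ## `Ext` of modules killed by the maximal ideal of a local ring -/

section Local

variable {A : Type u} [CommRing A]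

lemma subsingleton_ext_of_subsingleton (M N : Type u) [AddCommGroup M] [Module A M]
    [AddCommGroup N] [Module A N] [Subsingleton M] (n : ℕ) : Subsingleton (ExtM A M N n) := by
  refine ⟨fun x y ↦ ?_⟩
  rw [← extPre_id n x, ← extPre_id n y, Subsingleton.elim (LinearMap.id : M →ₗ[A] M) 0,
    extPre_zero, extPre_zero]

/-- The sequence `0 → V → V^{b+1} → V^b → 0`. -/
lemma isShortExact_fin_succ (V : Type*) [AddCommGroup V] [Module A V] (b : ℕ) :
    IsShortExact (LinearMap.single A (fun _ : Fin (b + 1) ↦ V) 0)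
      (LinearMap.funLeft A V (Fin.succ : Fin b → Fin (b + 1))) := by
  refine ⟨fun x y h ↦ by simpa using congrFun h 0, fun x ↦ ⟨fun h ↦ ⟨x 0, ?_⟩, ?_⟩, fun x ↦
    ⟨Fin.cons 0 x, rfl⟩⟩
  · ext i
    refine Fin.cases (by simp) (fun i ↦ ?_) i
    simpa using (congrFun h i).symm
  · rintro ⟨y, rfl⟩
    ext i
    simp [LinearMap.funLeft_apply]

variable [IsLocalRing A]

open IsLocalRing

lemma exists_equiv_residueField_pow {V : Type u} [AddCommGroup V] [Module A V]
    [Module.Finite A V] (hV : ∀ a ∈ maximalIdeal A, ∀ v : V, a • v = 0) :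
    ∃ b : ℕ, Nonempty (V ≃ₗ[A] (Fin b → ResidueField A)) := by
  have ht : Module.IsTorsionBySet A V (maximalIdeal A) := fun v a ↦ hV a.1 a.2 v
  let : Module (ResidueField A) V := ht.module
  have : IsScalarTower A (ResidueField A) V := ht.isScalarTower
  have : Module.Finite (ResidueField A) V := Module.Finite.of_restrictScalars_finite A _ _
  exact ⟨_, ⟨(Module.finBasis (ResidueField A) V).equivFun.restrictScalars A⟩⟩

variable {N : Type u} [AddCommGroup N] [Module A N] {t : ℕ}

lemma subsingleton_ext_residueField_pow {q : ℕ}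
    (h : Subsingleton (ExtM A (ResidueField A) N q)) (b : ℕ) :
    Subsingleton (ExtM A (Fin b → ResidueField A) N q) := by
  induction b with
  | zero => exact subsingleton_ext_of_subsingleton _ _ _
  | succ b ih => exact (isShortExact_fin_succ (ResidueField A) b).subsingleton_ext_mid q

lemma subsingleton_ext_of_killed {q : ℕ} {V : Type u} [AddCommGroup V] [Module A V]
    [Module.Finite A V] (hV : ∀ a ∈ maximalIdeal A, ∀ v : V, a • v = 0)
    (h : Subsingleton (ExtM A (ResidueField A) N q)) : Subsingleton (ExtM A V N q) := by
  obtain ⟨b, ⟨e⟩⟩ := exists_equiv_residueField_pow hV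
  have := subsingleton_ext_residueField_pow h b
  exact (extPreEquiv e N q).symm.subsingleton

/-- If `Ext^t(κ, N)` is the last nonzero one and `Ext^t(V, N)` is simple for some finite module `V`
killed by the maximal ideal, then `V` is the residue field. -/
lemma nonempty_equiv_residueField {V : Type u} [AddCommGroup V] [Module A V]
    [Module.Finite A V] (hV : ∀ a ∈ maximalIdeal A, ∀ v : V, a • v = 0)
    (h0 : ¬ Subsingleton (ExtM A (ResidueField A) N t))
    (hs : ∀ u v : ExtM A V N t, u ≠ 0 → ∃ a : A, a • u = v)
    (hnt : ¬ Subsingleton (ExtM A V N t)) :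
    Nonempty (V ≃ₗ[A] ResidueField A) := by
  obtain ⟨b, ⟨e⟩⟩ := exists_equiv_residueField_pow hV
  let E := extPreEquiv e N t
  have hs' : ∀ u v : ExtM A (Fin b → ResidueField A) N t, u ≠ 0 → ∃ a : A, a • u = v := by
    intro u v hu
    obtain ⟨a, ha⟩ := hs (E u) (E v) (by simpa using hu)
    exact ⟨a, E.injective (by rw [map_smul, ha])⟩
  have hnt' : ¬ Subsingleton (ExtM A (Fin b → ResidueField A) N t) :=
    fun h ↦ hnt E.symm.subsingleton
  rcases b with _ | _ | b
  · exact absurd (subsingleton_ext_of_subsingleton _ _ _) hnt'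
  · exact ⟨e.trans (LinearEquiv.funUnique (Fin 1) A (ResidueField A))⟩
  · exfalso
    have S := isShortExact_fin_succ (A := A) (ResidueField A) (b + 1)
    have := not_subsingleton_iff_nontrivial.mp h0
    obtain ⟨x, hx⟩ := exists_ne (0 : ExtM A (ResidueField A) N t)
    let p : (Fin (b + 1) → ResidueField A) →ₗ[A] ResidueField A := LinearMap.proj 0
    let p' : (Fin (b + 2) → ResidueField A) →ₗ[A] ResidueField A := LinearMap.proj 0
    -- With two or more copies, simplicity would make the pullback of x along coordinate 0 a
    -- multiple of its pullback along coordinate 1. Restriction to copy 0 kills the latter and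
    -- returns x from the former.
    have hu : extPre (p ∘ₗ LinearMap.funLeft A (ResidueField A) Fin.succ) N t x ≠ 0 := by
      intro h
      have h2 := congrArg (extPre (LinearMap.single A (fun _ ↦ ResidueField A)
        (1 : Fin (b + 2))) N t) h
      rw [← extPre_comp, map_zero] at h2
      have : (p ∘ₗ LinearMap.funLeft A (ResidueField A) Fin.succ) ∘ₗ
          LinearMap.single A (fun _ ↦ ResidueField A) (1 : Fin (b + 2)) = LinearMap.id := by
        ext
        simp [p, LinearMap.funLeft_apply]
      rw [this, extPre_id] at h2
      exact hx h2
    obtain ⟨a, ha⟩ := hs' _ (extPre p' N t x) hu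
    have h3 := congrArg (extPre (LinearMap.single A (fun _ ↦ ResidueField A)
        (0 : Fin (b + 2))) N t) ha
    rw [← extPre_comp, map_smul, ← extPre_comp, LinearMap.comp_assoc, S.comp_eq_zero,
      LinearMap.comp_zero, extPre_zero, smul_zero] at h3
    have : p' ∘ₗ LinearMap.single A (fun _ ↦ ResidueField A) (0 : Fin (b + 2)) =
        LinearMap.id := by
      ext
      simp [p']
    rw [this, extPre_id] at h3
    exact hx h3.symm

end Local

/-! ### Complexes of free modules over a local ring whose cohomology is killed by the maximal ideal
-/

section Corner

open IsLocalRing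

variable {A : Type u} [CommRing A] [IsLocalRing A] [IsNoetherianRing A] {r : ℕ → ℕ}
  {d : ∀ i, Matrix (Fin (r i)) (Fin (r (i + 1))) A}

/-- Descending induction on j, starting beyond the end of the complex, where the cokernel is zero.
The coboundaries in degree j + 1 are a first syzygy of the next cokernel, and the present cokernel
is an extension of them by the cohomology, to which `ht` applies. -/
lemma subsingleton_ext_coker {m : ℕ} (hd : ∀ i, d i * d (i + 1) = 0) (hm : ∀ j, m < j → r j = 0)
    (hkill : ∀ j, ∀ a ∈ maximalIdeal A, ∀ x : cohom hd j, a • x = 0) {t : ℕ}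
    (ht : ∀ q, t < q → Subsingleton (ExtM A (ResidueField A) A q)) (q : ℕ) (hq : t < q + 1)
    (j : ℕ) : Subsingleton (ExtM A (Coker d j) A (q + 1)) := by
  suffices H : ∀ i j q, t < q + 1 → m < i + j → Subsingleton (ExtM A (Coker d j) A (q + 1)) from
    H (m + 1) j q hq (by omega)
  intro i
  induction i with
  | zero =>
    intro j q hq hj
    have : IsEmpty (Fin (r j)) := by rw [hm j (by omega)]; infer_instance
    have : Subsingleton (Coker d j) := (Submodule.mkQ_surjective (coboundary d j)).subsingleton
    exact subsingleton_ext_of_subsingleton _ _ _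
  | succ i ih =>
    intro j q hq hj
    have h1 : Subsingleton (ExtM A (Coker d (j + 1)) A (q + 1 + 1)) :=
      ih (j + 1) (q + 1) (by omega) (by omega)
    have h2 : Subsingleton (ExtM A (coboundary d (j + 1)) A (q + 1)) :=
      ((isShortExact_coboundary d (j + 1)).extδEquiv A (q + 1)).subsingleton
    have h3 : Subsingleton (ExtM A (cohom hd j) A (q + 1)) :=
      subsingleton_ext_of_killed (hkill j) (ht _ hq)
    exact (isShortExact_cohom hd j).subsingleton_ext_mid (q + 1)

/-- Let `A^{r 0} → A^{r 1} → ⋯` be a bounded complex of finite free modules over a Noetherian local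
ring such that `r 0 = 1`, the entries of the first matrix generate the maximal ideal, and the
cohomology is killed by the maximal ideal. If `Ext^t(κ, A)` is the last nonzero one, `t ≥ 1`, then
the first nonzero cohomology is in degree `t` and is isomorphic to `κ`. -/
theorem exact_and_cohom_equiv_residueField {m : ℕ} (hd : ∀ i, d i * d (i + 1) = 0)
    (hr : r 0 = 1) (hI : entryIdeal (d 0) = maximalIdeal A) (hm : ∀ j, m < j → r j = 0)
    (hkill : ∀ j, ∀ a ∈ maximalIdeal A, ∀ x : cohom hd j, a • x = 0) {t : ℕ} (ht1 : 1 ≤ t)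
    (ht0 : ¬ Subsingleton (ExtM A (ResidueField A) A t))
    (ht : ∀ q, t < q → Subsingleton (ExtM A (ResidueField A) A q)) :
    (∀ j < t, LinearMap.ker (d j).vecMulLinear ≤ coboundary d j) ∧
      Nonempty (cohom hd t ≃ₗ[A] ResidueField A) := by
  have hvan := subsingleton_ext_coker hd hm hkill ht
  have hex : ∀ j, cohom hd j = ⊥ → LinearMap.ker (d j).vecMulLinear ≤ coboundary d j := by
    intro j hj x hx
    have : (Submodule.Quotient.mk x : Coker d j) ∈ cohom hd j :=
      (cokerMap_mk_eq_zero hd j x).mpr hx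
    rwa [hj, Submodule.mem_bot, Submodule.Quotient.mk_eq_zero] at this
  obtain ⟨t, rfl⟩ := Nat.exists_eq_add_of_le' ht1
  -- `Ext` of the coboundaries vanishes in degrees t + 1 and t + 2, so in degree t + 1 the cokernel
  -- and its cohomology submodule have the same `Ext`.
  have hsurj : ∀ j, Nonempty (ExtM A (Coker d j) A (t + 1) ≃ₗ[A] ExtM A (cohom hd j) A (t + 1)) := by
    intro j
    have h1 : Subsingleton (ExtM A (coboundary d (j + 1)) A (t + 1)) := by
      have := hvan (t + 1) (by omega) (j + 1)
      exact ((isShortExact_coboundary d (j + 1)).extδEquiv A (t + 1)).subsingleton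
    have h2 : Subsingleton (ExtM A (coboundary d (j + 1)) A (t + 1 + 1)) := by
      have := hvan (t + 1 + 1) (by omega) (j + 1)
      exact ((isShortExact_coboundary d (j + 1)).extδEquiv A (t + 1 + 1)).subsingleton
    exact ⟨(isShortExact_cohom hd j).extPreEquiv A (t + 1)⟩
  -- Nonzero cohomology has the residue field as a direct summand.
  have hne : ∀ j, cohom hd j ≠ ⊥ → ¬ Subsingleton (ExtM A (Coker d j) A (t + 1)) := by
    intro j hj hsub
    obtain ⟨e⟩ := hsurj j
    have hsub' := e.symm.subsingleton
    obtain ⟨b, ⟨e'⟩⟩ := exists_equiv_residueField_pow (V := cohom hd j) (hkill j)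
    rcases b with _ | b
    · apply hj
      have := e'.subsingleton
      exact (Submodule.subsingleton_iff_eq_bot).mp this
    · have h3 := (extPreEquiv e' A (t + 1)).subsingleton
      refine ht0 ⟨fun x y ↦ ?_⟩
      let p : (Fin (b + 1) → ResidueField A) →ₗ[A] ResidueField A := LinearMap.proj 0
      have hp : p ∘ₗ LinearMap.single A (fun _ ↦ ResidueField A) (0 : Fin (b + 1)) =
          LinearMap.id := by
        ext; simp [p]
      rw [← extPre_id _ x, ← extPre_id _ y, ← hp, extPre_comp, extPre_comp]
      exact congrArg _ (Subsingleton.elim _ _)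
  -- if the complex is exact at spots `< s`, then `s ≤ t + 1`
  have hle : ∀ s, (∀ j < s, cohom hd j = ⊥) → s ≤ t + 1 := by
    intro s hs
    by_contra! hlt
    -- Exactness up to s makes Ext^s of the cokernel the residue field, against the vanishing above
    -- t + 1.
    obtain ⟨f, hf, hfk⟩ := exists_surjective_ext_coker hd hr
      (fun j hj ↦ hex j (hs j hj)) (by omega : 1 ≤ s)
    obtain ⟨s, rfl⟩ := Nat.exists_eq_add_of_le' (by omega : 1 ≤ s)
    have := hvan s (by omega) (s + 1)
    have h1 : (1 : A) ∈ LinearMap.ker f := Subsingleton.elim _ _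
    rw [hfk, hI] at h1
    exact (Ideal.ne_top_iff_one _).mp (maximalIdeal.isMaximal A).ne_top h1
  -- As long as the complex is exact below j, dimension shifting reduces Ext^(t + 1) of the j-th
  -- cokernel to positive `Ext` of the free module `Coker d 0`, which is zero; so there is no
  -- cohomology at j either.
  have hge : ∀ j < t + 1, cohom hd j = ⊥ := by
    intro j
    induction j using Nat.strong_induction_on with
    | _ j ih =>
      intro hj
      by_contra hne'
      apply hne j hne'
      obtain ⟨e⟩ := nonempty_ext_coker_equiv hd (s := j)
        (fun i hi ↦ hex i (ih i hi (by omega))) A 0 j (by omega) (t - j)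
      have h0 : Subsingleton (ExtM A (Coker d 0) A (t - j + 1)) := by
        have e₀ : Coker d 0 ≃ₗ[A] (Fin (r 0) → A) := Submodule.quotEquivOfEqBot _ rfl
        exact (extPreEquiv e₀ A (t - j + 1)).symm.subsingleton
      have h1 := e.symm.subsingleton
      rwa [zero_add, show j + (t - j) + 1 = t + 1 by omega] at h1
  refine ⟨fun j hj ↦ hex j (hge j hj), ?_⟩
  have hbot : cohom hd (t + 1) ≠ ⊥ := by
    intro hb
    have := hle (t + 2) (fun j hj ↦ by
      rcases Nat.lt_succ_iff_lt_or_eq.mp hj with h | rfl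
      · exact hge j h
      · exact hb)
    omega
  obtain ⟨e⟩ := hsurj (t + 1)
  obtain ⟨f, hf, hfk⟩ := exists_surjective_ext_coker hd hr
      (fun j hj ↦ hex j (hge j hj)) (by omega : 1 ≤ t + 1)
  -- Ext^(t + 1) of the cohomology in degree t + 1 is A modulo the entries of `d 0`, that is, the
  -- residue field; hence the cohomology is one copy of it.
  refine nonempty_equiv_residueField (hkill (t + 1)) ht0 ?_ ?_
  · intro u v hu
    obtain ⟨a, ha⟩ := hf (e.symm u)
    obtain ⟨b, hb⟩ := hf (e.symm v)
    have ha' : IsUnit a := by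
      by_contra hc
      have : a ∈ LinearMap.ker f := by rw [hfk, hI]; exact hc
      rw [LinearMap.mem_ker, ha] at this
      exact hu (by simpa using this)
    obtain ⟨c, rfl⟩ := ha'
    refine ⟨b * (↑c⁻¹ : A), e.symm.injective ?_⟩
    rw [map_smul, ← ha, ← hb, ← map_smul, smul_eq_mul, mul_assoc, Units.inv_mul, mul_one]
  · intro h
    exact hne _ hbot e.subsingleton

end Corner

/-! ## Resolutions given by matrices -/

section Resolution

variable {S : Type u} [CommRing S] {r : ℕ → ℕ}

/-- The matrices `d i` form a free resolution of `S ⧸ I` with `S` in degree zero. -/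
structure IsResolution (d : ∀ i, Matrix (Fin (r i)) (Fin (r (i + 1))) S) (I : Ideal S) : Prop where
  rank_zero : r 0 = 1
  entryIdeal_eq : entryIdeal (d 0) = I
  exact : ∀ i, LinearMap.range (d (i + 1)).mulVecLin = LinearMap.ker (d i).mulVecLin

variable {d : ∀ i, Matrix (Fin (r i)) (Fin (r (i + 1))) S} {I : Ideal S}

lemma IsResolution.mul_eq_zero (h : IsResolution d I) (i : ℕ) : d i * d (i + 1) = 0 := by
  apply Matrix.toLin'.injective
  rw [Matrix.toLin'_mul, map_zero]
  exact LinearMap.range_le_ker_iff.mp (h.exact i).le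

/-- The module of syzygies. -/
noncomputable abbrev syz (d : ∀ i, Matrix (Fin (r i)) (Fin (r (i + 1))) S) (j : ℕ) :
    Submodule S (Fin (r j) → S) := LinearMap.range (d j).mulVecLin

lemma isShortExact_syz_zero (d : ∀ i, Matrix (Fin (r i)) (Fin (r (i + 1))) S) :
    IsShortExact (syz d 0).subtype (syz d 0).mkQ :=
  ⟨Subtype.val_injective, LinearMap.exact_subtype_mkQ _, Submodule.mkQ_surjective _⟩

lemma IsResolution.isShortExact_syz (h : IsResolution d I) (j : ℕ) :
    IsShortExact (syz d (j + 1)).subtype (d j).mulVecLin.rangeRestrict :=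
  ⟨Subtype.val_injective, by
    rw [LinearMap.exact_iff, Submodule.range_subtype, LinearMap.ker_rangeRestrict]
    exact (h.exact j).symm,
    LinearMap.surjective_rangeRestrict _⟩

/-- The cokernel of the first matrix is `S ⧸ I`. -/
lemma IsResolution.nonempty_equiv (h : IsResolution d I) :
    Nonempty (((Fin (r 0) → S) ⧸ syz d 0) ≃ₗ[S] S ⧸ I) := by
  have hu : ∀ a b : Fin (r 0), a = b := by
    rw [h.rank_zero]; exact fun a b ↦ Subsingleton.elim a b
  let : Unique (Fin (r 0)) := ⟨⟨⟨0, by have := h.rank_zero; omega⟩⟩, fun a ↦ hu _ _⟩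
  refine ⟨Submodule.Quotient.equiv _ _ (LinearEquiv.funUnique (Fin (r 0)) S S) ?_⟩
  apply le_antisymm
  · rintro _ ⟨_, ⟨x, rfl⟩, rfl⟩
    rw [← h.entryIdeal_eq]
    change ∑ b, d 0 default b * x b ∈ entryIdeal (d 0)
    exact Submodule.sum_mem _ fun b _ ↦
      Ideal.mul_mem_right _ _ (Ideal.subset_span ⟨default, b, rfl⟩)
  · rw [← h.entryIdeal_eq, entryIdeal, Ideal.span_le]
    rintro _ ⟨a, b, rfl⟩
    refine ⟨(d 0).mulVecLin (Pi.single b 1), ⟨_, rfl⟩, ?_⟩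
    simp [hu default a]

lemma IsResolution.nonempty_ext_syz_equiv (h : IsResolution d I) (N : Type u) [AddCommGroup N]
    [Module S N] (j : ℕ) :
    Nonempty (ExtM S (syz d j) N 1 ≃ₗ[S] ExtM S ((Fin (r 0) → S) ⧸ syz d 0) N (j + 2)) := by
  suffices H : ∀ j p, Nonempty (ExtM S (syz d j) N (p + 1) ≃ₗ[S]
      ExtM S ((Fin (r 0) → S) ⧸ syz d 0) N (p + j + 2)) by
    have := H j 0
    rwa [zero_add, zero_add] at this
  intro j
  induction j with
  | zero => exact fun p ↦ ⟨(isShortExact_syz_zero d).extδEquiv N (p + 1)⟩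
  | succ j ih =>
    intro p
    obtain ⟨e⟩ := ih (p + 1)
    rw [show p + (j + 1) + 2 = p + 1 + j + 2 by omega]
    exact ⟨((h.isShortExact_syz j).extδEquiv N (p + 1)).trans e⟩

/-- The syzygies inside the j-th free module are the (j + 1)-st syzygies of `S ⧸ I`, so after j
shifts the connecting map of a single short exact sequence remains. -/
lemma IsResolution.exists_hom_to_ext (h : IsResolution d I) (N : Type u) [AddCommGroup N]
    [Module S N] (j : ℕ) :
    ∃ f : (syz d j →ₗ[S] N) →ₗ[S] ExtM S (S ⧸ I) N (j + 1), Function.Surjective f ∧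
      ∀ φ, f φ = 0 ↔ ∃ ψ : (Fin (r j) → S) →ₗ[S] N, ψ ∘ₗ (syz d j).subtype = φ := by
  obtain ⟨e₀⟩ := h.nonempty_equiv
  have E := extPreEquiv e₀.symm N (j + 1)
  suffices H : ∃ f : (syz d j →ₗ[S] N) →ₗ[S] ExtM S ((Fin (r 0) → S) ⧸ syz d 0) N (j + 1),
      Function.Surjective f ∧
      ∀ φ, f φ = 0 ↔ ∃ ψ : (Fin (r j) → S) →ₗ[S] N, ψ ∘ₗ (syz d j).subtype = φ by
    obtain ⟨f, hf, hf'⟩ := H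
    refine ⟨E.toLinearMap ∘ₗ f, E.surjective.comp hf, fun φ ↦ ?_⟩
    rw [← hf' φ, LinearMap.comp_apply, LinearEquiv.coe_coe, LinearEquiv.map_eq_zero_iff]
  cases j with
  | zero =>
    exact ⟨_, (isShortExact_syz_zero d).homToExt_surjective (N := N),
      (isShortExact_syz_zero d).homToExt_eq_zero_iff⟩
  | succ j =>
    obtain ⟨e⟩ := h.nonempty_ext_syz_equiv N j
    refine ⟨e.toLinearMap ∘ₗ (h.isShortExact_syz j).homToExt N,
      e.surjective.comp (h.isShortExact_syz j).homToExt_surjective, fun φ ↦ ?_⟩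
    rw [← (h.isShortExact_syz j).homToExt_eq_zero_iff φ, LinearMap.comp_apply, LinearEquiv.coe_coe,
      LinearEquiv.map_eq_zero_iff]

/-- The map `N^ι → N^κ`, `u ↦ (∑ a, M a b • u a)_b`. -/
noncomputable def coMap {ι κ : Type*} [Fintype ι] (M : Matrix ι κ S) (N : Type*) [AddCommGroup N]
    [Module S N] : (ι → N) →ₗ[S] (κ → N) :=
  LinearMap.pi fun b ↦ ∑ a, M a b • LinearMap.proj a

lemma coMap_apply {ι κ : Type*} [Fintype ι] (M : Matrix ι κ S) {N : Type*} [AddCommGroup N]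
    [Module S N] (u : ι → N) (b : κ) : coMap M N u b = ∑ a, M a b • u a := by
  simp [coMap]

lemma coMap_self {ι κ : Type*} [Fintype ι] (M : Matrix ι κ S) : coMap M S = M.vecMulLinear := by
  refine LinearMap.ext fun u ↦ funext fun b ↦ ?_
  simp [coMap_apply, Matrix.vecMul, dotProduct, mul_comm]

/-- `Ext (S ⧸ I, N)` is the cohomology of the complex of row vectors with entries in `N`. -/
lemma IsResolution.exists_cocycles_to_ext (h : IsResolution d I) (N : Type u) [AddCommGroup N]
    [Module S N] (j : ℕ) :
    ∃ f : LinearMap.ker (coMap (d (j + 1)) N) →ₗ[S] ExtM S (S ⧸ I) N (j + 1),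
      Function.Surjective f ∧ ∀ w, f w = 0 ↔ ∃ u, coMap (d j) N u = w := by
  obtain ⟨f, hf, hf'⟩ := h.exists_hom_to_ext N j
  let Φ := Module.piEquiv (Fin (r (j + 1))) S N
  have hΦ : ∀ w, w ∈ LinearMap.ker (coMap (d (j + 1)) N) ↔ Φ w ∘ₗ (d (j + 1)).mulVecLin = 0 := by
    intro w
    rw [LinearMap.mem_ker]
    constructor
    · intro hw
      apply LinearMap.pi_ext'
      intro c
      ext
      have := congrFun hw c
      rw [coMap_apply] at this
      simpa [Φ, Module.piEquiv_apply_apply] using this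
    · intro hw
      ext c
      have := LinearMap.congr_fun hw (Pi.single c 1)
      rw [coMap_apply]
      simpa [Φ, Module.piEquiv_apply_apply] using this
  let g₀ : (syz d j →ₗ[S] N) →ₗ[S] (Fin (r (j + 1)) → N) :=
    Φ.symm.toLinearMap ∘ₗ (LinearMap.lcomp S N (d j).mulVecLin.rangeRestrict)
  have hΦg : ∀ φ, Φ (g₀ φ) = φ ∘ₗ (d j).mulVecLin.rangeRestrict := fun φ ↦
    Φ.apply_symm_apply _
  have h1 : (d j).mulVecLin.rangeRestrict ∘ₗ (d (j + 1)).mulVecLin = 0 := by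
    refine LinearMap.ext fun x ↦ Subtype.ext ?_
    exact LinearMap.mem_ker.mp ((h.exact j).le ⟨x, rfl⟩)
  have hg₀ : ∀ φ, g₀ φ ∈ LinearMap.ker (coMap (d (j + 1)) N) := by
    intro φ
    rw [hΦ, hΦg, LinearMap.comp_assoc, h1, LinearMap.comp_zero]
  let g := LinearMap.codRestrict _ g₀ hg₀
  -- A cocycle is a map from the free module that kills the next image, which by exactness is the
  -- kernel; so it descends uniquely to the syzygies.
  have hg : Function.Bijective g := by
    refine ⟨fun φ φ' hφ ↦ ?_, fun w ↦ ?_⟩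
    · have h2 : g₀ φ = g₀ φ' := congrArg Subtype.val hφ
      have h3 := congrArg Φ h2
      rw [hΦg, hΦg] at h3
      exact (LinearMap.cancel_right (LinearMap.surjective_rangeRestrict _)).mp h3
    · have hw := (hΦ w).mp w.2
      have hk : LinearMap.ker (d j).mulVecLin ≤ LinearMap.ker (Φ w) := by
        rw [← h.exact j]
        exact LinearMap.range_le_ker_iff.mpr hw
      refine ⟨(LinearMap.ker (d j).mulVecLin).liftQ (Φ w) hk ∘ₗ
        (d j).mulVecLin.quotKerEquivRange.symm.toLinearMap, Subtype.ext (Φ.injective ?_)⟩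
      refine (hΦg _).trans (LinearMap.ext fun x ↦ ?_)
      have : (d j).mulVecLin.quotKerEquivRange.symm ((d j).mulVecLin.rangeRestrict x) =
          Submodule.Quotient.mk x := by
        rw [LinearEquiv.symm_apply_eq]; rfl
      simp only [LinearMap.comp_apply, LinearEquiv.coe_coe]
      rw [this]; rfl
  let G := LinearEquiv.ofBijective g hg
  refine ⟨f ∘ₗ G.symm.toLinearMap, hf.comp G.symm.surjective, fun w ↦ ?_⟩
  obtain ⟨φ, rfl⟩ := G.surjective w
  rw [LinearMap.comp_apply, LinearEquiv.coe_coe, LinearEquiv.symm_apply_apply, hf']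
  have hG : (G φ : Fin (r (j + 1)) → N) = g₀ φ := rfl
  have key : ∀ u : Fin (r j) → N, Φ (coMap (d j) N u) =
      Module.piEquiv (Fin (r j)) S N u ∘ₗ (d j).mulVecLin := by
    intro u
    apply LinearMap.pi_ext'
    intro b
    ext
    simp [Φ, Module.piEquiv_apply_apply, coMap_apply]
  have hsub : (syz d j).subtype ∘ₗ (d j).mulVecLin.rangeRestrict = (d j).mulVecLin := rfl
  constructor
  · rintro ⟨ψ, rfl⟩
    obtain ⟨u, rfl⟩ := (Module.piEquiv (Fin (r j)) S N).surjective ψ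
    refine ⟨u, Φ.injective ?_⟩
    rw [key, hG, hΦg, LinearMap.comp_assoc, hsub]
  · rintro ⟨u, hu⟩
    refine ⟨Module.piEquiv (Fin (r j)) S N u, ?_⟩
    have h3 := congrArg Φ hu
    rw [key, hG, hΦg] at h3
    refine (LinearMap.cancel_right (LinearMap.surjective_rangeRestrict (d j).mulVecLin)).mp ?_
    rw [LinearMap.comp_assoc]
    exact h3

/-- The complex of row vectors over N has zero differentials, so its cohomology in degree j + 1 is
the power of N with exponent `r (j + 1)`. For a minimal resolution and N the simple module this
reads the ranks off `Ext`, whatever the resolution. -/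
lemma IsResolution.rank_eq_zero_of_subsingleton (h : IsResolution d I) (N : Type u)
    [AddCommGroup N] [Module S N] [Nontrivial N] (hN : ∀ i a b, ∀ x : N, d i a b • x = 0) (j : ℕ)
    (hj : Subsingleton (ExtM S (S ⧸ I) N (j + 1))) : r (j + 1) = 0 := by
  obtain ⟨f, -, hf⟩ := h.exists_cocycles_to_ext N j
  have hc : ∀ i (u : Fin (r i) → N), coMap (d i) N u = 0 := by
    intro i u
    ext b
    simp [coMap_apply, hN]
  by_contra hr
  obtain ⟨x, hx⟩ := exists_ne (0 : N)
  obtain ⟨u, hu⟩ := (hf ⟨fun _ ↦ x, hc _ _⟩).mp (Subsingleton.elim _ _)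
  rw [hc] at hu
  exact hx (congrFun hu ⟨0, Nat.pos_of_ne_zero hr⟩).symm

lemma IsResolution.subsingleton_ext_of_rank_eq_zero (h : IsResolution d I) (N : Type u)
    [AddCommGroup N] [Module S N] (j : ℕ) (hj : r (j + 1) = 0) :
    Subsingleton (ExtM S (S ⧸ I) N (j + 1)) := by
  obtain ⟨f, hf, -⟩ := h.exists_cocycles_to_ext N j
  have : IsEmpty (Fin (r (j + 1))) := by rw [hj]; infer_instance
  exact hf.subsingleton

lemma IsResolution.ker_le_coboundary (h : IsResolution d I) (j : ℕ)
    (hj : Subsingleton (ExtM S (S ⧸ I) S (j + 1))) :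
    LinearMap.ker (d (j + 1)).vecMulLinear ≤ coboundary d (j + 1) := by
  obtain ⟨f, -, hf⟩ := h.exists_cocycles_to_ext S j
  intro w hw
  obtain ⟨u, hu⟩ := (hf ⟨w, by rwa [coMap_self]⟩).mp (Subsingleton.elim _ _)
  exact ⟨u, by rw [← coMap_self]; exact hu⟩

/-- I kills `S ⧸ I`, hence its `Ext`, hence the cohomology of the complex of row vectors. -/
lemma IsResolution.smul_mem_range (h : IsResolution d I) (N : Type u)
    [AddCommGroup N] [Module S N] (j : ℕ) {a : S} (ha : a ∈ I)
    {w : Fin (r (j + 1)) → N} (hw : coMap (d (j + 1)) N w = 0) :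
    ∃ u, coMap (d j) N u = a • w := by
  obtain ⟨f, -, hf⟩ := h.exists_cocycles_to_ext N j
  have := (hf (a • ⟨w, hw⟩)).mp (by
    rw [map_smul]
    refine smul_ext_eq_zero_of_left (fun x ↦ ?_) _ _
    obtain ⟨x, rfl⟩ := Ideal.Quotient.mk_surjective x
    exact Ideal.Quotient.eq_zero_iff_mem.mpr (Ideal.mul_mem_right _ _ ha))
  exact this

/-- At the last nonzero module every row vector is a cocycle, whereas coboundaries have coordinates
in J; the vector of ones is a nonzero class. -/
lemma IsResolution.not_subsingleton_ext (h : IsResolution d I) (j : ℕ) {J : Ideal S} (hJ : J ≠ ⊤)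
    (hd : ∀ a b, d j a b ∈ J) (hj : r (j + 1) ≠ 0) (hj' : r (j + 2) = 0) :
    ¬ Subsingleton (ExtM S (S ⧸ I) S (j + 1)) := by
  intro hs
  have h1 : (fun _ ↦ 1) ∈ LinearMap.ker (d (j + 1)).vecMulLinear := by
    have : IsEmpty (Fin (r (j + 1 + 1))) := by rw [hj']; infer_instance
    exact Subsingleton.elim _ _
  obtain ⟨u, hu⟩ := h.ker_le_coboundary j hs h1
  refine (Ideal.ne_top_iff_one J).mp hJ ?_
  rw [← congrFun hu ⟨0, Nat.pos_of_ne_zero hj⟩]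
  change ∑ a, u a * d j a _ ∈ J
  exact Submodule.sum_mem _ fun a _ ↦ Ideal.mul_mem_left _ _ (hd _ _)

end Resolution

/-! ## Localization and the last syzygy module -/

section Localized

variable {S : Type u} [CommRing S] (p : Submonoid S)

/-- Localization of linear maps, as a linear map over the base ring. -/
noncomputable def locMap {M N : Type*} [AddCommGroup M] [Module S M] [AddCommGroup N] [Module S N] :
    (M →ₗ[S] N) →ₗ[S] (LocalizedModule p M →ₗ[S] LocalizedModule p N) :=
  IsLocalizedModule.map p (LocalizedModule.mkLinearMap p M) (LocalizedModule.mkLinearMap p N)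

lemma IsShortExact.loc {X₁ X₂ X₃ : Type*} [AddCommGroup X₁] [AddCommGroup X₂] [AddCommGroup X₃]
    [Module S X₁] [Module S X₂] [Module S X₃] {f : X₁ →ₗ[S] X₂} {g : X₂ →ₗ[S] X₃}
    (h : IsShortExact f g) : IsShortExact (locMap p f) (locMap p g) :=
  ⟨IsLocalizedModule.map_injective p _ _ _ h.inj, IsLocalizedModule.map_exact p _ _ _ _ _ h.exact,
    IsLocalizedModule.map_surjective p _ _ _ h.surj⟩

lemma locMap_id (M : Type*) [AddCommGroup M] [Module S M] :
    locMap p (LinearMap.id : M →ₗ[S] M) = LinearMap.id :=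
  IsLocalizedModule.map_id p _

lemma locMap_comp {M N P : Type*} [AddCommGroup M] [Module S M] [AddCommGroup N] [Module S N]
    [AddCommGroup P] [Module S P] (f : M →ₗ[S] N) (g : N →ₗ[S] P) :
    locMap p (g ∘ₗ f) = locMap p g ∘ₗ locMap p f :=
  IsLocalizedModule.map_comp' p _ _ _ f g

/-- Localization of linear equivalences, as a linear equivalence over the base ring. -/
noncomputable def locEquiv {M N : Type*} [AddCommGroup M] [Module S M] [AddCommGroup N] [Module S N]
    (e : M ≃ₗ[S] N) : LocalizedModule p M ≃ₗ[S] LocalizedModule p N :=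
  LinearEquiv.ofLinearMap (locMap p e.toLinearMap) (locMap p e.symm.toLinearMap)
    (by rw [← locMap_comp]; simp [locMap_id]) (by rw [← locMap_comp]; simp [locMap_id])

variable {κ : Type u} [AddCommGroup κ] [Module S κ] {J : Ideal S}

/-- A scalar acting on the target may be moved to the first variable, where J acts by zero. This is
how minimality of a resolution enters. -/
lemma extPost_eq_zero_of_mem_smul (hκ : ∀ a ∈ J, ∀ x : κ, a • x = 0) {M N : Type u}
    [AddCommGroup M] [Module S M] [AddCommGroup N] [Module S N] {f : M →ₗ[S] N}
    (hf : f ∈ J • (⊤ : Submodule S (M →ₗ[S] N))) (n : ℕ) (x : ExtM S κ M n) :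
    extPost κ f n x = 0 := by
  refine Submodule.smul_induction_on hf (fun a ha g _ ↦ ?_) fun f g hf hg ↦ ?_
  · rw [show a • g = g ∘ₗ (a • LinearMap.id) from by ext; simp, extPost_comp, extPost_smul_id,
      smul_ext_eq_zero_of_left (hκ a ha), map_zero]
  · rw [extPost_add, hf, hg, add_zero]

lemma mulVecLin_mem_smul_top {a b : ℕ} {M : Matrix (Fin a) (Fin b) S} (hM : ∀ i j, M i j ∈ J) :
    M.mulVecLin ∈ J • (⊤ : Submodule S ((Fin b → S) →ₗ[S] (Fin a → S))) := by
  have : M.mulVecLin = ∑ i, ∑ j, M i j • (LinearMap.single S (fun _ ↦ S) i ∘ₗ LinearMap.proj j) := by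
    refine LinearMap.ext fun x ↦ funext fun i ↦ ?_
    simp [Matrix.mulVec, dotProduct, LinearMap.sum_apply, Pi.single_apply]
  rw [this]
  exact Submodule.sum_mem _ fun i _ ↦ Submodule.sum_mem _ fun j _ ↦
    Submodule.smul_mem_smul (hM i j) trivial

lemma subsingleton_ext_pi {N : Type u} [AddCommGroup N] [Module S N] {n : ℕ}
    (h : Subsingleton (ExtM S κ N n)) (b : ℕ) : Subsingleton (ExtM S κ (Fin b → N) n) := by
  induction b with
  | zero =>
    refine ⟨fun x y ↦ ?_⟩
    rw [← extPost_id n x, ← extPost_id n y,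
      Subsingleton.elim (LinearMap.id : (Fin 0 → N) →ₗ[S] _) 0, extPost_zero, extPost_zero]
  | succ b ih => exact ((isShortExact_fin_succ N b).exact_post n).subsingleton_mid

/-- If `Ext (κ, N)` is nonzero and `Ext (κ, N^b)` is simple, then `b = 1`. -/
lemma eq_one_of_ext_pi_simple {N : Type u} [AddCommGroup N] [Module S N] {n b : ℕ}
    (h : ¬ Subsingleton (ExtM S κ N n)) (hb : ¬ Subsingleton (ExtM S κ (Fin b → N) n))
    (hs : ∀ u v : ExtM S κ (Fin b → N) n, u ≠ 0 → ∃ a : S, a • u = v) : b = 1 := by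
  rcases b with _ | _ | b
  · refine absurd ⟨fun x y ↦ ?_⟩ hb
    rw [← extPost_id n x, ← extPost_id n y,
      Subsingleton.elim (LinearMap.id : (Fin 0 → N) →ₗ[S] _) 0, extPost_zero, extPost_zero]
  · rfl
  · exfalso
    have := not_subsingleton_iff_nontrivial.mp h
    obtain ⟨x, hx⟩ := exists_ne (0 : ExtM S κ N n)
    let ι (i : Fin (b + 2)) : N →ₗ[S] (Fin (b + 2) → N) := LinearMap.single S (fun _ ↦ N) i
    let π (i : Fin (b + 2)) : (Fin (b + 2) → N) →ₗ[S] N := LinearMap.proj i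
    have h1 : ∀ i, extPost κ (π i) n (extPost κ (ι i) n x) = x := by
      intro i
      rw [← extPost_comp, show π i ∘ₗ ι i = LinearMap.id from by ext; simp [π, ι], extPost_id]
    have h2 : extPost κ (π 0) n (extPost κ (ι 1) n x) = 0 := by
      rw [← extPost_comp, show π 0 ∘ₗ ι 1 = 0 from by ext; simp [π, ι], extPost_zero]
    obtain ⟨a, ha⟩ := hs (extPost κ (ι 1) n x) (extPost κ (ι 0) n x) (fun h0 ↦ hx (by
      rw [← h1 1, h0, map_zero]))
    have h3 := congrArg (extPost κ (π 0) n) ha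
    rw [map_smul, h2, h1, smul_zero] at h3
    exact hx h3.symm

/-- `(S^b)_p = (S_p)^b`. -/
lemma nonempty_loc_pi_equiv (b : ℕ) :
    Nonempty (LocalizedModule p (Fin b → S) ≃ₗ[S] (Fin b → LocalizedModule p S)) :=
  ⟨IsLocalizedModule.linearEquiv p (LocalizedModule.mkLinearMap p _)
    (LinearMap.pi fun i ↦ LocalizedModule.mkLinearMap p S ∘ₗ LinearMap.proj i)⟩

variable {r : ℕ → ℕ} {d : ∀ i, Matrix (Fin (r i)) (Fin (r (i + 1))) S} {I : Ideal S}

lemma IsResolution.bijective_rangeRestrict (h : IsResolution d I) {i : ℕ} (hi : r (i + 2) = 0) :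
    Function.Bijective (d i).mulVecLin.rangeRestrict := by
  refine ⟨?_, LinearMap.surjective_rangeRestrict _⟩
  rw [← LinearMap.ker_eq_bot, LinearMap.ker_rangeRestrict, ← h.exact i, LinearMap.range_eq_bot]
  have : IsEmpty (Fin (r (i + 1 + 1))) := by rw [hi]; infer_instance
  exact LinearMap.ext fun x ↦ by rw [Subsingleton.elim x 0, map_zero, map_zero]

/-- If the entries of a resolution of length `Q + 1` of `S ⧸ I` kill `κ`, and
`Ext^j (κ, S_p) = 0` for `j < m`, then `Ext^j (κ, (S ⧸ I)_p)` vanishes for `j + Q + 1 < m` and is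
`Ext^m (κ, (F_{Q+1})_p)` for `j + Q + 1 = m`. -/
lemma IsResolution.ext_localized (h : IsResolution d I) (hκ : ∀ a ∈ J, ∀ x : κ, a • x = 0)
    (hdJ : ∀ i a b, d i a b ∈ J) {m Q : ℕ} (hr : r (Q + 2) = 0)
    (hvan : ∀ j < m, Subsingleton (ExtM S κ (LocalizedModule p S) j)) :
    (∀ j, j + Q + 1 < m → Subsingleton (ExtM S κ (LocalizedModule p (S ⧸ I)) j)) ∧
    ∀ j, j + Q + 1 = m → Nonempty (ExtM S κ (LocalizedModule p (S ⧸ I)) j ≃ₗ[S]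
      ExtM S κ (Fin (r (Q + 1)) → LocalizedModule p S) m) := by
  obtain ⟨e₀⟩ := h.nonempty_equiv
  have hfree : ∀ b, ∀ j < m, Subsingleton (ExtM S κ (LocalizedModule p (Fin b → S)) j) := by
    intro b j hj
    obtain ⟨e⟩ := nonempty_loc_pi_equiv (S := S) p b
    have := subsingleton_ext_pi (hvan j hj) b
    exact (extPostEquiv κ e j).subsingleton
  let eQ := LinearEquiv.ofBijective _ (h.bijective_rangeRestrict hr)
  -- The last syzygy module is free, and its inclusion is then the last matrix, whose entries lie in
  -- J.
  have hzero : ∀ n (x : ExtM S κ (LocalizedModule p (syz d Q)) n),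
      extPost κ (locMap p (syz d Q).subtype) n x = 0 := by
    intro n x
    obtain ⟨y, rfl⟩ := (extPostEquiv κ (locEquiv p eQ) n).surjective x
    change extPost κ (locMap p (syz d Q).subtype) n
      (extPost κ (locMap p (d Q).mulVecLin.rangeRestrict) n y) = 0
    rw [← extPost_comp, ← locMap_comp]
    refine extPost_eq_zero_of_mem_smul hκ ?_ n y
    have := mulVecLin_mem_smul_top (hdJ Q)
    have h2 := Submodule.mem_map_of_mem (f := locMap p) this
    rw [Submodule.map_smul''] at h2
    exact Submodule.smul_mono le_rfl le_top h2
  -- Induction on the distance e to the last syzygy module; each step away from it lowers the degree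
  -- of `Ext` by one.
  have key : ∀ e i, i + e = Q →
      (∀ j, j + e < m → Subsingleton (ExtM S κ (LocalizedModule p (syz d i)) j)) ∧
      ∀ j, j + e = m → Nonempty (ExtM S κ (LocalizedModule p (syz d i)) j ≃ₗ[S]
      ExtM S κ (Fin (r (Q + 1)) → LocalizedModule p S) m) := by
    intro e
    induction e with
    | zero =>
      rintro i rfl
      obtain ⟨e₁⟩ := nonempty_loc_pi_equiv (S := S) p (r (i + 1))
      have E := (locEquiv p eQ).symm.trans e₁
      refine ⟨fun j hj ↦ ?_, ?_⟩
      · have := subsingleton_ext_pi (hvan j hj) (r (i + 1))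
        exact (extPostEquiv κ E j).subsingleton
      · rintro j rfl
        exact ⟨extPostEquiv κ E j⟩
    | succ e ih =>
      intro i hi
      have SE := (h.isShortExact_syz i).loc p
      obtain ⟨ih1, ih2⟩ := ih (i + 1) (by omega)
      have hδ : ∀ j, j + (e + 1) ≤ m → Nonempty (ExtM S κ (LocalizedModule p (syz d i)) j ≃ₗ[S]
          ExtM S κ (LocalizedModule p (syz d (i + 1))) (j + 1)) := by
        intro j hj
        have := hfree (r (i + 1)) j (by omega)
        refine ⟨SE.extδEquiv' κ j fun x ↦ ?_⟩
        rcases Nat.lt_or_ge (j + 1) m with hlt | hge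
        · have := hfree (r (i + 1)) (j + 1) hlt
          exact Subsingleton.elim _ _
        -- In degree m the `Ext` of a free module need not vanish. That degree is met only at the
        -- inclusion of the last syzygies, which induces zero.
        · obtain rfl : e = 0 := by omega
          obtain rfl : i + 1 = Q := by omega
          exact hzero _ x
      refine ⟨fun j hj ↦ ?_, fun j hj ↦ ?_⟩
      · obtain ⟨E⟩ := hδ j hj.le
        have := ih1 (j + 1) (by omega)
        exact E.subsingleton
      · obtain ⟨E⟩ := hδ j hj.le
        obtain ⟨E'⟩ := ih2 (j + 1) (by omega)
        exact ⟨E.trans E'⟩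
  obtain ⟨k1, k2⟩ := key Q 0 (by omega)
  have SE := (isShortExact_syz_zero d).loc p
  have hδ : ∀ j, j + Q + 1 ≤ m → Nonempty (ExtM S κ (LocalizedModule p (S ⧸ I)) j ≃ₗ[S]
      ExtM S κ (LocalizedModule p (syz d 0)) (j + 1)) := by
    intro j hj
    have := hfree (r 0) j (by omega)
    refine ⟨(extPostEquiv κ (locEquiv p e₀.symm) j).trans (SE.extδEquiv' κ j fun x ↦ ?_)⟩
    rcases Nat.lt_or_ge (j + 1) m with hlt | hge
    · have := hfree (r 0) (j + 1) hlt
      exact Subsingleton.elim _ _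
    · obtain rfl : Q = 0 := by omega
      exact hzero _ x
  refine ⟨fun j hj ↦ ?_, fun j hj ↦ ?_⟩
  · obtain ⟨E⟩ := hδ j hj.le
    have := k1 (j + 1) (by omega)
    exact E.subsingleton
  · obtain ⟨E⟩ := hδ j hj.le
    obtain ⟨E'⟩ := k2 (j + 1) (by omega)
    exact ⟨E.trans E'⟩

end Localized

/-! ## Families of quotients by regular elements -/

section RegularFamily

variable {S : Type u} [CommRing S] {ι : Type*} [DecidableEq ι] {x : ι → S}
  {N : Finset ι → Type u} [∀ U, AddCommGroup (N U)] [∀ U, Module S (N U)]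

/-- `N (insert v U)` is the quotient of `N U` by the regular element `x v`, for `v ∉ U ⊇ U₀`. -/
def IsRegularFamily (x : ι → S) (N : Finset ι → Type u) [∀ U, AddCommGroup (N U)]
    [∀ U, Module S (N U)] (U₀ : Finset ι) : Prop :=
  ∀ U v, U₀ ⊆ U → v ∉ U → ∃ g : N U →ₗ[S] N (insert v U),
    IsShortExact (x v • LinearMap.id : N U →ₗ[S] N U) g

variable {M : Type u} [AddCommGroup M] [Module S M] {U₀ : Finset ι}

/-- Multiplication by `x v` is zero on `Ext`, since it is zero on M. It is also injective: in degree
0 by regularity, and in higher degrees because the preceding `Ext` into the quotient vanishes by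
induction. -/
lemma IsRegularFamily.subsingleton_ext (hN : IsRegularFamily x N U₀) {T : Finset ι}
    (hM : ∀ v ∈ T, ∀ y : M, x v • y = 0) :
    ∀ U, U₀ ⊆ U → Disjoint T U → ∀ j < T.card, Subsingleton (ExtM S M (N U) j) := by
  induction T using Finset.induction_on with
  | empty => simp
  | insert v T hv ih =>
    intro U hU hd j hj
    rw [Finset.disjoint_insert_left] at hd
    obtain ⟨g, hg⟩ := hN U v hU hd.1
    have hinj : Function.Injective (extPost M (x v • LinearMap.id : N U →ₗ[S] N U) j) := by
      rcases j with _ | j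
      · rw [injective_iff_map_eq_zero]
        intro z hz
        obtain ⟨φ, rfl⟩ := (extZeroEquiv M (N U)).symm.surjective z
        rw [extPost_smul_id, ← map_smul, LinearEquiv.map_eq_zero_iff] at hz
        rw [LinearEquiv.map_eq_zero_iff]
        ext y
        exact hg.inj (by simpa using LinearMap.congr_fun hz y)
      · have := ih (fun w hw ↦ hM w (Finset.mem_insert_of_mem hw)) (insert v U)
          (hU.trans (Finset.subset_insert _ _))
          (Finset.disjoint_insert_right.mpr ⟨hv, hd.2⟩) j
          (by rw [Finset.card_insert_of_notMem hv] at hj; omega)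
        exact (hg.exact_δ_post (M := M) j).injective_of_subsingleton_left
    refine ⟨fun z z' ↦ hinj ?_⟩
    rw [extPost_smul_id, extPost_smul_id,
      smul_ext_eq_zero_of_left (hM v (Finset.mem_insert_self _ _)),
      smul_ext_eq_zero_of_left (hM v (Finset.mem_insert_self _ _))]

/-- By the vanishing below `T.card`, the connecting map embeds `Ext` into the quotient by `x v` in
the next `Ext` into `N U`; iterating over T starts from `Hom`. -/
lemma IsRegularFamily.not_subsingleton_ext (hN : IsRegularFamily x N U₀) {T : Finset ι}
    (hM : ∀ v ∈ T, ∀ y : M, x v • y = 0) :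
    ∀ U, U₀ ⊆ U → Disjoint T U → ¬ Subsingleton (ExtM S M (N (T ∪ U)) 0) →
      ¬ Subsingleton (ExtM S M (N U) T.card) := by
  induction T using Finset.induction_on with
  | empty => intro U _ _; rw [Finset.empty_union]; exact id
  | insert v T hv ih =>
    intro U hU hd h0
    have hvan := hN.subsingleton_ext hM U hU hd
    rw [Finset.card_insert_of_notMem hv] at hvan ⊢
    rw [Finset.disjoint_insert_left] at hd
    obtain ⟨g, hg⟩ := hN U v hU hd.1
    have := hvan T.card (by omega)
    have h1 := ih (fun w hw ↦ hM w (Finset.mem_insert_of_mem hw)) (insert v U)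
      (hU.trans (Finset.subset_insert _ _)) (Finset.disjoint_insert_right.mpr ⟨hv, hd.2⟩)
      (by rwa [Finset.union_insert, ← Finset.insert_union])
    intro hs
    exact h1 (hg.exact_post_δ (M := M) T.card).subsingleton_mid

/-- Passing to the quotient by a regular element of the maximal ideal raises the degree of a
nonvanishing `Ext`. -/
lemma IsRegularFamily.not_subsingleton_ext_left [IsLocalRing S] [IsNoetherianRing S]
    [∀ U, Module.Finite S (N U)] (hN : IsRegularFamily x N U₀)
    (hx : ∀ v, x v ∈ IsLocalRing.maximalIdeal S) {T : Finset ι} (hT : Disjoint T U₀)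
    (h0 : ¬ Subsingleton (ExtM S (N U₀) S 0)) :
    ¬ Subsingleton (ExtM S (N (T ∪ U₀)) S T.card) := by
  induction T using Finset.induction_on with
  | empty => rwa [Finset.empty_union]
  | insert v T hv ih =>
    rw [Finset.disjoint_insert_left] at hT
    rw [Finset.card_insert_of_notMem hv, Finset.insert_union]
    intro hs
    apply ih hT.2
    obtain ⟨g, hg⟩ := hN (T ∪ U₀) v Finset.subset_union_right (by simp [hv, hT.1])
    have hsurj := (hg.exact_pre_δ (N := S) T.card).surjective_of_subsingleton_right
    have hfin : Module.Finite S (ExtM S (N (T ∪ U₀)) S T.card) := inferInstance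
    -- If the next `Ext` were zero, multiplication by `x v` would be onto here, and Nakayama's lemma
    -- would annihilate this `Ext`.
    have : (⊤ : Submodule S (ExtM S (N (T ∪ U₀)) S T.card)) = ⊥ := by
      refine Submodule.eq_bot_of_le_smul_of_le_jacobson_bot (IsLocalRing.maximalIdeal S) ⊤
        hfin.fg_top ?_ (IsLocalRing.maximalIdeal_le_jacobson _)
      intro y _
      obtain ⟨z, rfl⟩ := hsurj y
      rw [extPre_smul_id]
      exact Submodule.smul_mem_smul (hx v) trivial
    rw [← Submodule.subsingleton_iff S]
    exact subsingleton_of_bot_eq_top this.symm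

end RegularFamily

/-! ## Squarefree multigraded resolutions of squarefree monomial ideals -/

section Squarefree

open MvPolynomial

variable {k : Type u} [Field k] {m : ℕ}

/-- `w` is supported on the basis elements of degree contained in `σ`. -/
def SupportedIn {r : ℕ} (δ : Fin r → Finset (Fin m)) (σ : Finset (Fin m)) (w : Fin r → k) : Prop :=
  ∀ b, w b ≠ 0 → δ b ⊆ σ

/-- Basis elements with squarefree degrees, together with the squarefree strands of the submodule
still to be generated. -/
structure SqStage (k : Type u) [Field k] (m : ℕ) where
  /-- the number of basis elements -/
  rank : ℕ
  /-- the degrees of the basis elements -/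
  deg : Fin rank → Finset (Fin m)
  /-- the squarefree strands of the submodule -/
  strand : Finset (Fin m) → Submodule k (Fin rank → k)
  mono : Monotone strand
  strict : ∀ σ, ∀ v ∈ strand σ, ∀ a, v a ≠ 0 → deg a ⊂ σ

/-- The columns of `c` generate the strands. -/
def SqStage.Generates (T : SqStage k m) {r : ℕ} (δ : Fin r → Finset (Fin m))
    (c : Matrix (Fin T.rank) (Fin r) k) : Prop :=
  ∀ σ v, v ∈ T.strand σ ↔ ∃ w, SupportedIn δ σ w ∧ c.mulVec w = v

/-- Bases of all the strands together generate; this wasteful system makes the search for a smallest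
one meaningful. -/
lemma SqStage.exists_generates (T : SqStage k m) :
    ∃ (r : ℕ) (δ : Fin r → Finset (Fin m)) (c : Matrix (Fin T.rank) (Fin r) k),
      T.Generates δ c := by
  let ι := Σ σ : Finset (Fin m), Fin (Module.finrank k (T.strand σ))
  let e := Fintype.equivFin ι
  let B := fun σ ↦ Module.finBasis k (T.strand σ)
  let z : ι → (Fin T.rank → k) := fun x ↦ B x.1 x.2
  have hz : ∀ w : Fin (Fintype.card ι) → k,
      (Matrix.of fun a b ↦ z (e.symm b) a).mulVec w = ∑ x : ι, w (e x) • z x := by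
    intro w
    rw [← e.symm.sum_comp]
    ext a
    simp [Matrix.mulVec, dotProduct, mul_comm]
  refine ⟨Fintype.card ι, fun b ↦ (e.symm b).1, Matrix.of fun a b ↦ z (e.symm b) a, fun σ v ↦ ?_⟩
  constructor
  · intro hv
    let g : ι → k := fun x ↦ if h : x.1 = σ then (B σ).repr ⟨v, hv⟩ (h ▸ x.2) else 0
    refine ⟨g ∘ e.symm, fun b hb ↦ ?_, ?_⟩
    · by_contra hne
      refine hb (dif_neg ?_)
      rintro rfl
      exact hne subset_rfl
    · rw [hz, Fintype.sum_sigma, Finset.sum_eq_single σ]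
      · have := congrArg Subtype.val ((B σ).sum_repr ⟨v, hv⟩)
        rw [Submodule.coe_sum] at this
        have hg : ∀ x, g ⟨σ, x⟩ = (B σ).repr ⟨v, hv⟩ x := fun x ↦ by simp [g]
        simpa [z, hg] using this
      · intro τ _ hτ
        simp [hτ, g]
      · simp
  · rintro ⟨w, hw, rfl⟩
    rw [hz]
    refine Submodule.sum_mem _ fun x _ ↦ ?_
    by_cases h0 : w (e x) = 0
    · simp [h0]
    · refine Submodule.smul_mem _ _ (T.mono ?_ (B x.1 x.2).2)
      simpa using hw _ h0

/-- There is a minimal system of generators of the strands. -/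
lemma SqStage.exists_minimal_generates (T : SqStage k m) :
    ∃ (r : ℕ) (δ : Fin r → Finset (Fin m)) (c : Matrix (Fin T.rank) (Fin r) k),
      T.Generates δ c ∧
      ∀ σ w, SupportedIn δ σ w → c.mulVec w = 0 → ∀ b, w b ≠ 0 → δ b ⊂ σ := by
  classical
  obtain ⟨δ, c, hg⟩ := Nat.find_spec T.exists_generates
  have hmin := fun n (hn : n < Nat.find T.exists_generates) ↦ Nat.find_min T.exists_generates hn
  generalize Nat.find T.exists_generates = r at *
  refine ⟨r, δ, c, hg, fun σ w hw hc b hb ↦ lt_of_le_of_ne (hw b hb) ?_⟩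
  rintro rfl
  obtain ⟨r, rfl⟩ : ∃ n, r = n + 1 := ⟨r - 1, by have := b.2; omega⟩
  -- In a system with the fewest generators, a relation in degree `δ b` with nonzero coefficient at
  -- b would make the generator b redundant: subtracting a multiple of w clears the coordinate b
  -- without leaving the strand.
  refine hmin r (by omega) ⟨δ ∘ b.succAbove, Matrix.of fun a i ↦ c a (b.succAbove i), ?_⟩
  intro σ v
  rw [hg σ v]
  constructor
  · rintro ⟨u, hu, rfl⟩
    let u' := u - (u b / w b) • w
    have hu'b : u' b = 0 := by simp [u', hb]
    have hcu : c.mulVec u' = c.mulVec u := by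
      simp [u', Matrix.mulVec_sub, Matrix.mulVec_smul, hc]
    refine ⟨u' ∘ b.succAbove, fun i hi ↦ ?_, ?_⟩
    · by_cases h1 : u (b.succAbove i) = 0
      · have h2 : u b ≠ 0 := by
          intro h
          exact hi (by simp [u', h, h1])
        have h3 : w (b.succAbove i) ≠ 0 := by
          intro h
          exact hi (by simp [u', h, h1])
        exact (hw _ h3).trans (hu _ h2)
      · exact hu _ h1
    · rw [← hcu]
      ext a
      simp only [Matrix.mulVec, dotProduct]
      rw [Fin.sum_univ_succAbove _ b, hu'b, mul_zero, zero_add]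
      rfl
  · rintro ⟨u, hu, rfl⟩
    refine ⟨b.insertNth 0 u, fun i hi ↦ ?_, ?_⟩
    · rcases Fin.eq_self_or_eq_succAbove b i with rfl | ⟨j, rfl⟩
      · simp at hi
      · exact hu j (by simpa using hi)
    · ext a
      simp only [Matrix.mulVec, dotProduct]
      rw [Fin.sum_univ_succAbove _ b]
      simp

/-- The submodule of vectors supported in `σ`. -/
def supportedSubmodule {r : ℕ} (δ : Fin r → Finset (Fin m)) (σ : Finset (Fin m)) :
    Submodule k (Fin r → k) where
  carrier := {w | SupportedIn δ σ w}
  zero_mem' := fun b hb ↦ absurd rfl hb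
  add_mem' := fun {v w} hv hw b hb ↦ by
    by_cases h : v b = 0
    · exact hw b fun h' ↦ hb (by simp [h, h'])
    · exact hv b h
  smul_mem' := fun c v hv b hb ↦ hv b fun h ↦ hb (by simp [h])

/-- A squarefree multigraded minimal free resolution, given by its coefficient matrices; `U` is the
set of squarefree monomials in the ideal. -/
structure SqResolution (k : Type u) [Field k] {m : ℕ} (U : Set (Finset (Fin m))) where
  /-- the ranks of the free modules -/
  rank : ℕ → ℕ
  /-- the degrees of the basis elements -/
  deg : ∀ i, Fin (rank i) → Finset (Fin m)
  /-- the coefficient matrices -/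
  coef : ∀ i, Matrix (Fin (rank i)) (Fin (rank (i + 1))) k
  rank_zero : rank 0 = 1
  deg_zero : ∀ a, deg 0 a = ∅
  deg_ssubset : ∀ i a b, coef i a b ≠ 0 → deg i a ⊂ deg (i + 1) b
  exists_coef_ne_zero : ∀ i b, ∃ a, coef i a b ≠ 0
  strand_zero : ∀ σ, σ ∈ U ↔ ∃ w, SupportedIn (deg 1) σ w ∧ (coef 0).mulVec w ≠ 0
  strand_succ : ∀ i σ v, (SupportedIn (deg (i + 1)) σ v ∧ (coef i).mulVec v = 0) ↔
    ∃ w, SupportedIn (deg (i + 2)) σ w ∧ (coef (i + 1)).mulVec w = v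

/-- The stage of syzygies of a minimal system of generators. -/
noncomputable def SqStage.next (T : SqStage k m) : SqStage k m where
  rank := T.exists_minimal_generates.choose
  deg := T.exists_minimal_generates.choose_spec.choose
  strand σ := supportedSubmodule T.exists_minimal_generates.choose_spec.choose σ ⊓
    LinearMap.ker T.exists_minimal_generates.choose_spec.choose_spec.choose.mulVecLin
  mono := fun _ _ h _ hv ↦ ⟨fun b hb ↦ (hv.1 b hb).trans h, hv.2⟩
  strict := fun σ v hv a ha ↦
    T.exists_minimal_generates.choose_spec.choose_spec.choose_spec.2 σ v hv.1
      (LinearMap.mem_ker.mp hv.2) a ha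

/-- The coefficient matrix from the next stage. -/
noncomputable def SqStage.coef (T : SqStage k m) : Matrix (Fin T.rank) (Fin T.next.rank) k :=
  T.exists_minimal_generates.choose_spec.choose_spec.choose

lemma SqStage.generates_coef (T : SqStage k m) : T.Generates T.next.deg T.coef :=
  T.exists_minimal_generates.choose_spec.choose_spec.choose_spec.1

lemma SqStage.mem_next_strand (T : SqStage k m) (σ : Finset (Fin m)) (v : Fin T.next.rank → k) :
    v ∈ T.next.strand σ ↔ SupportedIn T.next.deg σ v ∧ T.coef.mulVec v = 0 := Iff.rfl

lemma supportedIn_single {r : ℕ} (δ : Fin r → Finset (Fin m)) (b : Fin r) :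
    SupportedIn δ (δ b) (Pi.single b (1 : k)) := by
  intro a ha
  by_cases h : a = b
  · rw [h]
  · simp [h] at ha

lemma SqStage.deg_ssubset (T : SqStage k m) (a : Fin T.rank) (b : Fin T.next.rank)
    (h : T.coef a b ≠ 0) : T.deg a ⊂ T.next.deg b := by
  refine T.strict _ (T.coef.mulVec (Pi.single b 1))
    ((T.generates_coef _ _).mpr ⟨_, supportedIn_single _ b, rfl⟩) a ?_
  simpa using h

/-- A zero column would be a syzygy living in the degree of its own generator, which `strict`
forbids. -/
lemma SqStage.exists_coef_ne_zero (T : SqStage k m) (b : Fin T.next.rank) :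
    ∃ a, T.coef a b ≠ 0 := by
  by_contra! h
  have h1 : Pi.single b 1 ∈ T.next.strand (T.next.deg b) := by
    rw [T.mem_next_strand]
    refine ⟨supportedIn_single _ b, ?_⟩
    ext a
    simp [h]
  exact (T.next.strict _ _ h1 b (by simp)).ne rfl

/-- Every up-closed set of nonempty squarefree monomials has a squarefree resolution. -/
theorem nonempty_sqResolution (k : Type u) [Field k] {U : Set (Finset (Fin m))}
    (hU : ∀ σ ∈ U, ∀ τ, σ ⊆ τ → τ ∈ U) (h0 : ∅ ∉ U) : Nonempty (SqResolution k U) := by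
  classical
  let T₀ : SqStage k m :=
    { rank := 1
      deg := fun _ ↦ ∅
      strand := fun σ ↦ if σ ∈ U then ⊤ else ⊥
      mono := by
        intro σ τ h
        by_cases hσ : σ ∈ U
        · simp [hσ, hU σ hσ τ h]
        · simp [hσ]
      strict := by
        intro σ v hv a ha
        by_cases hσ : σ ∈ U
        · exact Finset.empty_ssubset.mpr (Finset.nonempty_iff_ne_empty.mpr fun h ↦ h0 (h ▸ hσ))
        · simp only [hσ, if_false, Submodule.mem_bot] at hv
          simp [hv] at ha }
  let T : ℕ → SqStage k m := fun n ↦ Nat.rec T₀ (fun _ ↦ SqStage.next) n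
  refine ⟨{ rank := fun i ↦ (T i).rank
            deg := fun i ↦ (T i).deg
            coef := fun i ↦ (T i).coef
            rank_zero := rfl
            deg_zero := fun _ ↦ rfl
            deg_ssubset := fun i ↦ (T i).deg_ssubset
            exists_coef_ne_zero := fun i ↦ (T i).exists_coef_ne_zero
            strand_zero := fun σ ↦ ?_
            strand_succ := fun i σ v ↦ (T (i + 1)).generates_coef σ v }⟩
  have h1 := (T 0).generates_coef σ
  constructor
  · intro hσ
    have hmem : (fun _ ↦ 1) ∈ (T 0).strand σ := by
      change _ ∈ (if σ ∈ U then ⊤ else ⊥ : Submodule k (Fin 1 → k))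
      rw [if_pos hσ]
      trivial
    obtain ⟨w, hw, hw'⟩ := (h1 _).mp hmem
    exact ⟨w, hw, fun h ↦ one_ne_zero (congrFun (hw'.symm.trans h) (0 : Fin 1))⟩
  · rintro ⟨w, hw, hw'⟩
    by_contra hσ
    have hmem := (h1 _).mpr ⟨w, hw, rfl⟩
    change _ ∈ (if σ ∈ U then ⊤ else ⊥ : Submodule k (Fin 1 → k)) at hmem
    rw [if_neg hσ] at hmem
    exact hw' hmem

/-! ### The resolution over the polynomial ring -/

/-- The exponent of the squarefree monomial with support `σ`. -/
noncomputable def sqExp (σ : Finset (Fin m)) : Fin m →₀ ℕ :=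
  Finsupp.equivFunOnFinite.symm fun i ↦ if i ∈ σ then 1 else 0

lemma sqExp_apply (σ : Finset (Fin m)) (i : Fin m) : sqExp σ i = if i ∈ σ then 1 else 0 := rfl

lemma sqExp_le_iff (σ : Finset (Fin m)) (e : Fin m →₀ ℕ) : sqExp σ ≤ e ↔ σ ⊆ e.support := by
  constructor
  · intro h i hi
    have := h i
    rw [sqExp_apply, if_pos hi] at this
    simp only [Finsupp.mem_support_iff]
    omega
  · intro h i
    rw [sqExp_apply]
    split_ifs with hi
    · have := h hi
      simp only [Finsupp.mem_support_iff] at this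
      omega
    · exact Nat.zero_le _

lemma sqExp_add_sdiff {σ τ : Finset (Fin m)} (h : σ ⊆ τ) : sqExp σ + sqExp (τ \ σ) = sqExp τ := by
  ext i
  simp only [Finsupp.add_apply, sqExp_apply, Finset.mem_sdiff]
  by_cases h1 : i ∈ σ
  · simp [h1, h h1]
  · by_cases h2 : i ∈ τ <;> simp [h1, h2]

lemma support_sqExp (σ : Finset (Fin m)) : (sqExp σ).support = σ := by
  ext i
  simp [sqExp_apply]

lemma monomial_sqExp (σ : Finset (Fin m)) :
    monomial (sqExp σ) (1 : k) = ∏ i ∈ σ, X i := by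
  rw [monomial_eq, C_1, one_mul, Finsupp.prod, support_sqExp]
  exact Finset.prod_congr rfl fun i hi ↦ by rw [sqExp_apply, if_pos hi, pow_one]

/-- The ideal generated by the squarefree monomials in `U`. -/
noncomputable def sqIdeal (k : Type u) [Field k] (U : Set (Finset (Fin m))) :
    Ideal (MvPolynomial (Fin m) k) :=
  Ideal.span {f | ∃ σ ∈ U, f = ∏ i ∈ σ, X i}

variable {U : Set (Finset (Fin m))} (G : SqResolution k U)

/-- The differentials over the polynomial ring. -/
noncomputable def SqResolution.d (i : ℕ) :
    Matrix (Fin (G.rank i)) (Fin (G.rank (i + 1))) (MvPolynomial (Fin m) k) :=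
  Matrix.of fun a b ↦ monomial (sqExp (G.deg (i + 1) b \ G.deg i a)) (G.coef i a b)

/-- The strand of degree `e` of a vector of polynomials. -/
noncomputable def strandAt {r : ℕ} (δ : Fin r → Finset (Fin m)) (e : Fin m →₀ ℕ)
    (v : Fin r → MvPolynomial (Fin m) k) (b : Fin r) : k :=
  if sqExp (δ b) ≤ e then coeff (e - sqExp (δ b)) (v b) else 0

lemma supportedIn_strandAt {r : ℕ} (δ : Fin r → Finset (Fin m)) (e : Fin m →₀ ℕ)
    (v : Fin r → MvPolynomial (Fin m) k) : SupportedIn δ e.support (strandAt δ e v) := by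
  intro b hb
  rw [← sqExp_le_iff]
  by_contra h
  exact hb (if_neg h)

lemma strandAt_ext {r : ℕ} (δ : Fin r → Finset (Fin m)) {v w : Fin r → MvPolynomial (Fin m) k}
    (h : ∀ e, strandAt δ e v = strandAt δ e w) : v = w := by
  funext b
  ext u
  have := congrFun (h (u + sqExp (δ b))) b
  simpa [strandAt] using this

lemma strandAt_zero {r : ℕ} (δ : Fin r → Finset (Fin m)) (e : Fin m →₀ ℕ) :
    strandAt δ e (0 : Fin r → MvPolynomial (Fin m) k) = 0 := by
  funext b
  simp [strandAt]

/-- In multidegree e the polynomial matrix acts as the scalar matrix on those basis elements whose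
monomial divides the monomial of e. Hence only the support of e matters, and exactness over the
polynomial ring reduces to squarefree strands. -/
lemma SqResolution.strandAt_mulVec (i : ℕ) (e : Fin m →₀ ℕ)
    (v : Fin (G.rank (i + 1)) → MvPolynomial (Fin m) k) :
    strandAt (G.deg i) e ((G.d i).mulVec v) =
      (G.coef i).mulVec (strandAt (G.deg (i + 1)) e v) := by
  funext a
  simp only [strandAt, Matrix.mulVec, dotProduct, SqResolution.d, Matrix.of_apply]
  split_ifs with ha
  · rw [coeff_sum]
    refine Finset.sum_congr rfl fun b _ ↦ ?_
    rw [coeff_monomial_mul']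
    by_cases hc : G.coef i a b = 0
    · simp [hc]
    · have h1 := sqExp_add_sdiff (G.deg_ssubset i a b hc).subset
      have h2 : sqExp (G.deg (i + 1) b \ G.deg i a) ≤ e - sqExp (G.deg i a) ↔
          sqExp (G.deg (i + 1) b) ≤ e := by
        rw [← h1, le_tsub_iff_left ha]
      simp only [h2]
      split_ifs
      · rw [tsub_tsub, h1]
      · simp
  · symm
    refine Finset.sum_eq_zero fun b _ ↦ ?_
    by_cases hc : G.coef i a b = 0
    · simp [hc]
    · rw [if_neg, mul_zero]
      intro hb
      apply ha
      rw [sqExp_le_iff] at hb ⊢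
      exact (G.deg_ssubset i a b hc).subset.trans hb

lemma SqResolution.coef_mul_coef (i : ℕ) (w : Fin (G.rank (i + 2)) → k) :
    (G.coef i).mulVec ((G.coef (i + 1)).mulVec w) = 0 :=
  ((G.strand_succ i Finset.univ _).mpr ⟨w, fun _ _ ↦ Finset.subset_univ _, rfl⟩).2

lemma SqResolution.range_eq_ker (i : ℕ) :
    LinearMap.range (G.d (i + 1)).mulVecLin = LinearMap.ker (G.d i).mulVecLin := by
  classical
  apply le_antisymm
  · rintro _ ⟨w, rfl⟩
    rw [LinearMap.mem_ker, Matrix.mulVecLin_apply, Matrix.mulVecLin_apply]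
    refine strandAt_ext (G.deg i) fun e ↦ ?_
    rw [strandAt_mulVec, strandAt_mulVec, G.coef_mul_coef, strandAt_zero]
  · intro v hv
    rw [LinearMap.mem_ker, Matrix.mulVecLin_apply] at hv
    have hv' : ∀ e, (G.coef i).mulVec (strandAt (G.deg (i + 1)) e v) = 0 := by
      intro e
      rw [← strandAt_mulVec, hv, strandAt_zero]
    have hex : ∀ e : Fin m →₀ ℕ, ∃ w, (SupportedIn (G.deg (i + 2)) e.support w ∧
        (G.coef (i + 1)).mulVec w = strandAt (G.deg (i + 1)) e v) ∧
        -- The choice w = 0 on zero strands leaves only finitely many degrees, so that the preimage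
        -- assembled from the strands is a vector of polynomials.
        (strandAt (G.deg (i + 1)) e v = 0 → w = 0) := by
      intro e
      by_cases h0 : strandAt (G.deg (i + 1)) e v = 0
      · exact ⟨0, ⟨fun b hb ↦ absurd rfl hb, by rw [h0, Matrix.mulVec_zero]⟩, fun _ ↦ rfl⟩
      · obtain ⟨w, hw⟩ := (G.strand_succ i e.support _).mp ⟨supportedIn_strandAt _ e v, hv' e⟩
        exact ⟨w, hw, fun h ↦ absurd h h0⟩
    choose w hw hw0 using hex
    let T : Finset (Fin m →₀ ℕ) := Finset.univ.biUnion fun b ↦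
      (v b).support.image (· + sqExp (G.deg (i + 1) b))
    have hT : ∀ e, e ∉ T → w e = 0 := by
      intro e he
      apply hw0
      funext b
      by_contra hne
      apply he
      simp only [strandAt, Pi.zero_apply] at hne
      split_ifs at hne with hle
      · simp only [T, Finset.mem_biUnion, Finset.mem_univ, true_and, Finset.mem_image]
        exact ⟨b, e - sqExp (G.deg (i + 1) b), by simpa using hne, tsub_add_cancel_of_le hle⟩
      · exact absurd rfl hne
    refine ⟨fun b ↦ ∑ e ∈ T, if sqExp (G.deg (i + 2) b) ≤ e then
      monomial (e - sqExp (G.deg (i + 2) b)) (w e b) else 0, ?_⟩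
    rw [Matrix.mulVecLin_apply]
    refine strandAt_ext (G.deg (i + 1)) fun e ↦ ?_
    rw [strandAt_mulVec, ← (hw e).2]
    congr 1
    funext b
    rw [strandAt]
    split_ifs with hb
    · rw [coeff_sum, Finset.sum_eq_single e]
      · rw [if_pos hb, coeff_monomial, if_pos rfl]
      · intro e' _ hne
        split_ifs with hb'
        · rw [coeff_monomial, if_neg]
          intro h
          exact hne ((tsub_left_inj hb' hb).mp h)
        · simp
      · intro he
        rw [if_pos hb, coeff_monomial, if_pos rfl, hT e he]; rfl
    · by_contra hne
      apply hb
      rw [sqExp_le_iff]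
      exact (hw e).1 b (Ne.symm hne)

lemma SqResolution.entryIdeal_d_zero : entryIdeal (G.d 0) = sqIdeal k U := by
  apply le_antisymm
  · refine Ideal.span_le.mpr ?_
    rintro _ ⟨a, b, rfl⟩
    by_cases hc : G.coef 0 a b = 0
    · simp [SqResolution.d, hc]
    · have hb : G.deg 1 b ∈ U := by
        refine (G.strand_zero _).mpr ⟨_, supportedIn_single _ b, fun h ↦ hc ?_⟩
        simpa using congrFun h a
      have : G.d 0 a b = C (G.coef 0 a b) * ∏ i ∈ G.deg 1 b, X i := by
        rw [← monomial_sqExp, C_mul_monomial, mul_one]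
        simp [SqResolution.d, G.deg_zero]
      rw [SetLike.mem_coe, this]
      exact Ideal.mul_mem_left _ _ (Ideal.subset_span ⟨_, hb, rfl⟩)
  · refine Ideal.span_le.mpr ?_
    rintro _ ⟨σ, hσ, rfl⟩
    obtain ⟨w, hw, hne⟩ := (G.strand_zero σ).mp hσ
    obtain ⟨a, ha⟩ := Function.ne_iff.mp hne
    obtain ⟨b, -, hb⟩ := Finset.exists_ne_zero_of_sum_ne_zero
      (show ∑ b, G.coef 0 a b * w b ≠ 0 from ha)
    have hbσ := hw b (right_ne_zero_of_mul hb)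
    have hc := left_ne_zero_of_mul hb
    have : ∏ i ∈ σ, (X i : MvPolynomial (Fin m) k) =
        monomial (sqExp (σ \ G.deg 1 b)) (G.coef 0 a b)⁻¹ * G.d 0 a b := by
      rw [← monomial_sqExp, SqResolution.d, Matrix.of_apply, monomial_mul, G.deg_zero,
        Finset.sdiff_empty, inv_mul_cancel₀ hc, add_comm, sqExp_add_sdiff hbσ]
    rw [SetLike.mem_coe, this]
    exact Ideal.mul_mem_left _ _ (Ideal.subset_span ⟨a, b, rfl⟩)

lemma SqResolution.isResolution : IsResolution G.d (sqIdeal k U) :=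
  ⟨G.rank_zero, G.entryIdeal_d_zero, G.range_eq_ker⟩

lemma SqResolution.constantCoeff_d (i : ℕ) (a : Fin (G.rank i)) (b : Fin (G.rank (i + 1))) :
    constantCoeff (G.d i a b) = 0 := by
  by_cases hc : G.coef i a b = 0
  · simp [SqResolution.d, hc]
  · obtain ⟨j, hj, hj'⟩ := Finset.exists_of_ssubset (G.deg_ssubset i a b hc)
    rw [SqResolution.d, Matrix.of_apply, constantCoeff_monomial, if_neg]
    intro h
    have := DFunLike.congr_fun h j
    simp [sqExp_apply, hj, hj'] at this

lemma SqResolution.le_card_deg (i : ℕ) (b : Fin (G.rank i)) : i ≤ (G.deg i b).card := by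
  induction i with
  | zero => exact Nat.zero_le _
  | succ i ih =>
    obtain ⟨a, ha⟩ := G.exists_coef_ne_zero i b
    have := Finset.card_lt_card (G.deg_ssubset i a b ha)
    have := ih a
    omega

/-- The degrees strictly increase as subsets of an m-element set, so there are at most m steps. -/
lemma SqResolution.rank_eq_zero (i : ℕ) (hi : m < i) : G.rank i = 0 := by
  by_contra h
  have h1 := G.le_card_deg i ⟨0, Nat.pos_of_ne_zero h⟩
  have h2 := Finset.card_le_univ (G.deg i ⟨0, Nat.pos_of_ne_zero h⟩)
  rw [Fintype.card_fin] at h2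
  omega

end Squarefree

/-! ## Ideals generated by variables -/

section VarIdeal

open MvPolynomial

variable {k : Type u} [Field k] {m : ℕ}

/-- The ideal generated by the variables in `U`. -/
noncomputable def varIdeal (k : Type u) [Field k] {m : ℕ} (U : Finset (Fin m)) :
    Ideal (MvPolynomial (Fin m) k) :=
  Ideal.span (X '' (U : Set (Fin m)))

lemma mem_varIdeal {U : Finset (Fin m)} {f : MvPolynomial (Fin m) k} :
    f ∈ varIdeal k U ↔ ∀ e ∈ f.support, ∃ i ∈ U, e i ≠ 0 := by
  simp [varIdeal, mem_ideal_span_X_image]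

lemma X_mem_varIdeal_iff {U : Finset (Fin m)} {v : Fin m} :
    (X v : MvPolynomial (Fin m) k) ∈ varIdeal k U ↔ v ∈ U := by
  simp [mem_varIdeal, support_X, Finsupp.single_apply]

/-- Killing the variables in U is a substitution into a domain, which makes the ideal prime. -/
lemma varIdeal_eq_ker (U : Finset (Fin m)) :
    varIdeal k U = RingHom.ker (aeval (R := k) (fun i ↦ if i ∈ U then (0 : MvPolynomial (Fin m) k)
      else X i)) := by
  apply le_antisymm
  · refine Ideal.span_le.mpr ?_
    rintro _ ⟨i, hi, rfl⟩
    have : i ∈ U := hi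
    simp [RingHom.mem_ker, this]
  · intro f hf
    have key : ∀ g : MvPolynomial (Fin m) k, g - aeval (fun i ↦ if i ∈ U then
        (0 : MvPolynomial (Fin m) k) else X i) g ∈ varIdeal k U := by
      intro g
      induction g using MvPolynomial.induction_on with
      | C a => simp [algebraMap_eq]
      | add p q hp hq =>
        rw [map_add, add_sub_add_comm]
        exact Ideal.add_mem _ hp hq
      | mul_X p i hp =>
        rw [map_mul, aeval_X]
        split_ifs with hi
        · rw [mul_zero, sub_zero]
          exact Ideal.mul_mem_left _ _ (X_mem_varIdeal_iff.mpr hi)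
        · rw [← sub_mul]
          exact Ideal.mul_mem_right _ _ hp
    have := key f
    rwa [RingHom.mem_ker.mp hf, sub_zero] at this

instance isPrime_varIdeal (U : Finset (Fin m)) : (varIdeal k U).IsPrime := by
  rw [varIdeal_eq_ker]
  exact RingHom.ker_isPrime _

lemma varIdeal_insert (U : Finset (Fin m)) (v : Fin m) :
    varIdeal k (insert v U) = varIdeal k U ⊔ Ideal.span {X v} := by
  rw [varIdeal, varIdeal, Finset.coe_insert, Set.image_insert_eq, Ideal.span_insert, sup_comm]

lemma mem_varIdeal_univ {f : MvPolynomial (Fin m) k} :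
    f ∈ varIdeal k (Finset.univ : Finset (Fin m)) ↔ constantCoeff f = 0 := by
  rw [mem_varIdeal, constantCoeff_eq]
  constructor
  · intro h
    by_contra h0
    obtain ⟨i, -, hi⟩ := h 0 (mem_support_iff.mpr h0)
    exact hi rfl
  · intro h e he
    by_contra! hc
    have : e = 0 := Finsupp.ext fun i ↦ hc i (Finset.mem_univ i)
    rw [this, mem_support_iff] at he
    exact he h

instance isMaximal_varIdeal_univ :
    (varIdeal k (Finset.univ : Finset (Fin m))).IsMaximal := by
  have : varIdeal k (Finset.univ : Finset (Fin m)) = RingHom.ker (constantCoeff (R := k)) := by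
    ext f
    rw [mem_varIdeal_univ, RingHom.mem_ker]
  rw [this]
  exact RingHom.ker_isMaximal_of_surjective _ fun a ↦ ⟨C a, by simp⟩

/-- Multiplication by a regular element on a quotient ring. -/
lemma isShortExact_quotient {B : Type*} [CommRing B] {P P' : Ideal B} {x : B}
    (hreg : ∀ b, x * b ∈ P → b ∈ P) (hP' : P' = P ⊔ Ideal.span {x}) :
    ∃ g : (B ⧸ P) →ₗ[B] (B ⧸ P'), IsShortExact (x • LinearMap.id : (B ⧸ P) →ₗ[B] (B ⧸ P)) g := by
  have hle : P ≤ P' := hP' ▸ le_sup_left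
  refine ⟨Submodule.factor hle, ?_, ?_, Submodule.factor_surjective hle⟩
  · rw [injective_iff_map_eq_zero]
    intro b hb
    obtain ⟨b, rfl⟩ := Submodule.Quotient.mk_surjective _ b
    rw [LinearMap.smul_apply, LinearMap.id_apply, ← Submodule.Quotient.mk_smul,
      Submodule.Quotient.mk_eq_zero] at hb
    rw [Submodule.Quotient.mk_eq_zero]
    exact hreg b hb
  · intro b
    obtain ⟨b, rfl⟩ := Submodule.Quotient.mk_surjective _ b
    constructor
    · intro hb
      have hb' : b ∈ P' := (Submodule.Quotient.mk_eq_zero P').mp hb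
      rw [hP', Submodule.mem_sup] at hb'
      obtain ⟨y, hy, z, hz, rfl⟩ := hb'
      obtain ⟨c, rfl⟩ := Ideal.mem_span_singleton'.mp hz
      refine ⟨Submodule.Quotient.mk c, ?_⟩
      rw [LinearMap.smul_apply, LinearMap.id_apply, ← Submodule.Quotient.mk_smul, eq_comm,
        Submodule.Quotient.eq, smul_eq_mul, mul_comm x c, add_sub_cancel_right]
      exact hy
    · rintro ⟨c, hc⟩
      obtain ⟨c, rfl⟩ := Submodule.Quotient.mk_surjective _ c
      rw [LinearMap.smul_apply, LinearMap.id_apply, ← Submodule.Quotient.mk_smul] at hc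
      rw [← hc]
      refine (Submodule.Quotient.mk_eq_zero P').mpr ?_
      rw [hP', smul_eq_mul]
      exact Ideal.mul_mem_right _ _ (Ideal.mem_sup_right (Ideal.mem_span_singleton_self x))

lemma isRegularFamily_varIdeal (k : Type u) [Field k] (m : ℕ) :
    IsRegularFamily (X : Fin m → MvPolynomial (Fin m) k)
      (fun U ↦ MvPolynomial (Fin m) k ⧸ varIdeal k U) ∅ := by
  intro U v _ hv
  refine isShortExact_quotient (fun b hb ↦ ?_) (varIdeal_insert U v)
  exact ((isPrime_varIdeal U).mem_or_mem hb).resolve_left (by rwa [X_mem_varIdeal_iff])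

lemma isRegularFamily_loc (k : Type u) [Field k] (m : ℕ)
    (p : Submonoid (MvPolynomial (Fin m) k)) :
    IsRegularFamily (X : Fin m → MvPolynomial (Fin m) k)
      (fun U ↦ LocalizedModule p (MvPolynomial (Fin m) k ⧸ varIdeal k U)) ∅ := by
  intro U v hU hv
  obtain ⟨g, hg⟩ := isRegularFamily_varIdeal k m U v hU hv
  refine ⟨locMap p g, ?_⟩
  have := hg.loc p
  rwa [map_smul, locMap_id] at this

/-- The quotient by the empty set of variables. -/
noncomputable def quotVarIdealEmpty (k : Type u) [Field k] (m : ℕ) :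
    (MvPolynomial (Fin m) k ⧸ varIdeal k (∅ : Finset (Fin m))) ≃ₗ[MvPolynomial (Fin m) k]
      MvPolynomial (Fin m) k :=
  Submodule.quotEquivOfEqBot _ (by simp [varIdeal])

lemma subsingleton_ext_of_X_smul {M : Type u} [AddCommGroup M] [Module (MvPolynomial (Fin m) k) M]
    {T : Finset (Fin m)} (hM : ∀ v ∈ T, ∀ y : M, (X v : MvPolynomial (Fin m) k) • y = 0)
    (j : ℕ) (hj : j < T.card) :
    Subsingleton (ExtM (MvPolynomial (Fin m) k) M (MvPolynomial (Fin m) k) j) := by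
  have := (isRegularFamily_varIdeal k m).subsingleton_ext hM ∅ subset_rfl
    (Finset.disjoint_empty_right T) j hj
  exact (extPostEquiv M (quotVarIdealEmpty k m) j).symm.subsingleton

lemma X_smul_quot_univ (v : Fin m)
    (y : MvPolynomial (Fin m) k ⧸ varIdeal k (Finset.univ : Finset (Fin m))) :
    (X v : MvPolynomial (Fin m) k) • y = 0 := by
  obtain ⟨y, rfl⟩ := Ideal.Quotient.mk_surjective y
  exact Ideal.Quotient.eq_zero_iff_mem.mpr
    (Ideal.mul_mem_right _ _ (X_mem_varIdeal_iff.mpr (Finset.mem_univ v)))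

variable (p : Submonoid (MvPolynomial (Fin m) k))

lemma subsingleton_ext_loc (j : ℕ) (hj : j < m) :
    Subsingleton (ExtM (MvPolynomial (Fin m) k)
      (MvPolynomial (Fin m) k ⧸ varIdeal k (Finset.univ : Finset (Fin m)))
      (LocalizedModule p (MvPolynomial (Fin m) k)) j) := by
  have := (isRegularFamily_loc k m p).subsingleton_ext (T := Finset.univ)
    (fun v _ y ↦ X_smul_quot_univ v y) ∅ subset_rfl (Finset.disjoint_empty_right _) j
    (by simpa using hj)
  exact (extPostEquiv _ (locEquiv p (quotVarIdealEmpty k m)) j).symm.subsingleton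

/-- Dividing out the variables one after the other reduces the claim to degree 0, where the
localization map of the simple module is nonzero, because 1 is not killed by any element outside the
maximal ideal. -/
lemma not_subsingleton_ext_loc :
    ¬ Subsingleton (ExtM (MvPolynomial (Fin m) k)
      (MvPolynomial (Fin m) k ⧸ varIdeal k (Finset.univ : Finset (Fin m)))
      (LocalizedModule (varIdeal k (Finset.univ : Finset (Fin m))).primeCompl
        (MvPolynomial (Fin m) k)) m) := by
  intro hs
  have h1 := (extPostEquiv (MvPolynomial (Fin m) k ⧸ varIdeal k (Finset.univ : Finset (Fin m)))
    (locEquiv (varIdeal k (Finset.univ : Finset (Fin m))).primeCompl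
      (quotVarIdealEmpty k m)) m).subsingleton
  have h2 := (isRegularFamily_loc k m
    (varIdeal k (Finset.univ : Finset (Fin m))).primeCompl).not_subsingleton_ext (T := Finset.univ)
    (M := MvPolynomial (Fin m) k ⧸ varIdeal k (Finset.univ : Finset (Fin m)))
    (fun v _ y ↦ X_smul_quot_univ v y) ∅ subset_rfl (Finset.disjoint_empty_right _)
  rw [Finset.card_univ, Fintype.card_fin] at h2
  refine h2 ?_ h1
  intro h3
  rw [Finset.union_empty] at h3
  have h4 := (extZeroEquiv (R := MvPolynomial (Fin m) k) (MvPolynomial (Fin m) k ⧸ varIdeal k (Finset.univ : Finset (Fin m)))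
    (LocalizedModule (varIdeal k (Finset.univ : Finset (Fin m))).primeCompl
      (MvPolynomial (Fin m) k ⧸ varIdeal k (Finset.univ : Finset (Fin m))))).symm.subsingleton
  have h5 : LocalizedModule.mkLinearMap (varIdeal k (Finset.univ : Finset (Fin m))).primeCompl
      (MvPolynomial (Fin m) k ⧸ varIdeal k (Finset.univ : Finset (Fin m)))
      (Submodule.Quotient.mk 1) = 0 := by
    rw [h4.elim (LocalizedModule.mkLinearMap _ _) 0, LinearMap.zero_apply]
  rw [IsLocalizedModule.eq_zero_iff
    (varIdeal k (Finset.univ : Finset (Fin m))).primeCompl] at h5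
  obtain ⟨c, hc⟩ := h5
  rw [Submonoid.smul_def, ← Submodule.Quotient.mk_smul, Submodule.Quotient.mk_eq_zero,
    smul_eq_mul, mul_one] at hc
  exact c.2 hc

end VarIdeal

/-! ## The local ring of a quotient at a maximal ideal -/

section QuotientLocal

open IsLocalRing

variable {S : Type u} [CommRing S] {I 𝔪 : Ideal S}
  [h𝔪 : (𝔪.map (Ideal.Quotient.mk I)).IsPrime]
  {A : Type u} [CommRing A] [Algebra S A] [Algebra (S ⧸ I) A]
  [IsScalarTower S (S ⧸ I) A] [IsLocalization.AtPrime A (𝔪.map (Ideal.Quotient.mk I))]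

lemma map_eq_map_map_mk (P : Ideal S) :
    P.map (algebraMap S A) = (P.map (Ideal.Quotient.mk I)).map (algebraMap (S ⧸ I) A) := by
  rw [Ideal.map_map, IsScalarTower.algebraMap_eq S (S ⧸ I) A]
  rfl

variable (I 𝔪 A) in
include h𝔪 in
lemma map_algebraMap_eq_maximalIdeal [IsLocalRing A] : 𝔪.map (algebraMap S A) = maximalIdeal A := by
  rw [map_eq_map_map_mk (I := I),
    IsLocalization.AtPrime.map_eq_maximalIdeal (𝔪.map (Ideal.Quotient.mk I)) A]

lemma disjoint_primeCompl_of_le {R : Type*} [CommRing R] {p q : Ideal R} [q.IsPrime] (h : p ≤ q) :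
    Disjoint (q.primeCompl : Set R) (p : Set R) :=
  Set.disjoint_left.mpr fun _ hx hx' ↦ hx (h hx')

include h𝔪 in
lemma isPrime_map_algebraMap {P : Ideal S} (hP : P.IsPrime) (hI : I ≤ P) (hle : P ≤ 𝔪) :
    (P.map (algebraMap S A)).IsPrime := by
  rw [map_eq_map_map_mk (I := I)]
  have h1 : (P.map (Ideal.Quotient.mk I)).IsPrime :=
    Ideal.map_isPrime_of_surjective Ideal.Quotient.mk_surjective (by rwa [Ideal.mk_ker])
  exact IsLocalization.isPrime_of_isPrime_disjoint (𝔪.map (Ideal.Quotient.mk I)).primeCompl A _ h1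
    (disjoint_primeCompl_of_le (Ideal.map_mono hle))

include h𝔪 in
lemma algebraMap_mem_map_iff {P : Ideal S} (hP : P.IsPrime) (hI : I ≤ P) (hle : P ≤ 𝔪) {x : S} :
    algebraMap S A x ∈ P.map (algebraMap S A) ↔ x ∈ P := by
  refine ⟨fun hx ↦ ?_, Ideal.mem_map_of_mem _⟩
  rw [map_eq_map_map_mk (I := I), IsScalarTower.algebraMap_apply S (S ⧸ I) A] at hx
  have h1 : (P.map (Ideal.Quotient.mk I)).IsPrime :=
    Ideal.map_isPrime_of_surjective Ideal.Quotient.mk_surjective (by rwa [Ideal.mk_ker])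
  have h2 := IsLocalization.under_map_of_isPrime_disjoint (𝔪.map (Ideal.Quotient.mk I)).primeCompl
    A h1 (disjoint_primeCompl_of_le (Ideal.map_mono hle))
  have h3 : algebraMap S (S ⧸ I) x ∈ P.map (Ideal.Quotient.mk I) := by
    rw [← h2]; exact hx
  rw [← Ideal.comap_map_mk hI]
  exact h3

variable [𝔪.IsMaximal]

lemma map_primeCompl_quotient (hI : I ≤ 𝔪) :
    Algebra.algebraMapSubmonoid (S ⧸ I) 𝔪.primeCompl =
      (𝔪.map (Ideal.Quotient.mk I)).primeCompl := by
  have hc := Ideal.comap_map_mk hI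
  ext x
  obtain ⟨x, rfl⟩ := Ideal.Quotient.mk_surjective x
  have key : ∀ y, Ideal.Quotient.mk I y ∈ 𝔪.map (Ideal.Quotient.mk I) ↔ y ∈ 𝔪 := fun y ↦ by
    conv_rhs => rw [← hc]
    rfl
  constructor
  · rintro ⟨y, hy, hyx⟩ hx
    exact hy ((key y).mp (by rw [← hyx] at hx; exact hx))
  · intro hx
    exact ⟨x, fun hx' ↦ hx ((key x).mpr hx'), rfl⟩

variable (A) in
include h𝔪 in
lemma nonempty_localizedModule_equiv (hI : I ≤ 𝔪) :
    Nonempty (LocalizedModule 𝔪.primeCompl (S ⧸ I) ≃ₗ[S] A) := by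
  have h1 : IsLocalization (Algebra.algebraMapSubmonoid (S ⧸ I) 𝔪.primeCompl) A := by
    rw [map_primeCompl_quotient hI]; infer_instance
  exact ⟨IsLocalizedModule.iso 𝔪.primeCompl (IsScalarTower.toAlgHom S (S ⧸ I) A).toLinearMap⟩

include h𝔪 in
-- S maps onto the residue field of A, since denominators are already invertible modulo 𝔪 in S. Thus
-- simplicity over A can be tested with scalars from S.
lemma exists_algebraMap_sub_mem [IsLocalRing A] (x : A) :
    ∃ s : S, algebraMap S A s - x ∈ maximalIdeal A := by
  obtain ⟨a, c, rfl⟩ := IsLocalization.exists_mk'_eq (𝔪.map (Ideal.Quotient.mk I)).primeCompl x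
  obtain ⟨a, rfl⟩ := Ideal.Quotient.mk_surjective a
  obtain ⟨c, hc⟩ := c
  obtain ⟨c, rfl⟩ := Ideal.Quotient.mk_surjective c
  have hc' : c ∉ 𝔪 := fun h ↦ hc (Ideal.mem_map_of_mem _ h)
  obtain ⟨b, hb⟩ := Ideal.Quotient.exists_inv (I := 𝔪)
    (a := Ideal.Quotient.mk 𝔪 c) (by rwa [ne_eq, Ideal.Quotient.eq_zero_iff_mem])
  obtain ⟨b, rfl⟩ := Ideal.Quotient.mk_surjective b
  rw [← map_mul, ← (Ideal.Quotient.mk 𝔪).map_one, Ideal.Quotient.eq] at hb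
  refine ⟨b * a, ?_⟩
  set z := IsLocalization.mk' A (Ideal.Quotient.mk I a)
    (⟨Ideal.Quotient.mk I c, hc⟩ : (𝔪.map (Ideal.Quotient.mk I)).primeCompl)
  have hz : algebraMap S A a = z * algebraMap S A c := by
    rw [IsScalarTower.algebraMap_apply S (S ⧸ I) A, IsScalarTower.algebraMap_apply S (S ⧸ I) A]
    exact (IsLocalization.mk'_spec A _ _).symm
  have : algebraMap S A (b * a) - z = z * algebraMap S A (c * b - 1) := by
    rw [map_mul, hz, map_sub, map_mul, map_one]; ring
  rw [this, ← map_algebraMap_eq_maximalIdeal I 𝔪 A]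
  exact Ideal.mul_mem_left _ _ (Ideal.mem_map_of_mem _ hb)

end QuotientLocal

/-! ## The residue field over the local ring of a squarefree monomial ideal -/

section LocalSq

open IsLocalRing MvPolynomial

variable {k : Type u} [Field k] {m : ℕ} {U : Set (Finset (Fin m))}

lemma sqIdeal_le_varIdeal {T : Finset (Fin m)} (h : ∀ σ ∈ U, ∃ i ∈ σ, i ∈ T) :
    sqIdeal k U ≤ varIdeal k T := by
  refine Ideal.span_le.mpr ?_
  rintro _ ⟨σ, hσ, rfl⟩
  obtain ⟨i, hi, hiT⟩ := h σ hσ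
  exact Ideal.mem_of_dvd _ (Finset.dvd_prod_of_mem _ hi) (X_mem_varIdeal_iff.mpr hiT)

lemma prod_X_mem_varIdeal_iff {T σ : Finset (Fin m)} :
    (∏ i ∈ σ, X i : MvPolynomial (Fin m) k) ∈ varIdeal k T ↔ ∃ i ∈ σ, i ∈ T := by
  rw [Ideal.IsPrime.prod_mem_iff]
  simp [X_mem_varIdeal_iff]

lemma varIdeal_mono {T T' : Finset (Fin m)} (h : T ⊆ T') : varIdeal k T ≤ varIdeal k T' :=
  Ideal.span_mono (Set.image_mono h)

variable [h𝔪 : ((varIdeal k (Finset.univ : Finset (Fin m))).map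
    (Ideal.Quotient.mk (sqIdeal k U))).IsPrime]
  {A : Type u} [CommRing A] [Algebra (MvPolynomial (Fin m) k) A]
  [Algebra (MvPolynomial (Fin m) k ⧸ sqIdeal k U) A]
  [IsScalarTower (MvPolynomial (Fin m) k) (MvPolynomial (Fin m) k ⧸ sqIdeal k U) A]
  [IsLocalization.AtPrime A ((varIdeal k (Finset.univ : Finset (Fin m))).map
    (Ideal.Quotient.mk (sqIdeal k U)))]

include h𝔪 in
-- The condition on `U₀` says that the prime generated by its variables contains the monomial ideal;
-- so this prime and all larger ones stay prime in A, and the remaining variables are regular modulo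
-- them.
lemma isRegularFamily_map_varIdeal {U₀ : Finset (Fin m)} (h₀ : ∀ σ ∈ U, ∃ i ∈ σ, i ∈ U₀) :
    IsRegularFamily (fun v ↦ algebraMap (MvPolynomial (Fin m) k) A (X v))
      (fun T ↦ A ⧸ (varIdeal k T).map (algebraMap (MvPolynomial (Fin m) k) A)) U₀ := by
  intro T v hT hv
  have hI : sqIdeal k U ≤ varIdeal k T := (sqIdeal_le_varIdeal h₀).trans (varIdeal_mono hT)
  have hle : varIdeal k T ≤ varIdeal k (Finset.univ : Finset (Fin m)) :=
    varIdeal_mono (Finset.subset_univ T)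
  refine isShortExact_quotient (fun b hb ↦ ?_) ?_
  · refine ((isPrime_map_algebraMap (I := sqIdeal k U) (isPrime_varIdeal T) hI
      hle).mem_or_mem hb).resolve_left ?_
    rw [algebraMap_mem_map_iff (I := sqIdeal k U) (isPrime_varIdeal T) hI hle]
    rwa [X_mem_varIdeal_iff]
  · rw [varIdeal_insert, Ideal.map_sup, Ideal.map_span, Set.image_singleton]

include h𝔪 in
/-- `Ext^n (κ, A) ≠ 0` where `n` is the number of vertices of a facet. -/
lemma not_subsingleton_ext_residueField [IsLocalRing A] [IsNoetherianRing A] {F : Finset (Fin m)}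
    (hU : ∀ σ ∈ U, ∀ τ, σ ⊆ τ → τ ∈ U) (hF : F ∉ U) (hF' : ∀ i ∉ F, insert i F ∈ U) :
    ¬ Subsingleton (ExtM A (ResidueField A) A F.card) := by
  have h₀ : ∀ σ ∈ U, ∃ i ∈ σ, i ∈ Fᶜ := by
    intro σ hσ
    by_contra! h
    exact hF (hU σ hσ F fun i hi ↦ by simpa using h i hi)
  have hx : ∀ v, algebraMap (MvPolynomial (Fin m) k) A (X v) ∈ maximalIdeal A := by
    intro v
    rw [← map_algebraMap_eq_maximalIdeal (sqIdeal k U) (varIdeal k (Finset.univ : Finset (Fin m)))]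
    exact Ideal.mem_map_of_mem _ (X_mem_varIdeal_iff.mpr (Finset.mem_univ v))
  set φ := algebraMap (MvPolynomial (Fin m) k) A with hφ
  have hIφ : ∀ f ∈ sqIdeal k U, φ f = 0 := by
    intro f hf
    rw [hφ, IsScalarTower.algebraMap_apply (MvPolynomial (Fin m) k)
      (MvPolynomial (Fin m) k ⧸ sqIdeal k U) A, Ideal.Quotient.algebraMap_eq,
      Ideal.Quotient.eq_zero_iff_mem.mpr hf, map_zero]
  -- Multiplication by the monomial of the facet F is a homomorphism from this quotient to A,
  -- because every variable outside F turns the monomial into a nonface. It is nonzero, as the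
  -- monomial does not lie in the prime.
  have h0 : ¬ Subsingleton (ExtM A (A ⧸ (varIdeal k Fᶜ).map φ) A 0) := by
    intro hs
    have hs' := (extZeroEquiv (R := A) (A ⧸ (varIdeal k Fᶜ).map φ) A).symm.subsingleton
    have hle : (varIdeal k Fᶜ).map φ ≤ LinearMap.ker (LinearMap.toSpanSingleton A A
        (φ (∏ i ∈ F, X i))) := by
      rw [Ideal.map_le_iff_le_comap, varIdeal, Ideal.span_le]
      rintro _ ⟨i, hi, rfl⟩
      have hi' : i ∉ F := by simpa using hi
      change φ (X i) * φ (∏ i ∈ F, X i) = 0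
      rw [← map_mul, ← Finset.prod_insert hi']
      exact hIφ _ (Ideal.subset_span ⟨_, hF' i hi', rfl⟩)
    have h1 : Submodule.liftQ ((varIdeal k Fᶜ).map φ) _ hle (Submodule.Quotient.mk 1) = 0 := by
      rw [hs'.elim (Submodule.liftQ ((varIdeal k Fᶜ).map φ) _ hle) 0, LinearMap.zero_apply]
    rw [Submodule.liftQ_apply, LinearMap.toSpanSingleton_apply, one_smul] at h1
    have h2 : φ (∏ i ∈ F, X i) ∈ (varIdeal k Fᶜ).map φ := h1 ▸ Ideal.zero_mem _
    rw [algebraMap_mem_map_iff (I := sqIdeal k U) (isPrime_varIdeal _) (sqIdeal_le_varIdeal h₀)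
      (varIdeal_mono (Finset.subset_univ _)), prod_X_mem_varIdeal_iff] at h2
    obtain ⟨i, hi, hi'⟩ := h2
    exact Finset.mem_compl.mp hi' hi
  -- Adjoining the variables of F to the prime one by one reaches the maximal ideal and raises the
  -- degree by `F.card`.
  have h3 := (isRegularFamily_map_varIdeal (A := A) h₀).not_subsingleton_ext_left hx
    (T := F) disjoint_compl_right h0
  have h4 : (varIdeal k (F ∪ Fᶜ)).map φ = maximalIdeal A := by
    rw [Finset.union_compl]
    exact map_algebraMap_eq_maximalIdeal (sqIdeal k U) _ A
  intro hs
  have hs' : Subsingleton (ExtM A (A ⧸ maximalIdeal A) A F.card) := hs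
  exact h3 (extPreEquiv (Submodule.quotEquivOfEq _ _ h4) A F.card).symm.subsingleton

end LocalSq

/-! ## The first nonvanishing `Ext` of the residue field -/

section Corner

open IsLocalRing

variable {S : Type u} [CommRing S] {A : Type u} [CommRing A] [Algebra S A]
  {r : ℕ → ℕ} {d : ∀ i, Matrix (Fin (r i)) (Fin (r (i + 1))) S}

lemma coMap_eq_vecMul {ι κ : Type*} [Fintype ι] (M : Matrix ι κ S) (w : ι → A) :
    coMap M A w = (M.map (algebraMap S A)).vecMulLinear w := by
  ext b
  simp [coMap_apply, Matrix.vecMul, dotProduct, Algebra.smul_def, mul_comm]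

lemma entryIdeal_map {B : Type*} [CommRing B] {ι κ : Type*} (φ : S →+* B) (M : Matrix ι κ S) :
    entryIdeal (M.map φ) = (entryIdeal M).map φ := by
  rw [entryIdeal, entryIdeal, Ideal.map_span]
  congr 1
  ext x
  simp

variable [IsLocalRing A] [IsNoetherianRing A] {𝔪 : Ideal S}

/-- If `Ext^t (κ, A)` is the last nonzero one, then it is also the first nonzero one,
and it is simple. -/
theorem IsResolution.ext_residueField (h : IsResolution d 𝔪)
    (h𝔪A : 𝔪.map (algebraMap S A) = maximalIdeal A)
    (hsurj : ∀ x : A, ∃ s : S, algebraMap S A s - x ∈ maximalIdeal A)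
    {m : ℕ} (hm : ∀ j, m < j → r j = 0) {t : ℕ} (ht1 : 1 ≤ t)
    (ht0 : ¬ Subsingleton (ExtM A (ResidueField A) A t))
    (ht : ∀ q, t < q → Subsingleton (ExtM A (ResidueField A) A q)) :
    (∀ j < t, Subsingleton (ExtM S (S ⧸ 𝔪) A j)) ∧ ¬ Subsingleton (ExtM S (S ⧸ 𝔪) A t) ∧
      ∀ u v : ExtM S (S ⧸ 𝔪) A t, u ≠ 0 → ∃ a : S, a • u = v := by
  -- The complex of row vectors over A computes `Ext` over S of `S ⧸ 𝔪` into A. It need not be the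
  -- dual of a resolution over A, but its cohomology is killed by 𝔪.
  let D : ∀ i, Matrix (Fin (r i)) (Fin (r (i + 1))) A := fun i ↦ (d i).map (algebraMap S A)
  have hD : ∀ i, D i * D (i + 1) = 0 := by
    intro i
    change (d i).map (algebraMap S A) * (d (i + 1)).map (algebraMap S A) = 0
    rw [← Matrix.map_mul, h.mul_eq_zero, Matrix.map_zero _ (map_zero _)]
  have hI : entryIdeal (D 0) = maximalIdeal A := by
    rw [entryIdeal_map, h.entryIdeal_eq, h𝔪A]
  have hkill0 : ∀ s ∈ 𝔪, ∀ w : Fin (r 0) → A, (D 0).vecMulLinear w = 0 →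
      algebraMap S A s • w = 0 := by
    intro s hs w hw
    have hu : ∀ a b : Fin (r 0), a = b := by
      rw [h.rank_zero]; exact fun a b ↦ Subsingleton.elim a b
    rw [← h.entryIdeal_eq] at hs
    induction hs using Submodule.span_induction with
    | mem x hx =>
      obtain ⟨a, b, rfl⟩ := hx
      ext c
      have := congrFun hw b
      change ∑ a, w a * D 0 a b = 0 at this
      rw [Finset.sum_eq_single_of_mem a (Finset.mem_univ a)
        fun a' _ ha' ↦ (ha' (hu _ _)).elim] at this
      rw [hu c a, Pi.smul_apply, smul_eq_mul, mul_comm]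
      exact this
    | zero => rw [map_zero, zero_smul]
    | add x y _ _ hx hy => rw [map_add, add_smul, hx, hy, add_zero]
    | smul c x _ hx => rw [smul_eq_mul, map_mul, mul_smul, hx, smul_zero]
  have hkill : ∀ j, ∀ a ∈ maximalIdeal A, ∀ x : cohom hD j, a • x = 0 := by
    intro j a ha x
    obtain ⟨x, hx⟩ := x
    obtain ⟨w, rfl⟩ := Submodule.Quotient.mk_surjective _ x
    rw [LinearMap.mem_ker, cokerMap_mk_eq_zero, LinearMap.mem_ker] at hx
    suffices hw : a • w ∈ coboundary D j by
      refine Subtype.ext ?_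
      change a • (Submodule.Quotient.mk w : Coker D j) = 0
      rwa [← Submodule.Quotient.mk_smul, Submodule.Quotient.mk_eq_zero]
    rw [← h𝔪A] at ha
    induction ha using Submodule.span_induction with
    | mem y hy =>
      obtain ⟨s, hs, rfl⟩ := hy
      rcases j with _ | j
      · rw [hkill0 s hs w hx]
        exact Submodule.zero_mem _
      · obtain ⟨u, hu⟩ := h.smul_mem_range A j hs (w := w) (by rw [coMap_eq_vecMul]; exact hx)
        rw [coMap_eq_vecMul] at hu
        rw [algebraMap_smul, ← hu]
        exact vecMul_mem_coboundary j u
    | zero => rw [zero_smul]; exact Submodule.zero_mem _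
    | add x y _ _ hx hy => rw [add_smul]; exact Submodule.add_mem _ hx hy
    | smul c x _ hx => rw [smul_eq_mul, mul_smul]; exact Submodule.smul_mem _ _ hx
  obtain ⟨hex, ⟨e⟩⟩ := exact_and_cohom_equiv_residueField hD h.rank_zero hI hm hkill ht1 ht0 ht
  refine ⟨fun j hj ↦ ?_, ?_⟩
  · rcases j with _ | j
    · suffices hs : Subsingleton ((S ⧸ 𝔪) →ₗ[S] A) from (extZeroEquiv (S ⧸ 𝔪) A).subsingleton
      refine ⟨fun f g ↦ ?_⟩
      suffices hz : ∀ f : (S ⧸ 𝔪) →ₗ[S] A, f = 0 by rw [hz f, hz g]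
      intro f
      have h1 : (fun _ ↦ f (Submodule.Quotient.mk 1) : Fin (r 0) → A) ∈
          LinearMap.ker (D 0).vecMulLinear := by
        rw [LinearMap.mem_ker]
        change (D 0).vecMulLinear _ = 0
        rw [← coMap_eq_vecMul]
        ext b
        rw [coMap_apply]
        refine Finset.sum_eq_zero fun a _ ↦ ?_
        rw [← map_smul, ← Submodule.Quotient.mk_smul, smul_eq_mul, mul_one,
          (Submodule.Quotient.mk_eq_zero 𝔪).mpr, map_zero]
        rw [← h.entryIdeal_eq]
        exact Ideal.subset_span ⟨a, b, rfl⟩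
      have h2 := (Submodule.mem_bot A).mp (hex 0 hj h1)
      have h3 := congrFun h2 ⟨0, by rw [h.rank_zero]; exact one_pos⟩
      refine LinearMap.ext fun y ↦ ?_
      obtain ⟨y, rfl⟩ := Submodule.Quotient.mk_surjective _ y
      rw [← mul_one y, ← smul_eq_mul, Submodule.Quotient.mk_smul, map_smul]
      simp only [LinearMap.zero_apply]
      rw [show f (Submodule.Quotient.mk 1) = 0 from h3, smul_zero]
    · obtain ⟨f, hf, hf0⟩ := h.exists_cocycles_to_ext A j
      refine subsingleton_of_forall_eq 0 fun z ↦ ?_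
      obtain ⟨w, rfl⟩ := hf z
      obtain ⟨u, hu⟩ := hex (j + 1) hj (x := w.1) (by
        have := w.2
        rw [LinearMap.mem_ker, coMap_eq_vecMul] at this
        exact this)
      exact (hf0 w).mpr ⟨u, by rw [coMap_eq_vecMul]; exact hu⟩
  · obtain ⟨t, rfl⟩ := Nat.exists_eq_add_of_le' ht1
    obtain ⟨f, hf, hf0⟩ := h.exists_cocycles_to_ext A t
    let cl : LinearMap.ker (coMap (d (t + 1)) A) → cohom hD (t + 1) := fun w ↦
      ⟨Submodule.Quotient.mk w.1, by
        rw [LinearMap.mem_ker, cokerMap_mk_eq_zero]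
        have := w.2
        rw [LinearMap.mem_ker, coMap_eq_vecMul] at this
        exact this⟩
    have hcl0 : ∀ w, cl w = 0 ↔ f w = 0 := by
      intro w
      rw [hf0, Subtype.ext_iff]
      change (Submodule.Quotient.mk w.1 : Coker D (t + 1)) = 0 ↔ _
      rw [Submodule.Quotient.mk_eq_zero]
      refine exists_congr fun u ↦ ?_
      rw [coMap_eq_vecMul]
    have hcl : Function.Surjective cl := by
      rintro ⟨x, hx⟩
      obtain ⟨w, rfl⟩ := Submodule.Quotient.mk_surjective _ x
      rw [LinearMap.mem_ker, cokerMap_mk_eq_zero, LinearMap.mem_ker] at hx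
      exact ⟨⟨w, by rw [LinearMap.mem_ker, coMap_eq_vecMul]; exact hx⟩, rfl⟩
    constructor
    · intro hs
      obtain ⟨w, hw⟩ := hcl (e.symm 1)
      have := (hcl0 w).mpr (Subsingleton.elim _ _)
      rw [hw, LinearEquiv.map_eq_zero_iff] at this
      exact one_ne_zero this
    · intro u v hu
      obtain ⟨w, rfl⟩ := hf u
      obtain ⟨w', rfl⟩ := hf v
      have hw : e (cl w) ≠ 0 := by
        rwa [ne_eq, LinearEquiv.map_eq_zero_iff, hcl0]
      -- The ratio of the two classes in the residue field lifts to A, and then to S up to the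
      -- maximal ideal.
      obtain ⟨x, hx⟩ := residue_surjective (e (cl w') / e (cl w))
      obtain ⟨s, hs⟩ := hsurj x
      have hs' : residue A (algebraMap S A s) = residue A x := by
        rw [← sub_eq_zero, ← map_sub, residue_eq_zero_iff]; exact hs
      refine ⟨s, ?_⟩
      rw [← map_smul, ← sub_eq_zero, ← map_sub, ← hcl0]
      have h5 : cl (s • w - w') = algebraMap S A s • cl w - cl w' := by
        refine Subtype.ext ?_
        change (Submodule.Quotient.mk (s • w.1 - w'.1) : Coker D (t + 1)) =
          algebraMap S A s • Submodule.Quotient.mk w.1 - Submodule.Quotient.mk w'.1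
        rw [← Submodule.Quotient.mk_smul, algebraMap_smul, ← Submodule.Quotient.mk_sub]
      rw [h5, ← LinearEquiv.map_eq_zero_iff e, map_sub, map_smul, sub_eq_zero]
      rw [Algebra.smul_def, ResidueField.algebraMap_eq, hs', hx, div_mul_cancel₀ _ hw]

end Corner

/-! ## Vanishing of `Ext` below the codimension -/

section Filtration

variable {S : Type u} [CommRing S]

/-- The submodule generated by the product over s is killed by `P i`, and the quotient by it is
killed by the product over s; the long exact sequence joins the two. -/
lemma subsingleton_ext_of_prod_ideal_smul {ι : Type*} (P : ι → Ideal S) (N : Type u)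
    [AddCommGroup N] [Module S N] (j : ℕ) (s : Finset ι)
    (hP : ∀ i ∈ s, ∀ (M : Type u) [AddCommGroup M] [Module S M],
      (∀ a ∈ P i, ∀ x : M, a • x = 0) → Subsingleton (ExtM S M N j)) :
    ∀ (M : Type u) [AddCommGroup M] [Module S M],
      (∀ a ∈ ∏ i ∈ s, P i, ∀ x : M, a • x = 0) → Subsingleton (ExtM S M N j) := by
  classical
  induction s using Finset.induction_on with
  | empty =>
    intro M _ _ hM
    have : Subsingleton M := subsingleton_of_forall_eq 0 fun x ↦ by
      rw [← one_smul S x]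
      exact hM 1 (by simp) x
    exact subsingleton_ext_of_subsingleton M N j
  | insert i s hi ih =>
    intro M _ _ hM
    rw [Finset.prod_insert hi] at hM
    let M' : Submodule S M := (∏ i ∈ s, P i) • ⊤
    have h1 : Subsingleton (ExtM S M' N j) := by
      refine hP i (Finset.mem_insert_self i s) M' fun a ha x ↦ Subtype.ext ?_
      obtain ⟨x, hx⟩ := x
      change a • x = 0
      refine Submodule.smul_induction_on (p := fun x ↦ a • x = 0) hx (fun b hb y _ ↦ ?_)
        fun y z hy hz ↦ ?_
      · rw [← mul_smul]
        exact hM _ (Ideal.mul_mem_mul ha hb) y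
      · rw [smul_add, hy, hz, add_zero]
    have h2 : Subsingleton (ExtM S (M ⧸ M') N j) := by
      refine ih (fun i hi ↦ hP i (Finset.mem_insert_of_mem hi)) (M ⧸ M') fun a ha x ↦ ?_
      obtain ⟨x, rfl⟩ := Submodule.Quotient.mk_surjective _ x
      rw [← Submodule.Quotient.mk_smul, Submodule.Quotient.mk_eq_zero]
      exact Submodule.smul_mem_smul ha Submodule.mem_top
    have hs : IsShortExact M'.subtype M'.mkQ :=
      ⟨Subtype.val_injective, LinearMap.exact_subtype_mkQ _, Submodule.mkQ_surjective _⟩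
    exact hs.subsingleton_ext_mid (N := N) j

end Filtration

/-! ## Faces and nonfaces -/

section Faces

variable {m : ℕ} (K : AbstractSimplicialComplex (Fin m))

/-- The nonfaces of a simplicial complex. -/
def nonfaces : Set (Finset (Fin m)) := {σ | ¬ IsFace K σ}

variable {K}

lemma stanleyReisnerIdeal_eq (k : Type*) [Field k] :
    stanleyReisnerIdeal k K = sqIdeal k (nonfaces K) := rfl

lemma IsFace.mono {σ τ : Finset (Fin m)} (h : IsFace K τ) (hσ : σ ⊆ τ) : IsFace K σ := by
  rcases σ.eq_empty_or_nonempty with rfl | hne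
  · exact Or.inl rfl
  · rcases h with rfl | h
    · exact Or.inl (Finset.subset_empty.mp hσ)
    · exact Or.inr (K.isRelLowerSet_faces.mem_of_le h hσ hne)

lemma nonfaces_upward : ∀ σ ∈ nonfaces K, ∀ τ, σ ⊆ τ → τ ∈ nonfaces K :=
  fun _ hσ _ h hτ ↦ hσ (hτ.mono h)

lemma empty_notMem_nonfaces : ∅ ∉ nonfaces K := fun h ↦ h (Or.inl rfl)

lemma isFace_singleton (v : Fin m) : IsFace K {v} := Or.inr (K.singleton_mem v)

lemma IsFace.card_le {σ : Finset (Fin m)} (h : IsFace K σ) : σ.card ≤ maxFaceCard K := by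
  classical
  exact Finset.le_sup (f := Finset.card) (by simpa using h)

variable (K) in
lemma exists_isFace_card_eq : ∃ F, IsFace K F ∧ F.card = maxFaceCard K := by
  classical
  obtain ⟨F, hF, h⟩ := Finset.exists_mem_eq_sup
    (Finset.univ.filter fun σ : Finset (Fin m) => IsFace K σ) ⟨∅, Finset.mem_filter.mpr ⟨Finset.mem_univ _, Or.inl rfl⟩⟩ Finset.card
  exact ⟨F, by simpa using hF, h.symm⟩

open MvPolynomial in
-- Pick a vertex outside each face. The set of picked vertices cannot be a face, since it would have
-- to miss the vertex picked for itself; so each product of generators is divisible by the monomial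
-- of a nonface.
lemma prod_varIdeal_le (k : Type u) [Field k] [DecidablePred (IsFace K)] :
    ∏ F ∈ Finset.univ.filter (IsFace K), varIdeal k Fᶜ ≤ sqIdeal k (nonfaces K) := by
  simp only [varIdeal]
  rw [Ideal.prod_span, Ideal.span_le]
  intro x hx
  obtain ⟨g, hg, rfl⟩ := (Set.mem_finsetProd _ _ _).mp hx
  obtain ⟨v₀, -⟩ := hg (i := ∅) (Finset.mem_filter.mpr ⟨Finset.mem_univ _, Or.inl rfl⟩)
  have : Nonempty (Fin m) := ⟨v₀⟩
  choose! v hv hv' using fun F hF ↦ hg (i := F) hF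
  have hnf : (Finset.univ.filter (IsFace K)).image v ∈ nonfaces K := by
    intro hf
    have h1 := hv _ (Finset.mem_filter.mpr ⟨Finset.mem_univ _, hf⟩)
    rw [Finset.mem_coe, Finset.mem_compl] at h1
    exact h1 (Finset.mem_image_of_mem v (Finset.mem_filter.mpr ⟨Finset.mem_univ _, hf⟩))
  rw [← Finset.prod_congr rfl fun F hF ↦ hv' F hF, Finset.prod_comp X v]
  refine Ideal.mem_of_dvd _ (Finset.prod_dvd_prod_of_dvd _ _ fun i hi ↦ dvd_pow_self _ ?_)
    (Ideal.subset_span ⟨_, hnf, rfl⟩)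
  obtain ⟨F, hF, rfl⟩ := Finset.mem_image.mp hi
  exact Finset.card_ne_zero.mpr ⟨F, by simpa using hF⟩

variable (K) in
/-- `Ext^j (k[K], S) = 0` for `j` less than the codimension. -/
lemma subsingleton_ext_stanleyReisner (k : Type u) [Field k] (j : ℕ) (hj : j + maxFaceCard K < m) :
    Subsingleton (ExtM (MvPolynomial (Fin m) k)
      (MvPolynomial (Fin m) k ⧸ sqIdeal k (nonfaces K)) (MvPolynomial (Fin m) k) j) := by
  classical
  refine subsingleton_ext_of_prod_ideal_smul (fun F ↦ varIdeal k Fᶜ) _ j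
    (Finset.univ.filter (IsFace K)) (fun F hF M _ _ hM ↦ ?_) _ fun a ha x ↦ ?_
  · refine subsingleton_ext_of_X_smul (T := Fᶜ)
      (fun v hv y ↦ hM _ (X_mem_varIdeal_iff.mpr hv) y) j ?_
    have := IsFace.card_le (Finset.mem_filter.mp hF).2
    rw [Finset.card_compl, Fintype.card_fin]
    omega
  · obtain ⟨x, rfl⟩ := Ideal.Quotient.mk_surjective x
    exact Ideal.Quotient.eq_zero_iff_mem.mpr (Ideal.mul_mem_right _ _ (prod_varIdeal_le k ha))

end Faces

/-! ## Resolutions of Gorenstein Stanley–Reisner rings -/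

section Gorenstein

open MvPolynomial IsLocalRing

variable {k : Type u} [Field k] {m : ℕ} {K : AbstractSimplicialComplex (Fin m)}

/-- The simple module is killed by polynomials without constant term. -/
lemma smul_quot_univ {a : MvPolynomial (Fin m) k} (ha : constantCoeff a = 0)
    (y : MvPolynomial (Fin m) k ⧸ varIdeal k (Finset.univ : Finset (Fin m))) : a • y = 0 := by
  obtain ⟨y, rfl⟩ := Ideal.Quotient.mk_surjective y
  exact Ideal.Quotient.eq_zero_iff_mem.mpr
    (Ideal.mul_mem_right _ _ (mem_varIdeal_univ.mpr ha))

variable (k m) in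
-- The squarefree construction applied to all nonempty sets of vertices plays the role of the Koszul
-- complex.
lemma exists_isResolution_varIdeal : ∃ (r : ℕ → ℕ)
    (d : ∀ i, Matrix (Fin (r i)) (Fin (r (i + 1))) (MvPolynomial (Fin m) k)),
    IsResolution d (varIdeal k (Finset.univ : Finset (Fin m))) ∧ ∀ j, m < j → r j = 0 := by
  obtain ⟨L⟩ := nonempty_sqResolution k (U := {σ : Finset (Fin m) | σ.Nonempty})
    (fun σ hσ τ h ↦ Finset.Nonempty.mono h hσ) Finset.not_nonempty_empty
  refine ⟨L.rank, L.d, ?_, L.rank_eq_zero⟩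
  have : sqIdeal k {σ : Finset (Fin m) | σ.Nonempty} =
      varIdeal k (Finset.univ : Finset (Fin m)) := by
    apply le_antisymm
    · exact sqIdeal_le_varIdeal fun σ ⟨i, hi⟩ ↦ ⟨i, hi, Finset.mem_univ i⟩
    · refine Ideal.span_mono ?_
      rintro _ ⟨i, -, rfl⟩
      exact ⟨{i}, Finset.singleton_nonempty i, by simp⟩
  exact this ▸ L.isResolution

/-- `Ext^j (κ, k[K]_𝔪)` vanishes below some degree which is at least the Krull dimension, and it is
simple in that degree. -/
lemma exists_ext_quot_univ (hK : IsGorensteinRing (MvPolynomial (Fin m) k ⧸ sqIdeal k (nonfaces K)))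
    (hm : 0 < m) : ∃ t, maxFaceCard K ≤ t ∧
    (∀ j < t, Subsingleton (ExtM (MvPolynomial (Fin m) k)
      (MvPolynomial (Fin m) k ⧸ varIdeal k (Finset.univ : Finset (Fin m)))
      (LocalizedModule (varIdeal k (Finset.univ : Finset (Fin m))).primeCompl
        (MvPolynomial (Fin m) k ⧸ sqIdeal k (nonfaces K))) j)) ∧
    ¬ Subsingleton (ExtM (MvPolynomial (Fin m) k)
      (MvPolynomial (Fin m) k ⧸ varIdeal k (Finset.univ : Finset (Fin m)))
      (LocalizedModule (varIdeal k (Finset.univ : Finset (Fin m))).primeCompl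
        (MvPolynomial (Fin m) k ⧸ sqIdeal k (nonfaces K))) t) ∧
    ∀ u v : ExtM (MvPolynomial (Fin m) k)
      (MvPolynomial (Fin m) k ⧸ varIdeal k (Finset.univ : Finset (Fin m)))
      (LocalizedModule (varIdeal k (Finset.univ : Finset (Fin m))).primeCompl
        (MvPolynomial (Fin m) k ⧸ sqIdeal k (nonfaces K))) t,
      u ≠ 0 → ∃ a : MvPolynomial (Fin m) k, a • u = v := by
  have hIM : (sqIdeal k (nonfaces K)) ≤ (varIdeal k Finset.univ) := sqIdeal_le_varIdeal fun σ hσ ↦ by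
    obtain ⟨i, hi⟩ := Finset.nonempty_iff_ne_empty.mpr
      fun h : σ = ∅ ↦ empty_notMem_nonfaces (h ▸ hσ)
    exact ⟨i, hi, Finset.mem_univ i⟩
  have hprime : ((varIdeal k Finset.univ).map (Ideal.Quotient.mk (sqIdeal k (nonfaces K)))).IsPrime :=
    
    Ideal.map_isPrime_of_surjective Ideal.Quotient.mk_surjective (by rwa [Ideal.mk_ker])
  obtain ⟨hN, hinj⟩ := hK
  obtain ⟨N, hN'⟩ := hinj ((varIdeal k Finset.univ).map (Ideal.Quotient.mk (sqIdeal k (nonfaces K))))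
  let A := Localization.AtPrime ((varIdeal k Finset.univ).map (Ideal.Quotient.mk (sqIdeal k (nonfaces K))))
  have hAN : IsNoetherianRing A :=
    IsLocalization.isNoetherianRing ((varIdeal k Finset.univ).map (Ideal.Quotient.mk (sqIdeal k (nonfaces K)))).primeCompl A hN
  obtain ⟨F, hF, hFc⟩ := exists_isFace_card_eq K
  have hn : ¬ Subsingleton (ExtM A (ResidueField A) A (maxFaceCard K)) := by
    rw [← hFc]
    refine not_subsingleton_ext_residueField (k := k) (U := nonfaces K) nonfaces_upward
      (fun h ↦ h hF) fun i hi h ↦ ?_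
    have := h.card_le
    rw [Finset.card_insert_of_notMem hi] at this
    omega
  have hvan : ∀ j, N < j → Subsingleton (ExtM A (ResidueField A) A j) := fun j hj ↦
    HasInjectiveDimensionLT.subsingleton (ModuleCat.of A A) (N + 1) j hj _
  classical
  -- Finite injective dimension bounds the degrees with nonzero `Ext`, so a last one exists; the
  -- facet shows that it is at least `maxFaceCard K`.
  let P := fun j ↦ ¬ Subsingleton (ExtM A (ResidueField A) A j)
  have hb : maxFaceCard K ≤ N := not_lt.mp fun h ↦ hn (hvan _ h)
  have hle : maxFaceCard K ≤ Nat.findGreatest P N := Nat.le_findGreatest hb hn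
  have h1n : 1 ≤ maxFaceCard K := by
    have := (isFace_singleton (K := K) ⟨0, hm⟩).card_le
    rwa [Finset.card_singleton] at this
  obtain ⟨r, d, hres, hr⟩ := exists_isResolution_varIdeal k m
  have key := hres.ext_residueField (A := A) (map_algebraMap_eq_maximalIdeal (sqIdeal k (nonfaces K)) (varIdeal k Finset.univ) A)
    (exists_algebraMap_sub_mem (I := (sqIdeal k (nonfaces K))) (𝔪 := (varIdeal k Finset.univ))) hr (t := Nat.findGreatest P N)
    (h1n.trans hle) (Nat.findGreatest_spec (P := P) hb hn) (fun j hj ↦ by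
      by_cases hjN : j ≤ N
      · exact not_not.mp (Nat.findGreatest_is_greatest hj hjN)
      · exact hvan j (not_le.mp hjN))
  obtain ⟨e⟩ := nonempty_localizedModule_equiv (𝔪 := (varIdeal k Finset.univ)) A hIM
  have E := fun j ↦ extPostEquiv (R := MvPolynomial (Fin m) k) (M' := A)
    (N := LocalizedModule (varIdeal k Finset.univ).primeCompl
      (MvPolynomial (Fin m) k ⧸ sqIdeal k (nonfaces K)))
    (MvPolynomial (Fin m) k ⧸ varIdeal k (Finset.univ : Finset (Fin m))) e j
  refine ⟨Nat.findGreatest P N, hle, fun j hj ↦ ?_, fun h ↦ key.2.1 ?_, fun u v hu ↦ ?_⟩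
  · have := key.1 j hj
    exact (E j).subsingleton
  · exact (E _).symm.subsingleton
  · obtain ⟨a, ha⟩ := key.2.2 (E _ u) (E _ v) (by
      rwa [ne_eq, LinearEquiv.map_eq_zero_iff])
    exact ⟨a, (E _).injective (by rw [map_smul, ha])⟩

variable {r : ℕ → ℕ} {d : ∀ i, Matrix (Fin (r i)) (Fin (r (i + 1))) (MvPolynomial (Fin m) k)}

/-- The length of a minimal resolution is at most the number of variables. -/
lemma IsResolution.rank_eq_zero_of_lt {U : Set (Finset (Fin m))}
    (hU : ∀ σ ∈ U, ∀ τ, σ ⊆ τ → τ ∈ U) (h0 : ∅ ∉ U) (h : IsResolution d (sqIdeal k U))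
    (hmin : ∀ i a b, constantCoeff (d i a b) = 0) (j : ℕ) (hj : m < j) : r j = 0 := by
  obtain ⟨G⟩ := nonempty_sqResolution k hU h0
  obtain ⟨j, rfl⟩ := Nat.exists_eq_add_of_le' (Nat.one_le_of_lt hj)
  have : Nontrivial (MvPolynomial (Fin m) k ⧸ varIdeal k (Finset.univ : Finset (Fin m))) :=
    Ideal.Quotient.nontrivial_iff.mpr (isPrime_varIdeal _).ne_top
  exact h.rank_eq_zero_of_subsingleton
    (MvPolynomial (Fin m) k ⧸ varIdeal k (Finset.univ : Finset (Fin m)))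
    (fun i a b x ↦ smul_quot_univ (hmin i a b) x) j
    (G.isResolution.subsingleton_ext_of_rank_eq_zero _ j (G.rank_eq_zero _ hj))

lemma subsingleton_ext_of_pi {S : Type u} [CommRing S] {κ N : Type u} [AddCommGroup κ] [Module S κ]
    [AddCommGroup N] [Module S N] {n b : ℕ} (hb : b ≠ 0)
    (h : Subsingleton (ExtM S κ (Fin b → N) n)) : Subsingleton (ExtM S κ N n) := by
  refine subsingleton_of_forall_eq 0 fun x ↦ ?_
  let i : Fin b := ⟨0, Nat.pos_of_ne_zero hb⟩
  have h1 : extPost κ (LinearMap.proj i : (Fin b → N) →ₗ[S] N) n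
      (extPost κ (LinearMap.single S (fun _ ↦ N) i) n x) = x := by
    rw [← extPost_comp, show (LinearMap.proj i : (Fin b → N) →ₗ[S] N) ∘ₗ
      LinearMap.single S (fun _ ↦ N) i = LinearMap.id from by ext; simp, extPost_id]
  rw [← h1, Subsingleton.elim (extPost κ (LinearMap.single S (fun _ ↦ N) i) n x) 0, map_zero]

/-- The minimal resolution of a Gorenstein Stanley–Reisner ring has length `m - n`, its last module
is free of rank one, and its dual is exact except in the last spot. -/
theorem IsResolution.gorenstein
    (hK : IsGorensteinRing (MvPolynomial (Fin m) k ⧸ sqIdeal k (nonfaces K)))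
    (hm : 0 < m) (h : IsResolution d (sqIdeal k (nonfaces K)))
    (hmin : ∀ i a b, constantCoeff (d i a b) = 0) (hI0 : sqIdeal k (nonfaces K) ≠ ⊥) :
    ∃ Q, Q + 1 + maxFaceCard K = m ∧ r (Q + 1) = 1 ∧ (∀ j, Q + 1 < j → r j = 0) ∧
      ∀ j < Q + 1, LinearMap.ker (d j).vecMulLinear ≤ coboundary d j := by
  classical
  have hrm := h.rank_eq_zero_of_lt nonfaces_upward empty_notMem_nonfaces hmin
  have hne : ∃ a b, d 0 a b ≠ 0 := by
    by_contra! hc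
    apply hI0
    rw [← h.entryIdeal_eq, entryIdeal, Ideal.span_eq_bot]
    rintro _ ⟨a, b, rfl⟩
    exact hc a b
  have hr1 : r 1 ≠ 0 := by
    obtain ⟨a, b, -⟩ := hne
    exact (Fin.pos b).ne'
  have hq1 : 1 ≤ Nat.findGreatest (fun j ↦ r j ≠ 0) m := Nat.le_findGreatest hm hr1
  have hq2 : r (Nat.findGreatest (fun j ↦ r j ≠ 0) m) ≠ 0 :=
    Nat.findGreatest_spec (P := fun j ↦ r j ≠ 0) hm hr1
  have hq3 : ∀ j, Nat.findGreatest (fun j ↦ r j ≠ 0) m < j → r j = 0 := by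
    intro j hj
    by_cases hjm : j ≤ m
    · exact not_not.mp (Nat.findGreatest_is_greatest hj hjm)
    · exact hrm j (not_le.mp hjm)
  have hqm : Nat.findGreatest (fun j ↦ r j ≠ 0) m ≤ m := Nat.findGreatest_le m
  generalize Nat.findGreatest (fun j ↦ r j ≠ 0) m = q at hq1 hq2 hq3 hqm
  obtain ⟨Q, rfl⟩ := Nat.exists_eq_add_of_le' hq1
  have hdm : ∀ i a b, d i a b ∈ (varIdeal k Finset.univ) := fun i a b ↦ mem_varIdeal_univ.mpr (hmin i a b)
  obtain ⟨t, hnt, ht1, ht2, ht3⟩ := exists_ext_quot_univ hK hm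
  obtain ⟨hloc1, hloc2⟩ := h.ext_localized (varIdeal k Finset.univ).primeCompl (κ := MvPolynomial (Fin m) k ⧸ (varIdeal k Finset.univ))
    (fun a ha x ↦ smul_quot_univ (mem_varIdeal_univ.mp ha) x) hdm
    (hq3 (Q + 2) (by omega)) (subsingleton_ext_loc (varIdeal k Finset.univ).primeCompl)
  obtain ⟨j, hj⟩ := Nat.exists_eq_add_of_le' hqm
  obtain ⟨E⟩ := hloc2 j (by omega)
  -- Both t and m minus the length of the resolution are the first degree with nonzero `Ext` from
  -- the simple module: the Auslander–Buchsbaum formula.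
  have hjt : t = j := by
    rcases lt_trichotomy t j with hlt | heq | hgt
    · exact absurd (hloc1 t (by omega)) ht2
    · exact heq
    · exfalso
      have := ht1 j hgt
      exact not_subsingleton_ext_loc (subsingleton_ext_of_pi hq2 E.symm.subsingleton)
  subst hjt
  have hns := not_subsingleton_ext_loc (k := k) (m := m)
  -- The `Ext` of the localized quotient in degree t is simple, and it is the m-th `Ext` into the
  -- last free module.
  have hrank : r (Q + 1) = 1 := by
    refine eq_one_of_ext_pi_simple (b := r (Q + 1)) hns (fun hs ↦ ?_) fun u v hu ↦ ?_
    · exact ht2 E.subsingleton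
    · obtain ⟨a, ha⟩ := ht3 (E.symm u) (E.symm v) (by rwa [ne_eq, LinearEquiv.map_eq_zero_iff])
      exact ⟨a, E.symm.injective (by rw [map_smul, ha])⟩
  -- The bound on t makes the length at most m - n. A shorter resolution would have its nonzero last
  -- `Ext` into S below the codimension, where `Ext` vanishes.
  have hQ : Q + 1 + maxFaceCard K = m := by
    by_contra hc
    exact h.not_subsingleton_ext Q (isPrime_varIdeal _).ne_top (hdm Q) hq2
      (hq3 (Q + 2) (by omega)) (subsingleton_ext_stanleyReisner K k (Q + 1) (by omega))
  refine ⟨Q, hQ, hrank, hq3, fun j hj ↦ ?_⟩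
  rcases j with _ | j
  · intro w hw
    obtain ⟨a, b, hab⟩ := hne
    have hu : ∀ a b : Fin (r 0), a = b := by
      rw [h.rank_zero]; exact fun a b ↦ Subsingleton.elim a b
    have h1 : ∑ a, w a * d 0 a b = 0 := congrFun hw b
    rw [Finset.sum_eq_single_of_mem a (Finset.mem_univ a)
      fun a' _ ha' ↦ (ha' (hu _ _)).elim] at h1
    refine (Submodule.mem_bot _).mpr (funext fun c ↦ ?_)
    rw [hu c a]
    exact (_root_.mul_eq_zero.mp h1).resolve_right hab
  · exact h.ker_le_coboundary j (subsingleton_ext_stanleyReisner K k (j + 1) (by omega))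

/-- Duality: the entries of the last matrix generate the ideal. -/
theorem IsResolution.entryIdeal_last {S : Type u} [CommRing S] {I : Ideal S} {r : ℕ → ℕ}
    {d : ∀ i, Matrix (Fin (r i)) (Fin (r (i + 1))) S} (h : IsResolution d I) {Q : ℕ}
    (hr : r (Q + 1) = 1) (hr' : r (Q + 2) = 0)
    (hex : ∀ j < Q + 1, LinearMap.ker (d j).vecMulLinear ≤ coboundary d j) :
    entryIdeal (d Q) = I := by
  have hu : ∀ a b : Fin (r (Q + 1)), a = b := by rw [hr]; exact fun a b ↦ Subsingleton.elim a b
  let z : Fin (r (Q + 1)) := ⟨0, by omega⟩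
  have hu' : ∀ u : Fin (r Q) → S, ∀ b, (d Q).vecMulLinear u b ∈ entryIdeal (d Q) := by
    intro u b
    change ∑ a, u a * d Q a b ∈ _
    exact Submodule.sum_mem _ fun a _ ↦ Ideal.mul_mem_left _ _ (Ideal.subset_span ⟨a, b, rfl⟩)
  apply le_antisymm
  -- By exactness of the dual, Ext^(Q + 1) of the last cokernel is `S ⧸ I`. The cokernel is S modulo
  -- the entries of `d Q`, so these entries kill `S ⧸ I`.
  · obtain ⟨f, -, hf⟩ := exists_surjective_ext_coker h.mul_eq_zero h.rank_zero hex (by omega)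
    rw [← h.entryIdeal_eq, ← hf, entryIdeal, Ideal.span_le]
    rintro _ ⟨a, b, rfl⟩
    change f (d Q a b) = 0
    rw [← mul_one (d Q a b), ← smul_eq_mul, map_smul]
    refine smul_ext_eq_zero_of_left (fun x ↦ ?_) _ _
    obtain ⟨x, rfl⟩ := Submodule.Quotient.mk_surjective _ x
    rw [← Submodule.Quotient.mk_smul, Submodule.Quotient.mk_eq_zero]
    refine ⟨Pi.single a (x z), funext fun c ↦ ?_⟩
    rw [hu c z, hu b z]
    simp [mul_comm]
  · intro a ha
    -- Conversely, I kills the cohomology at the last spot, so a times the basis vector is a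
    -- combination of the rows of `d Q`.
    obtain ⟨u, hu1⟩ := h.smul_mem_range S Q ha (w := fun _ ↦ 1) (by
      have : IsEmpty (Fin (r (Q + 1 + 1))) := by rw [hr']; infer_instance
      exact Subsingleton.elim _ _)
    rw [coMap_self] at hu1
    have := hu' u z
    rw [hu1] at this
    simpa using this

end Gorenstein

/-! ## Graded resolutions and Hilbert functions -/

section Graded

open MvPolynomial

variable {k : Type u} [Field k] {m : ℕ}

lemma homogeneousComponent_mul_of_isHomogeneous {p : MvPolynomial (Fin m) k} {t : ℕ}
    (hp : p.IsHomogeneous t) (n : ℕ) (f : MvPolynomial (Fin m) k) :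
    homogeneousComponent n (p * f) = if t ≤ n then p * homogeneousComponent (n - t) f else 0 := by
  have hf := sum_homogeneousComponent f
  have h1 : homogeneousComponent n (p * f) = ∑ i ∈ Finset.range (f.totalDegree + 1),
      if n = t + i then p * homogeneousComponent i f else 0 := by
    conv_lhs => rw [← hf]
    rw [Finset.mul_sum, map_sum]
    refine Finset.sum_congr rfl fun i _ ↦ ?_
    rw [homogeneousComponent_of_mem (hp.mul (homogeneousComponent_isHomogeneous i f))]
  rw [h1]
  split_ifs with hn
  · obtain ⟨s, rfl⟩ := Nat.exists_eq_add_of_le hn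
    simp only [add_right_inj, Nat.add_sub_cancel_left]
    rw [Finset.sum_ite_eq]
    split_ifs with hs
    · rfl
    · rw [homogeneousComponent_eq_zero s f (by simpa using hs), mul_zero]
  · exact Finset.sum_eq_zero fun i _ ↦ if_neg (by omega)

/-- The degree `j` part of `S(-e)`. -/
noncomputable def twistPart (k : Type u) [Field k] (m e j : ℕ) :
    Submodule k (MvPolynomial (Fin m) k) :=
  if e ≤ j then homogeneousSubmodule (Fin m) k (j - e) else ⊥

/-- The projection of `S(-e)` onto its degree `j` part. -/
noncomputable def twistProj (k : Type u) [Field k] (m e j : ℕ) :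
    MvPolynomial (Fin m) k →ₗ[k] MvPolynomial (Fin m) k :=
  if e ≤ j then homogeneousComponent (j - e) else 0

lemma twistProj_mem (e j : ℕ) (f : MvPolynomial (Fin m) k) :
    twistProj k m e j f ∈ twistPart k m e j := by
  unfold twistProj twistPart
  split_ifs
  · exact homogeneousComponent_mem _ _
  · exact Submodule.zero_mem _

lemma twistProj_eq_self {e j : ℕ} {f : MvPolynomial (Fin m) k} (hf : f ∈ twistPart k m e j) :
    twistProj k m e j f = f := by
  unfold twistProj twistPart at *
  split_ifs at *
  · exact homogeneousComponent_eq_self hf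
  · exact ((Submodule.mem_bot k).mp hf).symm

lemma twistProj_mul {p : MvPolynomial (Fin m) k} {e e' : ℕ}
    (hp : p ≠ 0 → ∃ t, e + t = e' ∧ p.IsHomogeneous t) (j : ℕ) (f : MvPolynomial (Fin m) k) :
    twistProj k m e j (p * f) = p * twistProj k m e' j f := by
  by_cases h0 : p = 0
  · simp [h0]
  obtain ⟨t, rfl, ht⟩ := hp h0
  unfold twistProj
  by_cases h1 : e ≤ j
  · rw [if_pos h1, homogeneousComponent_mul_of_isHomogeneous ht]
    by_cases h2 : t ≤ j - e
    · rw [if_pos h2, if_pos (by omega), Nat.sub_sub]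
    · rw [if_neg h2, if_neg (by omega), LinearMap.zero_apply, mul_zero]
  · rw [if_neg h1, if_neg (by omega), LinearMap.zero_apply, LinearMap.zero_apply, mul_zero]

instance (e j : ℕ) : Module.Finite k (twistPart k m e j) := by
  rw [Module.Finite.iff_fg, twistPart]
  split_ifs
  · exact homogeneousSubmodule_fg (Fin m) k _
  · exact Submodule.fg_bot

lemma finrank_twistPart_self (j : ℕ) : Module.finrank k (twistPart k m j j) = 1 := by
  rw [twistPart, if_pos le_rfl, Nat.sub_self, homogeneousSubmodule_zero, Submodule.one_eq_span]
  exact finrank_span_singleton one_ne_zero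

lemma finrank_twistPart_of_lt {e j : ℕ} (h : j < e) : Module.finrank k (twistPart k m e j) = 0 := by
  rw [twistPart, if_neg (by omega), finrank_bot]

/-- The degree `j` part of a graded free module. -/
noncomputable def freePart (k : Type u) [Field k] (m : ℕ) {r : ℕ} (δ : Fin r → ℕ) (j : ℕ) :
    Submodule k (Fin r → MvPolynomial (Fin m) k) :=
  Submodule.pi Set.univ fun b ↦ twistPart k m (δ b) j

lemma mem_freePart {r : ℕ} {δ : Fin r → ℕ} {j : ℕ} {v : Fin r → MvPolynomial (Fin m) k} :
    v ∈ freePart k m δ j ↔ ∀ b, v b ∈ twistPart k m (δ b) j := by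
  simp [freePart, Submodule.mem_pi]

/-- The degree `j` part of a graded free module is a product. -/
noncomputable def freePartEquiv {r : ℕ} (δ : Fin r → ℕ) (j : ℕ) :
    freePart k m δ j ≃ₗ[k] ∀ b, twistPart k m (δ b) j where
  toFun v b := ⟨v.1 b, mem_freePart.mp v.2 b⟩
  invFun w := ⟨fun b ↦ (w b).1, mem_freePart.mpr fun b ↦ (w b).2⟩
  map_add' _ _ := rfl
  map_smul' _ _ := rfl
  left_inv _ := rfl
  right_inv _ := rfl

instance {r : ℕ} (δ : Fin r → ℕ) (j : ℕ) : Module.Finite k (freePart k m δ j) :=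
  Module.Finite.equiv (freePartEquiv δ j).symm

lemma finrank_freePart {r : ℕ} (δ : Fin r → ℕ) (j : ℕ) :
    Module.finrank k (freePart k m δ j) = ∑ b, Module.finrank k (twistPart k m (δ b) j) := by
  rw [(freePartEquiv δ j).finrank_eq, Module.finrank_pi_fintype]

/-- A matrix of homogeneous polynomials defining a map of degree zero. -/
def IsGradedMatrix {r s : ℕ} (δ : Fin r → ℕ) (ε : Fin s → ℕ)
    (M : Matrix (Fin r) (Fin s) (MvPolynomial (Fin m) k)) : Prop :=
  ∀ a b, M a b ≠ 0 → ∃ t, δ a + t = ε b ∧ (M a b).IsHomogeneous t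

lemma IsGradedMatrix.proj_mulVec {r s : ℕ} {δ : Fin r → ℕ} {ε : Fin s → ℕ}
    {M : Matrix (Fin r) (Fin s) (MvPolynomial (Fin m) k)} (hM : IsGradedMatrix δ ε M) (j : ℕ)
    (w : Fin s → MvPolynomial (Fin m) k) (a : Fin r) :
    twistProj k m (δ a) j (M.mulVec w a) = M.mulVec (fun b ↦ twistProj k m (ε b) j (w b)) a := by
  simp only [Matrix.mulVec, dotProduct, map_sum]
  exact Finset.sum_congr rfl fun b _ ↦ twistProj_mul (hM a b) j (w b)

lemma IsGradedMatrix.mulVec_mem {r s : ℕ} {δ : Fin r → ℕ} {ε : Fin s → ℕ}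
    {M : Matrix (Fin r) (Fin s) (MvPolynomial (Fin m) k)} (hM : IsGradedMatrix δ ε M) {j : ℕ}
    {w : Fin s → MvPolynomial (Fin m) k} (hw : w ∈ freePart k m ε j) :
    M.mulVec w ∈ freePart k m δ j := by
  rw [mem_freePart] at hw ⊢
  intro a
  have := hM.proj_mulVec j w a
  rw [show (fun b ↦ twistProj k m (ε b) j (w b)) = w from
    funext fun b ↦ twistProj_eq_self (hw b)] at this
  rw [← this]
  exact twistProj_mem _ _ _

/-- Projecting a preimage to its degree j part does not change the image, because graded matrices
commute with these projections. -/
lemma IsGradedMatrix.exists_mem_freePart {r s : ℕ} {δ : Fin r → ℕ} {ε : Fin s → ℕ}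
    {M : Matrix (Fin r) (Fin s) (MvPolynomial (Fin m) k)} (hM : IsGradedMatrix δ ε M) {j : ℕ}
    {v : Fin r → MvPolynomial (Fin m) k} (hv : v ∈ freePart k m δ j)
    (h : ∃ w, M.mulVec w = v) : ∃ w ∈ freePart k m ε j, M.mulVec w = v := by
  obtain ⟨w, rfl⟩ := h
  rw [mem_freePart] at hv
  refine ⟨fun b ↦ twistProj k m (ε b) j (w b), mem_freePart.mpr fun b ↦ twistProj_mem _ _ _, ?_⟩
  ext1 a
  rw [← hM.proj_mulVec, twistProj_eq_self (hv a)]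

end Graded

/-! ### Alternating sums of graded Betti numbers -/

namespace MinimalGradedFreeResolution

open MvPolynomial

variable {k : Type u} [Field k] {m : ℕ} {I : Ideal (MvPolynomial (Fin m) k)}
  (F : MinimalGradedFreeResolution I)

/-- The ranks of the resolution of `S ⧸ I`. -/
def quotRank : ℕ → ℕ
  | 0 => 1
  | i + 1 => F.rank i

/-- The degrees of the resolution of `S ⧸ I`. -/
def quotDeg : ∀ i, Fin (F.quotRank i) → ℕ
  | 0 => fun _ ↦ 0
  | i + 1 => F.deg i

/-- The matrices of the resolution of `S ⧸ I`. -/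
def quotD : ∀ i, Matrix (Fin (F.quotRank i)) (Fin (F.quotRank (i + 1))) (MvPolynomial (Fin m) k)
  | 0 => Matrix.of fun _ b ↦ F.gen b
  | i + 1 => F.d i

lemma isGradedMatrix_quotD : ∀ i, IsGradedMatrix (F.quotDeg i) (F.quotDeg (i + 1)) (F.quotD i)
  | 0 => fun _ b _ ↦ ⟨F.deg 0 b, zero_add _, F.gen_homogeneous b⟩
  | i + 1 => fun a b h ↦ F.d_homogeneous i a b h

lemma quotD_zero_mulVec (w : Fin (F.rank 0) → MvPolynomial (Fin m) k) (a : Fin 1) :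
    (F.quotD 0).mulVec w a = Fintype.linearCombination (MvPolynomial (Fin m) k) F.gen w := by
  simp only [Matrix.mulVec, dotProduct, Fintype.linearCombination_apply, smul_eq_mul]
  exact Finset.sum_congr rfl fun b _ ↦ mul_comm _ _

lemma isResolution : IsResolution F.quotD I where
  rank_zero := rfl
  entryIdeal_eq := by
    conv_rhs => rw [← F.range_aug, Fintype.range_linearCombination]
    rw [entryIdeal, Ideal.span]
    congr 1
    ext x
    exact ⟨fun ⟨_, b, h⟩ ↦ ⟨b, h⟩, fun ⟨b, h⟩ ↦ ⟨(0 : Fin 1), b, h⟩⟩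
  exact
    | 0 => by
      refine F.exact_zero.trans (Submodule.ext fun w ↦ ?_)
      change Fintype.linearCombination (MvPolynomial (Fin m) k) F.gen w = 0 ↔
        (F.quotD 0).mulVec w = 0
      constructor
      · intro h
        ext1 a
        exact (F.quotD_zero_mulVec w a).trans h
      · intro h
        exact (F.quotD_zero_mulVec w 0).symm.trans (congrFun h (0 : Fin 1))
    | i + 1 => F.exact_succ i

lemma constantCoeff_quotD (hI : ∀ f ∈ I, constantCoeff f = 0) :
    ∀ i a b, constantCoeff (F.quotD i a b) = 0
  | 0 => fun a b ↦ hI _ (F.isResolution.entryIdeal_eq.le (Ideal.subset_span ⟨a, b, rfl⟩))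
  | i + 1 => F.minimal i

/-- The degree `j` part of the image of a differential. -/
noncomputable def imagePart (i j : ℕ) :
    Submodule k (Fin (F.quotRank i) → MvPolynomial (Fin m) k) :=
  (freePart k m (F.quotDeg (i + 1)) j).map ((F.quotD i).mulVecLin.restrictScalars k)

/-- Rank–nullity in degree j; by exactness the kernel is the image of the next differential. -/
lemma finrank_freePart_eq (i j : ℕ) : Module.finrank k (freePart k m (F.quotDeg (i + 1)) j) =
    Module.finrank k (F.imagePart i j) + Module.finrank k (F.imagePart (i + 1) j) := by
  let f := ((F.quotD i).mulVecLin.restrictScalars k).domRestrict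
    (freePart k m (F.quotDeg (i + 1)) j)
  have h1 := f.finrank_range_add_finrank_ker
  have h2 : LinearMap.range f = F.imagePart i j := by
    rw [LinearMap.range_domRestrict]; rfl
  have h3 : (LinearMap.ker f).map (Submodule.subtype _) = F.imagePart (i + 1) j := by
    ext v
    constructor
    · rintro ⟨⟨v, hv⟩, hv', rfl⟩
      obtain ⟨w, hw, hw'⟩ := (F.isGradedMatrix_quotD (i + 1)).exists_mem_freePart hv (by
        have h4 : v ∈ LinearMap.ker (F.quotD i).mulVecLin := hv'
        rw [← F.isResolution.exact i] at h4
        exact h4)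
      exact ⟨w, hw, hw'⟩
    · rintro ⟨w, hw, rfl⟩
      refine ⟨⟨_, (F.isGradedMatrix_quotD (i + 1)).mulVec_mem hw⟩, ?_, rfl⟩
      have h4 : (F.quotD (i + 1)).mulVecLin w ∈ LinearMap.ker (F.quotD i).mulVecLin := by
        rw [← F.isResolution.exact i]
        exact ⟨w, rfl⟩
      exact h4
  rw [← h1, h2, ← h3, Submodule.finrank_map_subtype_eq]

lemma mem_imagePart_zero (j : ℕ) (v : Fin 1 → MvPolynomial (Fin m) k) :
    v ∈ F.imagePart 0 j ↔ v ∈ freePart k m (fun _ : Fin 1 ↦ 0) j ∧ v 0 ∈ I := by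
  constructor
  · rintro ⟨w, hw, rfl⟩
    refine ⟨(F.isGradedMatrix_quotD 0).mulVec_mem hw, ?_⟩
    have h1 := F.quotD_zero_mulVec w 0
    change (F.quotD 0).mulVec w (0 : Fin 1) ∈ I
    rw [h1]
    have h2 : Fintype.linearCombination (MvPolynomial (Fin m) k) F.gen w ∈
      LinearMap.range (Fintype.linearCombination (MvPolynomial (Fin m) k) F.gen) := ⟨w, rfl⟩
    rwa [F.range_aug] at h2
  · rintro ⟨hv, hv'⟩
    rw [← F.range_aug] at hv'
    obtain ⟨w, hw⟩ := hv'
    obtain ⟨w, hw, hw'⟩ := (F.isGradedMatrix_quotD 0).exists_mem_freePart hv ⟨w, by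
      ext1 a
      exact (F.quotD_zero_mulVec w a).trans (hw.trans (congrArg v (Subsingleton.elim (α := Fin 1) 0 a)))⟩
    exact ⟨w, hw, hw'⟩

/-- The alternating sum of the values of a function at the degrees of the resolution. -/
noncomputable def eulerSum (N : ℕ) : (ℕ → ℤ) →ₗ[ℤ] ℤ :=
  ∑ i ∈ Finset.range N, (-1 : ℤ) ^ i • ∑ b : Fin (F.rank i), LinearMap.proj (F.deg i b)

lemma eulerSum_apply (N : ℕ) (g : ℕ → ℤ) :
    F.eulerSum N g = ∑ i ∈ Finset.range N, (-1 : ℤ) ^ i * ∑ b : Fin (F.rank i), g (F.deg i b) := by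
  simp [eulerSum]

lemma eulerSum_finrank (N j : ℕ) :
    F.eulerSum N (fun e ↦ (Module.finrank k (twistPart k m e j) : ℤ)) =
      Module.finrank k (F.imagePart 0 j) - (-1) ^ N * Module.finrank k (F.imagePart N j) := by
  rw [eulerSum_apply]
  induction N with
  | zero => simp
  | succ N ih =>
    rw [Finset.sum_range_succ, ih]
    have h1 := F.finrank_freePart_eq N j
    rw [finrank_freePart] at h1
    have h2 : (∑ b : Fin (F.rank N), (Module.finrank k (twistPart k m (F.deg N b) j) : ℤ)) =
        Module.finrank k (F.imagePart N j) + Module.finrank k (F.imagePart (N + 1) j) := by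
      exact_mod_cast h1
    rw [h2]
    ring

lemma finrank_imagePart_of_rank_eq_zero {N : ℕ} (hN : F.rank N = 0) (j : ℕ) :
    Module.finrank k (F.imagePart N j) = 0 := by
  have h1 := F.finrank_freePart_eq N j
  have : IsEmpty (Fin (F.quotRank (N + 1))) := by
    change IsEmpty (Fin (F.rank N))
    rw [hN]; infer_instance
  rw [finrank_freePart, Finset.sum_of_isEmpty] at h1
  omega

/-- The alternating sums of the graded Betti numbers depend on the ideal only. -/
theorem eulerSum_single_eq (F' : MinimalGradedFreeResolution I) {N : ℕ} (hF : F.rank N = 0)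
    (hF' : F'.rank N = 0) (e : ℕ) :
    F.eulerSum N (Pi.single e 1) = F'.eulerSum N (Pi.single e 1) := by
  have hL : ∀ j, (F.eulerSum N - F'.eulerSum N)
      (fun e ↦ (Module.finrank k (twistPart k m e j) : ℤ)) = 0 := by
    intro j
    have h0 : (F.imagePart 0 j : Submodule k (Fin 1 → MvPolynomial (Fin m) k)) =
        F'.imagePart 0 j :=
      Submodule.ext fun v ↦ (F.mem_imagePart_zero j v).trans (F'.mem_imagePart_zero j v).symm
    have h1 : Module.finrank k (F.imagePart 0 j) = Module.finrank k (F'.imagePart 0 j) :=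
      congrArg (fun W : Submodule k (Fin 1 → MvPolynomial (Fin m) k) ↦ Module.finrank k W) h0
    rw [LinearMap.sub_apply, eulerSum_finrank, eulerSum_finrank,
      F.finrank_imagePart_of_rank_eq_zero hF, F'.finrank_imagePart_of_rank_eq_zero hF', h1, sub_self]
  rw [← sub_eq_zero, ← LinearMap.sub_apply]
  induction e using Nat.strong_induction_on with
  | _ e ih =>
    -- The Hilbert functions are unitriangular: the degree e part of S(-x) has dimension 1 for x = e
    -- and 0 for x > e. So the equality for Hilbert functions gives the equality for each single
    -- degree by induction.
    have h1 : (fun x ↦ (Module.finrank k (twistPart k m x e) : ℤ)) = Pi.single e 1 +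
        ∑ x ∈ Finset.range e, (Module.finrank k (twistPart k m x e) : ℤ) • Pi.single x 1 := by
      ext y
      rw [Pi.add_apply, Finset.sum_apply]
      simp only [Pi.smul_apply, Pi.single_apply, smul_eq_mul, mul_ite, mul_one, mul_zero]
      rw [Finset.sum_ite_eq]
      rcases lt_trichotomy y e with h | rfl | h
      · simp [h, h.ne]
      · simp [finrank_twistPart_self]
      · simp [finrank_twistPart_of_lt h, h.ne', h.not_gt]
    have h2 := hL e
    rw [h1, map_add, map_sum, Finset.sum_eq_zero fun x hx ↦ by
      rw [map_smul, ih x (Finset.mem_range.mp hx), smul_zero], add_zero] at h2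
    exact h2

end MinimalGradedFreeResolution

/-! ## Projective dimension -/

section ProjDim

variable {S : Type u} [CommRing S] {I : Ideal S} {r : ℕ → ℕ}
  {d : ∀ i, Matrix (Fin (r i)) (Fin (r (i + 1))) S}

lemma isShortExact_ideal (I : Ideal S) : IsShortExact I.subtype I.mkQ :=
  ⟨Subtype.val_injective, LinearMap.exact_subtype_mkQ _, Submodule.mkQ_surjective _⟩

/-- The resolution of the quotient is one step longer than that of the ideal, hence Q and not Q + 1.
-/
lemma IsResolution.projectiveDimension_le (h : IsResolution d I) {Q : ℕ}
    (hr : ∀ j, Q + 1 < j → r j = 0) : projectiveDimension (ModuleCat.of S I) ≤ Q := by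
  rw [projectiveDimension_le_iff]
  refine HasProjectiveDimensionLT.mk fun i hi Y e ↦ ?_
  obtain ⟨i, rfl⟩ := Nat.exists_eq_add_of_le' (Nat.one_le_of_lt hi)
  have h1 : Subsingleton (ExtM S (S ⧸ I) Y (i + 1 + 1)) :=
    h.subsingleton_ext_of_rank_eq_zero Y (i + 1) (hr _ (by omega))
  have h2 : Subsingleton (ExtM S I Y (i + 1)) :=
    ((isShortExact_ideal I).extδEquiv Y (i + 1)).subsingleton
  exact h2.elim e 0

lemma IsResolution.le_projectiveDimension (h : IsResolution d I) {Q : ℕ} {J : Ideal S}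
    (hJ : J ≠ ⊤) (hd : ∀ a b, d (Q + 1) a b ∈ J) (hr : r (Q + 2) ≠ 0) (hr' : r (Q + 3) = 0) :
    ((Q + 1 : ℕ) : WithBot ℕ∞) ≤ projectiveDimension (ModuleCat.of S I) := by
  rw [projectiveDimension_ge_iff]
  intro hpd
  have h2 : Subsingleton (ExtM S I S (Q + 1)) :=
    HasProjectiveDimensionLT.subsingleton (ModuleCat.of S I) (Q + 1) (Q + 1) le_rfl _
  exact h.not_subsingleton_ext (Q + 1) hJ hd hr hr'
    ((isShortExact_ideal I).extδEquiv S (Q + 1)).symm.subsingleton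

/-- A matrix of a minimal resolution has no zero rows where the dual is exact. -/
lemma exists_entry_ne_zero_of_ker_le {J : Ideal S} (hJ : J ≠ ⊤)
    (hd : ∀ i a b, d i a b ∈ J) {i : ℕ}
    (hex : LinearMap.ker (d i).vecMulLinear ≤ coboundary d i) (a : Fin (r i)) :
    ∃ b, d i a b ≠ 0 := by
  by_contra! hc
  -- A zero row makes a basis vector a cocycle, hence a coboundary; but coboundaries have
  -- coordinates in J.
  have h1 : Pi.single a 1 ∈ LinearMap.ker (d i).vecMulLinear := by
    rw [LinearMap.mem_ker]
    ext b
    simp [hc]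
  refine (Ideal.ne_top_iff_one J).mp hJ ?_
  have h2 := hex h1
  rcases i with _ | i
  · have := congrFun ((Submodule.mem_bot S).mp h2) a
    rw [Pi.single_eq_same] at this
    rw [this]
    exact J.zero_mem
  · obtain ⟨u, hu⟩ := h2
    have := congrFun hu a
    rw [Pi.single_eq_same] at this
    rw [← this]
    change ∑ c, u c * d i c a ∈ J
    exact Submodule.sum_mem _ fun c _ ↦ Ideal.mul_mem_left _ _ (hd _ _ _)

end ProjDim

/-! ## The squarefree resolution as a graded resolution -/

section SqGraded

open MvPolynomial

variable {k : Type u} [Field k] {m : ℕ} {U : Set (Finset (Fin m))}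

lemma degree_sqExp (σ : Finset (Fin m)) : (sqExp σ).degree = σ.card := by
  rw [Finsupp.degree_eq_sum]
  simp [sqExp_apply]

lemma SqResolution.isHomogeneous_d (G : SqResolution k U) (i : ℕ) (a : Fin (G.rank i))
    (b : Fin (G.rank (i + 1))) :
    (G.d i a b).IsHomogeneous (G.deg (i + 1) b \ G.deg i a).card :=
  isHomogeneous_monomial _ (degree_sqExp _)

lemma SqResolution.coef_ne_zero (G : SqResolution k U) {i : ℕ} {a : Fin (G.rank i)}
    {b : Fin (G.rank (i + 1))} (h : G.d i a b ≠ 0) : G.coef i a b ≠ 0 := by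
  rintro hc
  exact h (by rw [SqResolution.d, Matrix.of_apply, hc, monomial_zero])

lemma SqResolution.deg_one_mem (G : SqResolution k U) (b : Fin (G.rank 1)) : G.deg 1 b ∈ U := by
  obtain ⟨a, ha⟩ := G.exists_coef_ne_zero 0 b
  refine (G.strand_zero _).mpr ⟨_, supportedIn_single _ b, fun h ↦ ha ?_⟩
  simpa using congrFun h a

lemma SqResolution.exists_deg_one_subset (G : SqResolution k U) {σ : Finset (Fin m)} (hσ : σ ∈ U) :
    ∃ b, G.deg 1 b ⊆ σ := by
  obtain ⟨w, hw, hw'⟩ := (G.strand_zero σ).mp hσ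
  by_contra! hc
  apply hw'
  rw [show w = 0 from funext fun b ↦ by_contra fun hb ↦ hc b (hw b hb), Matrix.mulVec_zero]

/-- The minimal graded free resolution of a squarefree monomial ideal. -/
noncomputable def SqResolution.toMinimal (G : SqResolution k U) :
    MinimalGradedFreeResolution (sqIdeal k U) where
  rank i := G.rank (i + 1)
  deg i b := (G.deg (i + 1) b).card
  gen b := G.d 0 ⟨0, by rw [G.rank_zero]; exact one_pos⟩ b
  d i := G.d (i + 1)
  gen_homogeneous b := by
    have := G.isHomogeneous_d 0 ⟨0, by rw [G.rank_zero]; exact one_pos⟩ b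
    rwa [G.deg_zero, Finset.sdiff_empty] at this
  d_homogeneous i a b h := by
    refine ⟨_, ?_, G.isHomogeneous_d (i + 1) a b⟩
    rw [add_comm]
    exact Finset.card_sdiff_add_card_eq_card (G.deg_ssubset _ _ _ (G.coef_ne_zero h)).subset
  range_aug := by
    have hu : ∀ a b : Fin (G.rank 0), a = b := by
      rw [G.rank_zero]; exact fun a b ↦ Subsingleton.elim a b
    rw [Fintype.range_linearCombination, ← G.entryIdeal_d_zero, entryIdeal, Ideal.span]
    congr 1
    ext x
    exact ⟨fun ⟨b, h⟩ ↦ ⟨_, b, h⟩, fun ⟨a, b, h⟩ ↦ ⟨b, by rw [← h]; exact congrArg₂ _ (hu _ _) rfl⟩⟩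
  exact_zero := by
    have hu : ∀ a b : Fin (G.rank 0), a = b := by
      rw [G.rank_zero]; exact fun a b ↦ Subsingleton.elim a b
    rw [G.isResolution.exact 0]
    ext w
    have key : ∀ a, (G.d 0).mulVec w a = Fintype.linearCombination (MvPolynomial (Fin m) k)
        (fun b ↦ G.d 0 ⟨0, by rw [G.rank_zero]; exact one_pos⟩ b) w := by
      intro a
      simp only [Matrix.mulVec, dotProduct, Fintype.linearCombination_apply, smul_eq_mul]
      exact Finset.sum_congr rfl fun b _ ↦ by rw [mul_comm, hu a]
    rw [LinearMap.mem_ker, LinearMap.mem_ker, Matrix.mulVecLin_apply]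
    exact ⟨fun h ↦ by rw [← key ⟨0, by rw [G.rank_zero]; exact one_pos⟩, h]; rfl,
      fun h ↦ funext fun a ↦ (key a).trans h⟩
  exact_succ i := G.isResolution.exact (i + 1)
  minimal i := G.constantCoeff_d (i + 1)

lemma mem_of_monomial_mem_sqIdeal (hU : ∀ σ ∈ U, ∀ τ, σ ⊆ τ → τ ∈ U) {σ : Finset (Fin m)} {c : k}
    (hc : c ≠ 0) (h : monomial (sqExp σ) c ∈ sqIdeal k U) : σ ∈ U := by
  have : sqIdeal k U = Ideal.span ((fun s ↦ monomial s 1) '' (sqExp '' U)) := by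
    rw [sqIdeal, Set.image_image]
    congr 1
    ext f
    simp only [monomial_sqExp, Set.mem_image, Set.mem_ofPred_eq, eq_comm]
  rw [this, mem_ideal_span_monomial_image] at h
  obtain ⟨_, ⟨τ, hτ, rfl⟩, hle⟩ := h (sqExp σ) (by simp [hc])
  rw [sqExp_le_iff, support_sqExp] at hle
  exact hU τ hτ σ hle

lemma constantCoeff_of_mem_sqIdeal (h0 : ∅ ∉ U) {f : MvPolynomial (Fin m) k}
    (hf : f ∈ sqIdeal k U) : constantCoeff f = 0 := by
  refine mem_varIdeal_univ.mp (sqIdeal_le_varIdeal (fun σ hσ ↦ ?_) hf)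
  obtain ⟨i, hi⟩ := Finset.nonempty_iff_ne_empty.mpr fun h : σ = ∅ ↦ h0 (h ▸ hσ)
  exact ⟨i, hi, Finset.mem_univ i⟩

/-- An ideal generated by forms of degree `t` contains no nonzero forms of smaller degree. -/
lemma le_of_mem_span_of_isHomogeneous {A : Set (MvPolynomial (Fin m) k)} {t s : ℕ}
    (hA : ∀ f ∈ A, f.IsHomogeneous t) {f : MvPolynomial (Fin m) k} (hf : f ∈ Ideal.span A)
    (hs : f.IsHomogeneous s) (h0 : f ≠ 0) : t ≤ s := by
  have key : ∀ e : Fin m →₀ ℕ, e.degree < t → coeff e f = 0 := by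
    clear hs h0
    induction hf using Submodule.span_induction with
    | mem x hx =>
      intro e he
      exact (hA x hx).coeff_eq_zero he.ne
    | zero => simp
    | add x y _ _ hx hy => intro e he; rw [coeff_add, hx e he, hy e he, add_zero]
    | smul c x _ hx =>
      intro e he
      rw [smul_eq_mul, coeff_mul]
      refine Finset.sum_eq_zero fun p hp ↦ ?_
      rw [Finset.HasAntidiagonal.mem_antidiagonal] at hp
      rw [hx p.2 (lt_of_le_of_lt ?_ he), mul_zero]
      rw [← hp, map_add]
      exact Nat.le_add_left _ _
  by_contra hc
  apply h0
  ext e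
  rw [coeff_zero]
  by_cases he : e.degree = s
  · exact key e (by omega)
  · exact hs.coeff_eq_zero he

lemma eq_of_span_eq_of_isHomogeneous {A B : Set (MvPolynomial (Fin m) k)} {t s : ℕ}
    (hA : ∀ f ∈ A, f.IsHomogeneous t) (hB : ∀ f ∈ B, f.IsHomogeneous s)
    (h : Ideal.span A = Ideal.span B) (h0 : Ideal.span A ≠ ⊥) : t = s := by
  have key : ∀ (A B : Set (MvPolynomial (Fin m) k)) (t s : ℕ), (∀ f ∈ A, f.IsHomogeneous t) →
      (∀ f ∈ B, f.IsHomogeneous s) → Ideal.span A = Ideal.span B → Ideal.span A ≠ ⊥ → t ≤ s := by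
    intro A B t s hA hB h h0
    rw [h, ne_eq, Ideal.span_eq_bot] at h0
    push Not at h0
    obtain ⟨f, hf, hf0⟩ := h0
    exact le_of_mem_span_of_isHomogeneous hA (h ▸ Ideal.subset_span hf) (hB f hf) hf0
  exact le_antisymm (key A B t s hA hB h h0) (key B A s t hB hA h.symm (h ▸ h0))

end SqGraded

/-! ### Detecting shifts through alternating sums -/

namespace MinimalGradedFreeResolution

variable {k : Type u} [Field k] {m : ℕ} {I : Ideal (MvPolynomial (Fin m) k)}
  (F : MinimalGradedFreeResolution I)

lemma exists_deg_eq_of_eulerSum_ne_zero {N e : ℕ} (h : F.eulerSum N (Pi.single e 1) ≠ 0) :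
    ∃ i < N, ∃ b, F.deg i b = e := by
  by_contra! hc
  apply h
  rw [eulerSum_apply]
  refine Finset.sum_eq_zero fun i hi ↦ ?_
  rw [Finset.sum_eq_zero fun b _ ↦ Pi.single_eq_of_ne (hc i (Finset.mem_range.mp hi) b) _, mul_zero]

/-- A shift that occurs only in the last module, which has rank one, cannot cancel; so it occurs in
every other finite minimal resolution as well. -/
lemma eulerSum_ne_zero {Q e : ℕ} (hQ : F.rank Q = 1) (hdeg : ∀ b, F.deg Q b = e)
    (hlt : ∀ i < Q, ∀ b, F.deg i b ≠ e) : F.eulerSum (Q + 1) (Pi.single e 1) ≠ 0 := by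
  rw [eulerSum_apply, Finset.sum_range_succ, Finset.sum_eq_zero fun i hi ↦ by
    rw [Finset.sum_eq_zero fun b _ ↦ Pi.single_eq_of_ne (hlt i (Finset.mem_range.mp hi) b) _,
      mul_zero]]
  simp [hdeg, hQ]

end MinimalGradedFreeResolution

/-! ## Degrees in the squarefree resolution -/

section Degrees

open MvPolynomial

variable {k : Type u} [Field k] {m : ℕ} {K : AbstractSimplicialComplex (Fin m)}

lemma SqResolution.exists_coef_row_ne_zero {U : Set (Finset (Fin m))} (G : SqResolution k U)
    {i : ℕ} (hex : LinearMap.ker (G.d i).vecMulLinear ≤ coboundary G.d i) (a : Fin (G.rank i)) :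
    ∃ b, G.coef i a b ≠ 0 := by
  obtain ⟨b, hb⟩ := exists_entry_ne_zero_of_ker_le
    (isPrime_varIdeal (k := k) (Finset.univ : Finset (Fin m))).ne_top
    (fun i a b ↦ mem_varIdeal_univ.mpr (G.constantCoeff_d i a b)) hex a
  exact ⟨b, G.coef_ne_zero hb⟩

variable (G : SqResolution k (nonfaces K))

/-- Some face becomes a nonface when v is added, and a generator dividing the new monomial must
involve v. -/
lemma SqResolution.exists_mem_deg_one (hK : ¬ IsCone K) (v : Fin m) : ∃ b, v ∈ G.deg 1 b := by
  unfold IsCone at hK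
  push Not at hK
  obtain ⟨σ, hσ, hσ'⟩ := hK v
  obtain ⟨b, hb⟩ := G.exists_deg_one_subset hσ'
  refine ⟨b, ?_⟩
  by_contra hv
  exact G.deg_one_mem b (hσ.mono ((Finset.subset_insert_iff_of_notMem hv).mp hb))

variable {Q : ℕ}
  (hex : ∀ j < Q + 1, LinearMap.ker (G.d j).vecMulLinear ≤ coboundary G.d j)

include hex

/-- The last basis element has degree `(1, …, 1)`. -/
lemma SqResolution.deg_last_eq_univ (hK : ¬ IsCone K) (hr : G.rank (Q + 1) = 1)
    (z : Fin (G.rank (Q + 1))) : G.deg (Q + 1) z = Finset.univ := by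
  -- Exactness of the dual excludes zero rows, so each basis element lies below one in the next
  -- step; in this way every vertex is carried to the last basis element.
  have key : ∀ v : Fin m, ∀ i ≤ Q, ∃ a, v ∈ G.deg (i + 1) a := by
    intro v i hi
    induction i with
    | zero => exact G.exists_mem_deg_one hK v
    | succ i ih =>
      obtain ⟨a, ha⟩ := ih (by omega)
      obtain ⟨b, hb⟩ := G.exists_coef_row_ne_zero (hex (i + 1) (by omega)) a
      exact ⟨b, (G.deg_ssubset _ _ _ hb).subset ha⟩
  have hu : ∀ a b : Fin (G.rank (Q + 1)), a = b := by rw [hr]; exact fun a b ↦ Subsingleton.elim a b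
  refine Finset.eq_univ_of_forall fun v ↦ ?_
  obtain ⟨a, ha⟩ := key v Q le_rfl
  rwa [hu z a]

/-- For Q = 0 there is a single generator, and its degree is the set of all vertices. -/
lemma SqResolution.isSimplexBoundary (hK : ¬ IsCone K) (hr : G.rank (Q + 1) = 1) (hQ : Q = 0) :
    IsSimplexBoundary K := by
  subst hQ
  have h1 := G.deg_last_eq_univ hex hK hr
  intro σ
  constructor
  · rintro hσ rfl
    have hz := G.deg_one_mem ⟨0, by rw [hr]; exact one_pos⟩
    rw [h1] at hz
    exact hz hσ
  · intro hσ
    by_contra hf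
    obtain ⟨b, hb⟩ := G.exists_deg_one_subset hf
    rw [h1] at hb
    exact hσ (Finset.univ_subset_iff.mp hb)

lemma SqResolution.card_deg_lt {i : ℕ} (hi : i ≤ Q) (a : Fin (G.rank i)) :
    (G.deg i a).card < m := by
  obtain ⟨b, hb⟩ := G.exists_coef_row_ne_zero (hex i (by omega)) a
  have h1 := Finset.card_lt_card (G.deg_ssubset _ _ _ hb)
  have h2 := Finset.card_le_univ (G.deg (i + 1) b)
  rw [Fintype.card_fin] at h2
  omega

omit hex in
lemma SqResolution.le_card_deg_of_le {e : ℕ} (he : ∀ σ ∈ nonfaces K, e ≤ σ.card) (i : ℕ)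
    (b : Fin (G.rank (i + 1))) : e + i ≤ (G.deg (i + 1) b).card := by
  induction i with
  | zero => exact he _ (G.deg_one_mem b)
  | succ i ih =>
    obtain ⟨a, ha⟩ := G.exists_coef_ne_zero (i + 1) b
    have := Finset.card_lt_card (G.deg_ssubset _ _ _ ha)
    have := ih a
    omega

/-- Counts from the other end: the entries of the last matrix lie in the ideal, so the last step
adds at least e to the degree, and each of the s steps before it adds at least 1. -/
lemma SqResolution.card_deg_add_le {e : ℕ} (he : ∀ σ ∈ nonfaces K, e ≤ σ.card)
    (hlast : entryIdeal (G.d Q) = sqIdeal k (nonfaces K)) (s : ℕ) :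
    ∀ i, i + s = Q → ∀ a : Fin (G.rank i), (G.deg i a).card + e + s ≤ m := by
  induction s with
  | zero =>
    rintro i rfl a
    obtain ⟨b, hb⟩ := G.exists_coef_row_ne_zero (hex i (by omega)) a
    have h1 : G.d i a b ∈ sqIdeal k (nonfaces K) := by
      have h0 : G.d i a b ∈ entryIdeal (G.d i) := Ideal.subset_span ⟨a, b, rfl⟩
      have h2 : entryIdeal (G.d i) = sqIdeal k (nonfaces K) := hlast
      rwa [h2] at h0
    have h2 := he _ (mem_of_monomial_mem_sqIdeal nonfaces_upward hb h1)
    have h3 := Finset.card_sdiff_add_card_eq_card (G.deg_ssubset _ _ _ hb).subset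
    have h4 := Finset.card_le_univ (G.deg (i + 1) b)
    rw [Fintype.card_fin] at h4
    omega
  | succ s ih =>
    intro i hi a
    obtain ⟨b, hb⟩ := G.exists_coef_row_ne_zero (hex i (by omega)) a
    have h1 := Finset.card_lt_card (G.deg_ssubset _ _ _ hb)
    have h2 := ih (i + 1) (by omega) b
    omega

end Degrees

/-! ## Almost linear resolutions of Gorenstein Stanley–Reisner ideals -/

section Main

open MvPolynomial

variable {k : Type u} [Field k] {m : ℕ} {K : AbstractSimplicialComplex (Fin m)}

lemma sqIdeal_nonfaces_ne_bot (hK : ¬ IsCone K) (hm : 0 < m) : sqIdeal k (nonfaces K) ≠ ⊥ := by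
  unfold IsCone at hK
  push Not at hK
  obtain ⟨σ, -, hσ⟩ := hK ⟨0, hm⟩
  intro h
  have h1 : (∏ i ∈ insert ⟨0, hm⟩ σ, X i : MvPolynomial (Fin m) k) ∈ sqIdeal k (nonfaces K) :=
    Ideal.subset_span ⟨_, hσ, rfl⟩
  rw [h, Ideal.mem_bot, ← monomial_sqExp, monomial_eq_zero] at h1
  exact one_ne_zero h1

lemma monomial_mem_sqIdeal {σ : Finset (Fin m)} (h : σ ∈ nonfaces K) :
    monomial (sqExp σ) (1 : k) ∈ sqIdeal k (nonfaces K) := by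
  rw [monomial_sqExp]
  exact Ideal.subset_span ⟨_, h, rfl⟩

/-- In a neighbourly complex all small sets are faces. -/
lemma IsNeighbourly.lt_card (h : IsNeighbourly K) {σ : Finset (Fin m)} (hσ : σ ∈ nonfaces K) :
    maxFaceCard K / 2 + 1 ≤ σ.card := by
  by_contra hc
  have hn : maxFaceCard K / 2 ≤ Fintype.card (Fin m) := by
    obtain ⟨F, -, hF⟩ := exists_isFace_card_eq K
    have := Finset.card_le_univ F
    omega
  obtain ⟨τ, hτ, hτc⟩ := Finset.exists_superset_card_eq (s := σ) (by omega) hn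
  exact hσ ((h τ hτc).mono hτ)

lemma hasAlmostLinearResolution_of_neighbourly (hK : IsGorensteinStar k K)
    (hne : ¬ IsSimplexBoundary K) (hm : 0 < m) (hodd : Odd (complexDim K))
    (hnb : IsNeighbourly K) : HasAlmostLinearResolution (sqIdeal k (nonfaces K)) := by
  obtain ⟨hGor, hcone⟩ := hK
  obtain ⟨G⟩ := nonempty_sqResolution k (U := nonfaces K) nonfaces_upward empty_notMem_nonfaces
  obtain ⟨Q, hQm, hr1, hr0, hex⟩ := G.isResolution.gorenstein hGor hm G.constantCoeff_d
    (sqIdeal_nonfaces_ne_bot hcone hm)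
  have hQ0 : Q ≠ 0 := fun h ↦ hne (G.isSimplexBoundary hex hcone hr1 h)
  -- The dimension is one less than the number of vertices of a facet, so odd dimension means an
  -- even number.
  obtain ⟨e, he⟩ : ∃ e, maxFaceCard K = 2 * e := by
    obtain ⟨a, ha⟩ := hodd
    unfold complexDim at ha
    exact ⟨(a + 1).toNat, by omega⟩
  have hcard : ∀ σ ∈ nonfaces K, e + 1 ≤ σ.card := by
    intro σ hσ
    have := hnb.lt_card hσ
    rwa [he, Nat.mul_div_cancel_left e two_pos] at this
  have hlast := G.isResolution.entryIdeal_last hr1 (hr0 _ (by omega)) hex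
  -- The lower bound is e + 1 + i and the upper bound is m - (e + 1) - (Q - i - 1); they agree
  -- because m = Q + 1 + 2e.
  have hdeg : ∀ i < Q, ∀ a, (G.deg (i + 1) a).card = i + (e + 1) := by
    intro i hi a
    have h1 := G.le_card_deg_of_le hcard i a
    have h2 := G.card_deg_add_le hex hcard hlast (Q - (i + 1)) (i + 1) (by omega) a
    omega
  refine ⟨e + 1, ?_, G.toMinimal, fun i hi j hj ↦ ?_⟩
  · refine le_antisymm (Ideal.span_le.mpr fun f hf ↦ hf.1) ?_
    conv_lhs => rw [← G.entryIdeal_d_zero]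
    refine Ideal.span_mono ?_
    rintro _ ⟨a, b, rfl⟩
    refine ⟨?_, ?_⟩
    · rw [← G.entryIdeal_d_zero]
      exact Ideal.subset_span ⟨a, b, rfl⟩
    · have h1 := G.isHomogeneous_d 0 a b
      rwa [G.deg_zero, Finset.sdiff_empty, hdeg 0 (by omega), zero_add] at h1
  · have hiQ : i < Q := by
      have := hi.trans_le (G.isResolution.projectiveDimension_le hr0)
      exact_mod_cast this
    rw [MinimalGradedFreeResolution.betti, Finset.card_eq_zero, Finset.filter_eq_empty_iff]
    rintro a - ha
    exact hj (ha.symm.trans (hdeg i hiQ a))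

lemma odd_and_neighbourly_of_hasAlmostLinearResolution (hK : IsGorensteinStar k K)
    (hne : ¬ IsSimplexBoundary K) (hm : 0 < m)
    (h : HasAlmostLinearResolution (sqIdeal k (nonfaces K))) :
    Odd (complexDim K) ∧ IsNeighbourly K := by
  obtain ⟨hGor, hcone⟩ := hK
  obtain ⟨G⟩ := nonempty_sqResolution k (U := nonfaces K) nonfaces_upward empty_notMem_nonfaces
  have hI0 := sqIdeal_nonfaces_ne_bot (k := k) hcone hm
  obtain ⟨Q, hQm, hr1, hr0, hex⟩ := G.isResolution.gorenstein hGor hm G.constantCoeff_d hI0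
  have hQ0 : Q ≠ 0 := fun h ↦ hne (G.isSimplexBoundary hex hcone hr1 h)
  obtain ⟨e, hgen, F, hF⟩ := h
  have hconst : ∀ f ∈ sqIdeal k (nonfaces K), constantCoeff f = 0 :=
    fun f hf ↦ constantCoeff_of_mem_sqIdeal empty_notMem_nonfaces hf
  obtain ⟨Q', hQm', hF1, hF0, hFex⟩ := F.isResolution.gorenstein hGor hm
    (F.constantCoeff_quotD hconst) hI0
  -- The given resolution and the squarefree one both have length m - n.
  obtain rfl : Q' = Q := by omega
  obtain ⟨q, rfl⟩ := Nat.exists_eq_succ_of_ne_zero hQ0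
  have hm_ne : (varIdeal k (Finset.univ : Finset (Fin m))) ≠ ⊤ := (isPrime_varIdeal _).ne_top
  have hpd := F.isResolution.le_projectiveDimension hm_ne
    (fun a b ↦ mem_varIdeal_univ.mpr (F.constantCoeff_quotD hconst _ a b))
    (by rw [hF1]; exact one_ne_zero) (hF0 _ (by omega))
  have hlin : ∀ i < q + 1, ∀ b, F.deg i b = i + e := by
    intro i hi b
    by_contra hb
    have h1 := hF i (lt_of_lt_of_le (by exact_mod_cast hi) hpd) _ hb
    rw [MinimalGradedFreeResolution.betti, Finset.card_eq_zero, Finset.filter_eq_empty_iff] at h1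
    exact h1 (Finset.mem_univ b) rfl
  have hFlast := F.isResolution.entryIdeal_last hF1 (hF0 _ (by omega)) hFex
  have hFrank : F.rank (q + 1) = 1 := hF1
  have hu : ∀ a b : Fin (F.rank (q + 1)), a = b := by
    rw [hFrank]; exact fun a b ↦ Subsingleton.elim a b
  let z : Fin (F.rank (q + 1)) := ⟨0, by rw [hFrank]; exact one_pos⟩
  -- All sources of the last differential sit in degree q + e, so its entries are forms of one
  -- common degree t.
  obtain ⟨t, ht⟩ : ∃ t, q + e + t = F.deg (q + 1) z := by
    have h1 : entryIdeal (F.quotD (q + 1)) ≠ ⊥ := fun h0 ↦ hI0 (hFlast.symm.trans h0)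
    rw [entryIdeal, ne_eq, Ideal.span_eq_bot] at h1
    push Not at h1
    obtain ⟨_, ⟨a, b, rfl⟩, hab⟩ := h1
    obtain ⟨t, ht, -⟩ := F.d_homogeneous q a b hab
    have h2 : F.deg q a = q + e := hlin q (by omega) a
    have h3 : F.deg (q + 1) b = F.deg (q + 1) z := congrArg (F.deg (q + 1)) (hu b z)
    exact ⟨t, by omega⟩
  have hA : ∀ f ∈ {x | ∃ a b, F.quotD (q + 1) a b = x}, f.IsHomogeneous t := by
    rintro _ ⟨a, b, rfl⟩
    by_cases hab : F.d q a b = 0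
    · have h1 : F.quotD (q + 1) a b = 0 := hab
      rw [h1]
      exact isHomogeneous_zero _ _ _
    · obtain ⟨t', ht', hhom⟩ := F.d_homogeneous q a b hab
      have h2 : F.deg q a = q + e := hlin q (by omega) a
      have h3 : F.deg (q + 1) b = F.deg (q + 1) z := congrArg (F.deg (q + 1)) (hu b z)
      rwa [show t = t' by omega]
  -- By duality these forms generate the same ideal as its forms of degree e.
  have hte : t = e := eq_of_span_eq_of_isHomogeneous hA (fun f hf ↦ hf.2)
    (hFlast.trans hgen.symm) (by rw [← entryIdeal, hFlast]; exact hI0)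
  subst hte
  have hmin : ∀ σ ∈ nonfaces K, t ≤ σ.card := by
    intro σ hσ
    have h1 := monomial_mem_sqIdeal (k := k) hσ
    rw [← hgen] at h1
    exact le_of_mem_span_of_isHomogeneous (fun f hf ↦ hf.2) h1
      (isHomogeneous_monomial _ (degree_sqExp σ)) (by simp)
  have ht0 : t ≠ 0 := by
    rintro rfl
    apply hI0
    rw [← hgen, Ideal.span_eq_bot]
    rintro f ⟨hf, hhom⟩
    have h1 := hconst f hf
    ext d
    rw [coeff_zero]
    by_cases hd : d.degree = 0
    · rw [(Finsupp.degree_eq_zero_iff d).mp hd]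
      exact h1
    · exact hhom.coeff_eq_zero hd
  -- In each resolution the last shift exceeds all others, since t is positive for the given one, so
  -- it must occur in the other. In the squarefree resolution the shifts are sizes of subsets of the
  -- vertex set, the last one being m.
  have hcm : F.deg (q + 1) z = m := by
    have hFN : F.rank (q + 1 + 1) = 0 := hF0 (q + 1 + 1 + 1) (by omega)
    have hGN : G.toMinimal.rank (q + 1 + 1) = 0 := hr0 (q + 1 + 1 + 1) (by omega)
    apply le_antisymm
    · have h1 := F.eulerSum_ne_zero hFrank (e := F.deg (q + 1) z) (fun b ↦ by rw [hu b z])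
        (fun i hi b ↦ by rw [hlin i hi]; omega)
      rw [F.eulerSum_single_eq G.toMinimal hFN hGN] at h1
      obtain ⟨i, -, b, hb⟩ := G.toMinimal.exists_deg_eq_of_eulerSum_ne_zero h1
      rw [← hb]
      exact (Finset.card_le_univ (G.deg (i + 1) b)).trans_eq (Fintype.card_fin m)
    · have h1 := G.toMinimal.eulerSum_ne_zero (Q := q + 1) (e := m) hr1
        (fun b ↦ by
          have h2 := congrArg Finset.card (G.deg_last_eq_univ hex hcone hr1 b)
          rw [Finset.card_univ, Fintype.card_fin] at h2
          exact h2)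
        (fun i hi b ↦ (G.card_deg_lt hex (i := i + 1) (by omega) b).ne)
      rw [← F.eulerSum_single_eq G.toMinimal hFN hGN] at h1
      obtain ⟨i, hi, b, hb⟩ := F.exists_deg_eq_of_eulerSum_ne_zero h1
      rcases Nat.lt_succ_iff_lt_or_eq.mp hi with hi' | rfl
      · have := hlin i hi' b
        omega
      · rw [hu z b, hb]
  -- From m = q + 2t and m = q + 2 + n.
  have hn : maxFaceCard K = 2 * (t - 1) := by omega
  refine ⟨⟨(t : ℤ) - 2, by unfold complexDim; omega⟩, fun σ hσ ↦ ?_⟩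
  by_contra hf
  have := hmin σ hf
  omega

/-- This serves the complex without vertices, whose ideal is zero; the zero resolution works. -/
lemma hasAlmostLinearResolution_bot {I : Ideal (MvPolynomial (Fin m) k)} (hI : I = ⊥) :
    HasAlmostLinearResolution I := by
  subst hI
  refine ⟨0, ?_, { rank := fun _ ↦ 0
                   deg := fun _ ↦ Fin.elim0
                   gen := Fin.elim0
                   d := fun _ ↦ 0
                   gen_homogeneous := fun a ↦ a.elim0
                   d_homogeneous := fun _ a ↦ a.elim0
                   range_aug := ?_
                   exact_zero := Subsingleton.elim _ _
                   exact_succ := fun _ ↦ Subsingleton.elim _ _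
                   minimal := fun _ a ↦ a.elim0 }, fun i _ j _ ↦ ?_⟩
  · refine Ideal.span_eq_bot.mpr ?_
    rintro f ⟨hf, -⟩
    exact hf
  · rw [LinearMap.range_eq_bot]
    exact LinearMap.ext fun x ↦ by rw [Subsingleton.elim x 0, map_zero, map_zero]
  · simp [MinimalGradedFreeResolution.betti]

end Main

theorem proposition5p3 {k : Type*} [Field k] {m : ℕ} (K : AbstractSimplicialComplex (Fin m))
    (hK : IsGorensteinStar k K) (hne : ¬ IsSimplexBoundary K) :
    HasAlmostLinearResolution (stanleyReisnerIdeal k K) ↔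
      Odd (complexDim K) ∧ IsNeighbourly K := by
  rw [stanleyReisnerIdeal_eq]
  rcases Nat.eq_zero_or_pos m with rfl | hm
  -- Without vertices the only face is empty, the dimension is -1 = 2 · (-1) + 1, and both sides
  -- hold.
  · have hface : ∀ σ, IsFace K σ := fun σ ↦ Or.inl (Subsingleton.elim _ _)
    refine iff_of_true (hasAlmostLinearResolution_bot ?_) ⟨⟨-1, ?_⟩, fun σ _ ↦ hface σ⟩
    · refine Ideal.span_eq_bot.mpr ?_
      rintro _ ⟨σ, hσ, -⟩
      exact absurd (hface σ) hσ
    · obtain ⟨F, -, hF⟩ := exists_isFace_card_eq K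
      rw [Subsingleton.elim F ∅, Finset.card_empty] at hF
      rw [complexDim, ← hF]
      norm_num
  · exact ⟨odd_and_neighbourly_of_hasAlmostLinearResolution hK hne hm,
      fun h ↦ hasAlmostLinearResolution_of_neighbourly hK hne hm h.1 h.2⟩
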